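/- **Setting.** For a symmetric matrix $A$ let $\mathrm{Haf}(A)$ be the sum, over all perfect matchings of its index set, of the product of the entries of the matched pairs. Let $N\ge 2$ (photons) and $M$ (modes) be even with $c_1N^{\gamma}\le M\le c_2N^{\gamma}$, for fixed $\gamma>2$ and $c_1,c_2>0$. For a complex $N\times M$ matrix $X$ put $$P(X)=\mathrm{Haf}\begin{pmatrix}XX^{T}&0\\0&X^{*}X^{\dagger}\end{pmatrix},\qquad P(\eta,X)=Q(\eta)^{-1}\,\mathrm{Haf}\begin{pmatrix}XX^{T}&(1-\eta)M\tanh r\,\mathbb I_N\\(1-\eta)M\tanh r\,\mathbb I_N&X^{*}X^{\dagger}\end{pmatrix},$$ $$Q(\eta)=\bigl(1-(1-\eta)^2\tanh^2 r\bigr)^{\frac M2+N}\,{}_2F_1\!\Bigl(\tfrac{M+N}2,\tfrac{N+1}2;\tfrac12;(1-\eta)^2\tanh^2 r\Bigr).$$ Here $r\ge 0$ is the squeezing parameter with $N=\tau M\sinh^2 r$, where either $\tau=\eta$ (squeezing matched to the rate asked for) or $\tau=\eta^*$ (squeezing fixed by the maximal rate); the result holds for each of these two conventions. Let $X$ have i.i.d.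 standard complex Gaussian entries, and let $B=\binom{\frac M2+\frac N2-1}{\frac N2}N!$. * An oracle $\mathcal O$ *solves $\mathrm{GHED}_\pm$ with maximal rate $\eta^*$ and error bounds $\epsilon,\delta$* if for every $\eta\in(0,\eta^*]$ we have $|\mathcal O(\eta,X)-P(\eta,X)|\le\epsilon B$ for all $X$ outside a set of probability at most $\delta$. * *$|\mathrm{GHE}|^2_\pm$ with error bounds $\epsilon_0,\delta_0$ is solved in $\mathrm{BPP}^{\mathcal O}$* if one probabilistic oracle program, the same for all $N,M,\eta^*,\epsilon_0,\delta_0$ and $\mathcal O$, which is given $N$, $M$ and the rationals $\eta^*,\epsilon_0,\delta_0$, which may read the entries of $X$ and the answers $\mathcal O(\eta,X)$ to any number of bits at proportional cost, always stops within a number of bit operations polynomial in $N$, $\epsilon_0^{-1}$, $\delta_0^{-1}$ and the number of bits of $\eta^*,\epsilon_0,\delta_0$, and, for all $X$ outside a set of probability at most $\delta_0$, outputs with probability at least $2/3$ over its coins a rational number within $\epsilon_0B$ of $P(X)$. **Theorem.** Fix $\gamma,c_1,c_2$ and one of the two squeezing conventions. 1. Let $\eta_{\rm th}=\eta_{\rm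 th}(N)$ be any threshold with $(1-\eta_{\rm th})N=O(\log N)$. There is a polynomial $q$ such that, for all sufficiently large $N$, all rational $\eta^*\in[\eta_{\rm th},1]$ and all rational $\epsilon_0,\delta_0>0$: if $\mathcal O$ solves $\mathrm{GHED}_\pm$ with maximal rate $\eta^*$ and error bounds $0<\epsilon,\delta\le 1/q(N,\epsilon_0^{-1},\delta_0^{-1})$, then $|\mathrm{GHE}|^2_\pm$ with error bounds $\epsilon_0,\delta_0$ is solved in $\mathrm{BPP}^{\mathcal O}$. 2. There is a constant $C>0$ such that, for all $N$, all rational $\eta^*\le 1$ with $1-\eta^*\le\frac1{12\sqrt N}$ and all rational $\epsilon_0,\delta_0>0$ with $\log(N\epsilon_0^{-1}\delta_0^{-1})\ge e$, the following holds. Let $$k^*=\Bigl(\tfrac1{\eta^*}-1\Bigr)N,\qquad \chi=\exp\!\left[\frac{\log\log(N\epsilon_0^{-1}\delta_0^{-1})}{\log(N\epsilon_0^{-1}\delta_0^{-1})}\right],\qquad \alpha=6(1+\log 2.1)e^2\chi+3 .$$ If $\mathcal O$ solves $\mathrm{GHED}_\pm$ with maximal rate $\eta^*$ and error bounds $$0<\epsilon\le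 C\,\epsilon_0^3\delta_0^2N^{-3}e^{-\alpha k^*},\qquad 0<\delta\le C\,\frac{\delta_0}{k^*+\log(N\epsilon_0^{-1}\delta_0^{-1})},$$ then $|\mathrm{GHE}|^2_\pm$ with error bounds $\epsilon_0,\delta_0$ is solved in $\mathrm{BPP}^{\mathcal O}$. -/

import Mathlib

open MeasureTheory ProbabilityTheory

noncomputable section

namespace LossyGBS

/-! ## Hafnians and rescaled output probabilities -/

/-- The hafnian of a symmetric `n × n` matrix: the sum over all perfect matchings of `{0, …, n-1}`
of the product of the weights of the matched pairs. A perfect matching is encoded as an involution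
without fixed points, and each pair is counted once, through its smaller element. -/
def hafnian {n : ℕ} (A : Matrix (Fin n) (Fin n) ℂ) : ℂ :=
  ∑ σ : Equiv.Perm (Fin n) with ∀ i, σ (σ i) = i ∧ σ i ≠ i,
    ∏ i : Fin n with i < σ i, A i (σ i)

/-- The symmetric `2N × 2N` block matrix with diagonal blocks `X Xᵀ` and `X* X†` (its entrywise
conjugate), and with `c • 1` as both off-diagonal blocks. -/
def blockMatrix {N M : ℕ} (c : ℂ) (X : Matrix (Fin N) (Fin M) ℂ) :
    Matrix (Fin (N + N)) (Fin (N + N)) ℂ :=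
  Matrix.reindex finSumFinEquiv finSumFinEquiv
    (Matrix.fromBlocks (X * X.transpose) (c • (1 : Matrix (Fin N) (Fin N) ℂ))
      (c • (1 : Matrix (Fin N) (Fin N) ℂ)) (X.map star * X.conjTranspose))

/-- The rescaled ideal probability `P(X)`. -/
def idealProb {N M : ℕ} (X : Matrix (Fin N) (Fin M) ℂ) : ℂ :=
  hafnian (blockMatrix 0 X)

/-- The factor `Q(η)` for `N` photons in `M` modes (both even) with squeezing parameter `r`. -/
def Q (N M : ℕ) (r η : ℝ) : ℝ :=
  (1 - (1 - η) ^ 2 * Real.tanh r ^ 2) ^ (M / 2 + N) *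
    ordinaryHypergeometric (((M : ℝ) + N) / 2) (((N : ℝ) + 1) / 2) (1 / 2 : ℝ)
      ((1 - η) ^ 2 * Real.tanh r ^ 2)

/-- The rescaled lossy probability `P(η, X)` with squeezing parameter `r`. -/
def lossyProb {N M : ℕ} (r η : ℝ) (X : Matrix (Fin N) (Fin M) ℂ) : ℂ :=
  ((Q N M r η : ℝ) : ℂ)⁻¹ *
    hafnian (blockMatrix (((1 - η) * M * Real.tanh r : ℝ) : ℂ) X)

/-- The squeezing parameter `r ≥ 0` with `N = τ M sinh² r`. -/
def squeezing (N M : ℕ) (τ : ℝ) : ℝ :=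
  Real.arsinh (Real.sqrt ((N : ℝ) / (τ * M)))

/-- Which transmission rate the squeezing is matched to: the rate `η` at which the probability is
asked for, or the fixed maximal rate `η*`. -/
inductive SqueezingRule
  | queried
  | maximal

/-- The transmission rate `τ` in `N = τ M sinh² r`. -/
def SqueezingRule.rate (s : SqueezingRule) (ηstar η : ℝ) : ℝ :=
  match s with
  | .queried => η
  | .maximal => ηstar

/-! ## Gaussian matrices and the two estimation problems -/

/-- The standard complex Gaussian law: independent real and imaginary parts, each centred with
variance `1/2`. -/
def complexGaussian : Measure ℂ :=
  ((gaussianReal 0 (1 / 2)).prod (gaussianReal 0 (1 / 2))).map fun p : ℝ × ℝ => ⟨p.1, p.2⟩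

/-- The law of an `N × M` array of i.i.d. standard complex Gaussians. -/
def gaussianLaw (N M : ℕ) : Measure (Fin N → Fin M → ℂ) :=
  Measure.pi fun _ => Measure.pi fun _ => complexGaussian

/-- The unit in which additive errors are measured: `binom(M/2 + N/2 - 1, N/2) N!`. -/
def errorUnit (N M : ℕ) : ℝ :=
  ((M / 2 + N / 2 - 1).choose (N / 2) : ℝ) * (N.factorial : ℝ)

/-- An oracle is asked with a transmission rate and a matrix and answers with a number. -/
abbrev Oracle (N M : ℕ) := ℝ → Matrix (Fin N) (Fin M) ℂ → ℝ

/-- `O` solves the problem `GHED±` with maximal rate `ηstar` and error bounds `ε`, `δ`: for every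
rate `η ∈ (0, ηstar]`, its answer is within `ε * errorUnit` of `P(η, X)` for all Gaussian `X`
outside a set of probability at most `δ`. -/
def SolvesGHED (s : SqueezingRule) {N M : ℕ} (ηstar ε δ : ℝ) (O : Oracle N M) : Prop :=
  ∀ η : ℝ, 0 < η → η ≤ ηstar →
    gaussianLaw N M {X | ε * errorUnit N M <
        ‖((O η (Matrix.of X) : ℝ) : ℂ) -
          lossyProb (squeezing N M (s.rate ηstar η)) η (Matrix.of X)‖}
      ≤ ENNReal.ofReal δ

/-! ## Probabilistic oracle machines with bit-cost time

A program acts on finitely many integer registers. Arithmetic is charged by bit length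
(schoolbook cost), so that a polynomial number of steps is polynomial time on a Turing machine.
The matrix `X` is an infinite-precision input: its entries can be read to any number of bits
at a cost proportional to that number, and it can be handed to the oracle. -/

/-- Bit length of an integer. -/
def bits (a : ℤ) : ℕ := a.natAbs.size

/-- Arithmetic expressions over the registers. -/
inductive Expr
  | reg (i : ℕ)
  | lit (c : ℤ)
  | add (a b : Expr)
  | sub (a b : Expr)
  | mul (a b : Expr)
  | div (a b : Expr)

/-- The value of an expression; division is floor division. -/
def Expr.val (m : ℕ → ℤ) : Expr → ℤ
  | .reg i => m i
  | .lit c => c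
  | .add a b => a.val m + b.val m
  | .sub a b => a.val m - b.val m
  | .mul a b => a.val m * b.val m
  | .div a b => Int.fdiv (a.val m) (b.val m)

/-- The time needed to evaluate an expression. -/
def Expr.cost (m : ℕ → ℤ) : Expr → ℕ
  | .reg i => 1 + bits (m i)
  | .lit c => 1 + bits c
  | .add a b => a.cost m + b.cost m + (1 + bits (a.val m)) * (1 + bits (b.val m))
  | .sub a b => a.cost m + b.cost m + (1 + bits (a.val m)) * (1 + bits (b.val m))
  | .mul a b => a.cost m + b.cost m + (1 + bits (a.val m)) * (1 + bits (b.val m))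
  | .div a b => a.cost m + b.cost m + (1 + bits (a.val m)) * (1 + bits (b.val m))

/-- Programs. `loop e p` repeats `p` as often as the value of `e` says on entry;
`flip i` puts a fair coin flip into register `i`;
`entry i im j k b` reads the real (or, if `im`, the imaginary) part of an entry of `X` to `b` bits;
`ask i e d b` asks the oracle at transmission rate `e / d` and at `X`, and reads its answer
to `b` bits. -/
inductive Program
  | skip
  | assign (i : ℕ) (e : Expr)
  | seq (p q : Program)
  | branch (e : Expr) (p q : Program)
  | loop (e : Expr) (p : Program)
  | flip (i : ℕ)
  | entry (i : ℕ) (im : Bool) (j k b : Expr)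
  | ask (i : ℕ) (e d b : Expr)

/-- A configuration: the registers, the number of coins flipped, and the time spent so far. -/
structure Config where
  reg : ℕ → ℤ
  coins : ℕ
  time : ℕ

/-- Spend `t` units of time. -/
def Config.spend (c : Config) (t : ℕ) : Config := { c with time := c.time + t }

/-- Put `a` into register `i`. -/
def Config.set (c : Config) (i : ℕ) (a : ℤ) : Config := { c with reg := Function.update c.reg i a }

/-- A real number read with `b` bits before and `b` bits after the binary point: the floor of
`2 ^ b * x`, cut off at `± 4 ^ b`. -/
def readReal (b : ℕ) (x : ℝ) : ℤ := max (-(4 ^ b)) (min (4 ^ b) ⌊2 ^ b * x⌋)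

/-- The real or imaginary part of an entry of `X`, and `0` for indices out of range. -/
def entryPart {N M : ℕ} (X : Matrix (Fin N) (Fin M) ℂ) (im : Bool) (j k : ℤ) : ℝ :=
  if h : (0 ≤ j ∧ j.toNat < N) ∧ 0 ≤ k ∧ k.toNat < M then
    (if im then (X ⟨j.toNat, h.1.2⟩ ⟨k.toNat, h.2.2⟩).im
      else (X ⟨j.toNat, h.1.2⟩ ⟨k.toNat, h.2.2⟩).re)
  else 0

/-- Run a program with oracle `O` on the matrix `X` with coin flips `ω`. -/
def Program.run {N M : ℕ} (O : Oracle N M) (X : Matrix (Fin N) (Fin M) ℂ) (ω : ℕ → Bool) :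
    Program → Config → Config
  | .skip, c => c.spend 1
  | .assign i e, c => (c.set i (e.val c.reg)).spend (1 + e.cost c.reg)
  | .seq p q, c => q.run O X ω (p.run O X ω c)
  | .branch e p q, c =>
      if 0 < e.val c.reg then p.run O X ω (c.spend (1 + e.cost c.reg))
      else q.run O X ω (c.spend (1 + e.cost c.reg))
  | .loop e p, c =>
      (fun c' => (p.run O X ω c').spend 1)^[(e.val c.reg).toNat] (c.spend (1 + e.cost c.reg))
  | .flip i, c =>
      { reg := Function.update c.reg i (if ω c.coins then 1 else 0)
        coins := c.coins + 1
        time := c.time + 1 }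
  | .entry i im j k b, c =>
      (c.set i (readReal (b.val c.reg).toNat (entryPart X im (j.val c.reg) (k.val c.reg)))).spend
        (1 + j.cost c.reg + k.cost c.reg + b.cost c.reg + 2 * (b.val c.reg).toNat)
  | .ask i e d b, c =>
      (c.set i (readReal (b.val c.reg).toNat (O ((e.val c.reg : ℝ) / (d.val c.reg : ℝ)) X))).spend
        (1 + e.cost c.reg + d.cost c.reg + b.cost c.reg + 2 * (b.val c.reg).toNat)

/-- The initial configuration: `N`, `M` and the numerators and denominators of `η*`, `ε₀`, `δ₀`
in registers `0, …, 7`. -/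
def initial (N M : ℕ) (ηstar ε₀ δ₀ : ℚ) : Config where
  reg := fun i => match i with
    | 0 => N
    | 1 => M
    | 2 => ηstar.num
    | 3 => ηstar.den
    | 4 => ε₀.num
    | 5 => ε₀.den
    | 6 => δ₀.num
    | 7 => δ₀.den
    | _ => 0
  coins := 0
  time := 0

/-- The rational number that a final configuration returns: register `0` over register `1`. -/
def Config.output (c : Config) : ℝ := (c.reg 0 : ℝ) / (c.reg 1 : ℝ)

/-- The law of an infinite sequence of fair coin flips. -/
def coinLaw : Measure (ℕ → Bool) :=
  Measure.infinitePi fun _ => (PMF.uniformOfFintype Bool).toMeasure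

/-- The number of bits of the rational parameters. -/
def paramBits (ηstar ε₀ δ₀ : ℚ) : ℕ :=
  bits ηstar.num + bits ηstar.den + bits ε₀.num + bits ε₀.den + bits δ₀.num + bits δ₀.den

/-- With oracle `O`, the program `p` solves the problem `|GHE|²±` with error bounds `ε₀`, `δ₀` in
the sense of `BPP^O`: on every matrix and all coin flips it stops within time
`K (N + 1/ε₀ + 1/δ₀ + number of bits of the parameters) ^ K`, and for all Gaussian `X` outside a set
of probability at most `δ₀`, with probability at least `2/3` over the coins its output is within
`ε₀ * errorUnit` of `P(X)`. -/
def SolvesGHE (p : Program) (K : ℕ) {N M : ℕ} (ηstar ε₀ δ₀ : ℚ) (O : Oracle N M) : Prop :=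
  (∀ (X : Matrix (Fin N) (Fin M) ℂ) (ω : ℕ → Bool),
    ((p.run O X ω (initial N M ηstar ε₀ δ₀)).time : ℝ) ≤
      K * ((N : ℝ) + (ε₀ : ℝ)⁻¹ + (δ₀ : ℝ)⁻¹ + paramBits ηstar ε₀ δ₀) ^ K) ∧
  gaussianLaw N M {X | coinLaw {ω |
      ‖(((p.run O (Matrix.of X) ω (initial N M ηstar ε₀ δ₀)).output : ℝ) : ℂ) -
        idealProb (Matrix.of X)‖ ≤ (ε₀ : ℝ) * errorUnit N M} < 2 / 3}
    ≤ ENNReal.ofReal δ₀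

/-! ## Parameters of the reduction -/

/-- The dilute regime `M ∝ N ^ γ`, with numbers of photons and modes positive and even. -/
structure Dilute (γ c₁ c₂ : ℝ) (N M : ℕ) : Prop where
  pos : 0 < N
  even_photons : Even N
  even_modes : Even M
  lower : c₁ * (N : ℝ) ^ γ ≤ M
  upper : (M : ℝ) ≤ c₂ * (N : ℝ) ^ γ

/-- `k* = (1/η* - 1) N`. -/
def kStar (N : ℕ) (ηstar : ℝ) : ℝ := (1 / ηstar - 1) * N

/-- `log (N ε₀⁻¹ δ₀⁻¹)`. -/
def logSize (N : ℕ) (ε₀ δ₀ : ℝ) : ℝ := Real.log (N * ε₀⁻¹ * δ₀⁻¹)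

/-- `χ`. -/
def chi (N : ℕ) (ε₀ δ₀ : ℝ) : ℝ :=
  Real.exp (Real.log (logSize N ε₀ δ₀) / logSize N ε₀ δ₀)

/-- `α`. -/
def alpha (N : ℕ) (ε₀ δ₀ : ℝ) : ℝ :=
  6 * (1 + Real.log 2.1) * Real.exp 1 ^ 2 * chi N ε₀ δ₀ + 3

end LossyGBS

end

noncomputable section

namespace LossyGBS

/-! ## Expansion of hafnians -/

section Hafnian

variable {ι : Type*} [Fintype ι] [LinearOrder ι]

/-! Write `u = 1 - η` and `z = u² tanh² r`. In a matching of the `2N` indices of the block matrix, a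
pair joining the two blocks must join an index to its own copy. Summing over the set `S` of indices
matched in this way gives `∑ c^|S| |Haf((XXᵀ) on Sᶜ)|²` (`hafnian_blockMatrix`). For even `N` only
even `|S|` contribute, so `Q(η) P(η, X)` is a polynomial in `z` with nonnegative coefficients and
constant term `P(X)` (`hafnian_blockMatrix_eq_lossPoly`, `lossCoeff_zero`). Euler's transformation
turns `Q` into an explicit polynomial in `z` (`Q_eq_qPoly`), hence into a computable factor. The
task is then to extrapolate a polynomial to `z = 0` from its noisy values at rates at most `η*`.

The degree `N / 2` is too large for a stable extrapolation, so the polynomial is treated as one of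
smaller degree `d`. Expanding `Haf(XXᵀ)` into monomials that are orthonormal under the Gaussian law
gives its second moment exactly (`integral_hafSq`). It follows that the coefficient of `z^j` times
`z^j` has expectation at most `B (NMz)^j / (2j)!` (`integral_lossCoeff_le`). At the nodes used `NMz
≤ (4g)²`, where `g` is an integer above `(1 - η*) N`. Once `d ≥ 32 g` the terms of degree above `d`
have total expectation at most `B 32^(-d) / 16` (`sum_tail_le`), and Markov's inequality makes them
small with high probability.

The losses at the nodes are equally spaced between `u₀` and `3 u₀`, with `u₀` slightly above `1 -
η*`. Then `z` grows at least like the square of the loss under either squeezing rule, and the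
absolute values of the extrapolation weights sum to at most `e^(2d)` (`sum_abs_weight_le`). This
amplification is beaten by the decay `32^(-d)` of the tail. The oracle error is amplified by
`e^(2d)` and by `Q ≤ e^(4g)`. With `d = ⌈log₃(N / (ε₀ δ₀))⌉ + 32 g`, up to rounding of the argument
of the logarithm, this costs a constant times `(N / (ε₀ δ₀))² e^(68 k*)`, and `68 ≤ α`.
`measure_estimate_error_le` collects the exceptional sets: a failing oracle answer, a large tail,
and a value too large to be read.

The algorithm is deterministic and computes with exact integer fractions. `Program.wp` is a calculus
of preconditions that bounds register lengths and loop counts together with functional correctness;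
`Program.wp_sound` converts it into a bound on the running time, and `PolyBounded` shows that bound
to be polynomial. The first half of the theorem replaces `ε₀`, `δ₀` by their minima with `1` and
uses that `e^(68 k*)` is polynomial in `N` when the loss is logarithmic. -/

/-- The involutions whose set of moved points is `S`. -/
def matchings (S : Finset ι) : Finset (Equiv.Perm ι) :=
  Finset.univ.filter fun σ => ∀ i, σ (σ i) = i ∧ (σ i ≠ i ↔ i ∈ S)

/-- The hafnian of the principal submatrix of `A` with index set `S`. -/
def hafOn (A : Matrix ι ι ℂ) (S : Finset ι) : ℂ :=
  ∑ σ ∈ matchings S, ∏ i : ι with i < σ i, A i (σ i)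

lemma mem_matchings {S : Finset ι} {σ : Equiv.Perm ι} :
    σ ∈ matchings S ↔ ∀ i, σ (σ i) = i ∧ (σ i ≠ i ↔ i ∈ S) := by
  simp [matchings]

lemma hafnian_eq_hafOn {n : ℕ} (A : Matrix (Fin n) (Fin n) ℂ) :
    hafnian A = hafOn A Finset.univ := by
  unfold hafnian hafOn
  refine Finset.sum_congr ?_ fun _ _ => rfl
  ext σ
  simp [matchings]

lemma hafOn_empty (A : Matrix ι ι ℂ) : hafOn A ∅ = 1 := by
  have : matchings (∅ : Finset ι) = {1} := by
    ext σ
    rw [mem_matchings, Finset.mem_singleton]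
    constructor
    · intro h
      ext i
      have := (h i).2
      simp at this
      simpa using this
    · rintro rfl i
      simp
  rw [hafOn, this]
  simp

lemma swap_mul_mem_matchings {S : Finset ι} {a b : ι} (hab : a ≠ b)
    {σ : Equiv.Perm ι} (hσ : σ ∈ matchings S) (h : σ a = b) :
    Equiv.swap a b * σ ∈ matchings ((S.erase a).erase b) := by
  rw [mem_matchings] at *
  have hb : σ b = a := by rw [← h]; exact (hσ a).1
  intro i
  by_cases hia : i = a
  · subst hia; simp [h]
  by_cases hib : i = b
  · subst hib; simp [hb]
  have h1 : σ i ≠ a := fun e => hib (by rw [← (hσ i).1, e, h])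
  have h2 : σ i ≠ b := fun e => hia (by rw [← (hσ i).1, e, hb])
  simp only [Equiv.Perm.mul_apply, Equiv.swap_apply_of_ne_of_ne h1 h2, (hσ i).1,
    Equiv.swap_apply_of_ne_of_ne hia hib, (hσ i).2, Finset.mem_erase]
  tauto

lemma swap_mul_mem_matchings' {S : Finset ι} {a b : ι} (hab : a ≠ b) (ha : a ∈ S) (hb : b ∈ S)
    {σ : Equiv.Perm ι} (hσ : σ ∈ matchings ((S.erase a).erase b)) :
    Equiv.swap a b * σ ∈ matchings S ∧ (Equiv.swap a b * σ) a = b := by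
  rw [mem_matchings] at *
  have h1 : σ a = a := by have := (hσ a).2; simp at this; exact this
  have h2 : σ b = b := by have := (hσ b).2; simp at this; exact this
  refine ⟨fun i => ?_, by simp [h1]⟩
  by_cases hia : i = a
  · subst hia; simp [h1, h2, ha, hab.symm]
  by_cases hib : i = b
  · subst hib; simp [h1, h2, hb, hab]
  have h3 : σ i ≠ a := fun e => hia (by rw [← (hσ i).1, e, h1])
  have h4 : σ i ≠ b := fun e => hib (by rw [← (hσ i).1, e, h2])
  simp only [Equiv.Perm.mul_apply, Equiv.swap_apply_of_ne_of_ne h3 h4, (hσ i).1,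
    Equiv.swap_apply_of_ne_of_ne hia hib, (hσ i).2, Finset.mem_erase]
  tauto

/-- Expansion of the hafnian along its first row. -/
lemma hafOn_eq_sum (A : Matrix ι ι ℂ) {S : Finset ι} {a : ι} (ha : a ∈ S)
    (hmin : ∀ b ∈ S, a ≤ b) :
    hafOn A S = ∑ b ∈ S.erase a, A a b * hafOn A ((S.erase a).erase b) := by
  have hmaps : ∀ σ ∈ matchings S, σ a ∈ S.erase a := by
    intro σ hσ
    rw [mem_matchings] at hσ
    have h1 : σ a ≠ a := (hσ a).2.2 ha
    refine Finset.mem_erase.2 ⟨h1, (hσ _).2.1 ?_⟩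
    rw [(hσ a).1]; exact h1.symm
  rw [hafOn, ← Finset.sum_fiberwise_of_maps_to hmaps]
  refine Finset.sum_congr rfl fun b hb => ?_
  obtain ⟨hba, hbS⟩ := Finset.mem_erase.1 hb
  -- Minimality makes `a` the element through which its pair is counted, so the weight is `A a b`;
  -- symmetry of `A` is never needed.
  have hab : a < b := lt_of_le_of_ne (hmin b hbS) hba.symm
  rw [hafOn, Finset.mul_sum]
  -- Composing with the transposition of `a` and `b` unmatches this pair and leaves all others
  -- alone, and it is its own inverse.
  refine Finset.sum_bij' (fun σ _ => Equiv.swap a b * σ) (fun σ _ => Equiv.swap a b * σ)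
    ?_ ?_ ?_ ?_ ?_
  · intro σ hσ
    rw [Finset.mem_filter] at hσ
    exact swap_mul_mem_matchings hab.ne hσ.1 hσ.2
  · intro σ hσ
    rw [Finset.mem_filter]
    exact swap_mul_mem_matchings' hab.ne ha hbS hσ
  · intro σ _; simp [← mul_assoc]
  · intro σ _; simp [← mul_assoc]
  · intro σ hσ
    rw [Finset.mem_filter] at hσ
    obtain ⟨hσ, hσa⟩ := hσ
    rw [mem_matchings] at hσ
    have hσb : σ b = a := by rw [← hσa]; exact (hσ a).1
    have hne : ∀ i, i ≠ a → i ≠ b → (Equiv.swap a b * σ) i = σ i := by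
      intro i hia hib
      have h1 : σ i ≠ a := fun e => hib (by rw [← (hσ i).1, e, hσa])
      have h2 : σ i ≠ b := fun e => hia (by rw [← (hσ i).1, e, hσb])
      simp [Equiv.swap_apply_of_ne_of_ne h1 h2]
    have hset : (Finset.univ.filter fun i => i < σ i) =
        insert a (Finset.univ.filter fun i => i < (Equiv.swap a b * σ) i) := by
      ext i
      simp only [Finset.mem_filter, Finset.mem_univ, true_and, Finset.mem_insert]
      by_cases hia : i = a
      · subst hia; simp [hσa, hab]
      by_cases hib : i = b
      · subst hib
        simp only [hσb, Equiv.Perm.mul_apply, Equiv.swap_apply_left, lt_self_iff_false, or_false,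
          hia, iff_false, not_lt]
        exact hab.le
      rw [hne i hia hib]; simp [hia]
    rw [hset, Finset.prod_insert (by rw [Finset.mem_filter, Equiv.Perm.mul_apply, hσa]; simp), hσa]
    congr 1
    refine Finset.prod_congr rfl fun i hi => ?_
    rw [Finset.mem_filter] at hi
    by_cases hia : i = a
    · subst hia; simp [hσa] at hi
    by_cases hib : i = b
    · subst hib; simp [hσb] at hi
    rw [hne i hia hib]

lemma hafOn_eq_zero_of_odd (A : Matrix ι ι ℂ) (S : Finset ι) (h : Odd S.card) :
    hafOn A S = 0 := by
  induction hn : S.card using Nat.strong_induction_on generalizing S with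
  | _ n ih =>
    have hne : S.Nonempty := by
      rw [← Finset.card_pos]; exact h.pos
    rw [hafOn_eq_sum A (S.min'_mem hne) fun b hb => S.min'_le b hb]
    refine Finset.sum_eq_zero fun b hb => ?_
    have h1 := Finset.card_erase_of_mem (S.min'_mem hne)
    have h2 := Finset.card_erase_of_mem hb
    have h3 : 0 < (S.erase (S.min' hne)).card := Finset.card_pos.2 ⟨b, hb⟩
    have h4 : Odd ((S.erase (S.min' hne)).erase b).card := by
      rw [h2, h1]; rw [h1] at h3
      obtain ⟨k, hk⟩ := h
      exact ⟨k - 1, by omega⟩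
    rw [ih _ (by omega) _ h4 rfl, mul_zero]

lemma hafOn_map_star (A : Matrix ι ι ℂ) (S : Finset ι) :
    hafOn (A.map star) S = star (hafOn A S) := by
  simp [hafOn, Matrix.map_apply]

end Hafnian

/-! ### Hafnians of block matrices with scalar off-diagonal blocks -/

section Block

variable {N : ℕ}

/-- The matrix with the blocks `A`, `c • 1`, `c • 1`, `B`. -/
def twoBlock (A B : Matrix (Fin N) (Fin N) ℂ) (c : ℂ) : Matrix (Fin (N + N)) (Fin (N + N)) ℂ :=
  Matrix.reindex finSumFinEquiv finSumFinEquiv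
    (Matrix.fromBlocks A (c • (1 : Matrix (Fin N) (Fin N) ℂ))
      (c • (1 : Matrix (Fin N) (Fin N) ℂ)) B)

/-- The index set with parts `S` and `T` in the two blocks. -/
def blockSet (S T : Finset (Fin N)) : Finset (Fin (N + N)) :=
  (S.disjSum T).map finSumFinEquiv.toEmbedding

lemma blockSet_erase_inl (S T : Finset (Fin N)) (i : Fin N) :
    (blockSet S T).erase (finSumFinEquiv (Sum.inl i)) = blockSet (S.erase i) T := by
  ext x
  obtain ⟨y, rfl⟩ := finSumFinEquiv.surjective x
  rcases y with y | y <;> simp [blockSet, -finSumFinEquiv_apply_left, -finSumFinEquiv_apply_right]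

lemma blockSet_erase_inr (S T : Finset (Fin N)) (i : Fin N) :
    (blockSet S T).erase (finSumFinEquiv (Sum.inr i)) = blockSet S (T.erase i) := by
  ext x
  obtain ⟨y, rfl⟩ := finSumFinEquiv.surjective x
  rcases y with y | y <;> simp [blockSet, -finSumFinEquiv_apply_left, -finSumFinEquiv_apply_right]

lemma sum_blockSet (S T : Finset (Fin N)) (f : Fin (N + N) → ℂ) :
    ∑ x ∈ blockSet S T, f x =
      ∑ i ∈ S, f (finSumFinEquiv (Sum.inl i)) + ∑ i ∈ T, f (finSumFinEquiv (Sum.inr i)) := by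
  simp [blockSet, Finset.sum_map, Finset.sum_disjSum]

lemma mem_blockSet_inl {S T : Finset (Fin N)} {i : Fin N} :
    finSumFinEquiv (Sum.inl i) ∈ blockSet S T ↔ i ∈ S := by
  simp [blockSet, -finSumFinEquiv_apply_left]

lemma mem_blockSet_inr {S T : Finset (Fin N)} {i : Fin N} :
    finSumFinEquiv (Sum.inr i) ∈ blockSet S T ↔ i ∈ T := by
  simp [blockSet, -finSumFinEquiv_apply_right]

/-- Base case of the expansion below: without indices of the first block only entries of `B` are
met, and the embedding of the second block preserves the order. -/
lemma hafOn_twoBlock_empty (A B : Matrix (Fin N) (Fin N) ℂ) (c : ℂ) (T : Finset (Fin N)) :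
    hafOn (twoBlock A B c) (blockSet ∅ T) = hafOn B T := by
  induction hn : T.card using Nat.strong_induction_on generalizing T with
  | _ n ih =>
    rcases T.eq_empty_or_nonempty with rfl | hne
    · rw [hafOn_empty]
      have : blockSet (∅ : Finset (Fin N)) ∅ = ∅ := by simp [blockSet]
      rw [this, hafOn_empty]
    have ha := T.min'_mem hne
    rw [hafOn_eq_sum B ha fun b hb => T.min'_le b hb,
      hafOn_eq_sum (twoBlock A B c) (a := finSumFinEquiv (Sum.inr (T.min' hne)))
        (mem_blockSet_inr.2 ha), blockSet_erase_inr, sum_blockSet, Finset.sum_empty, zero_add]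
    · refine Finset.sum_congr rfl fun b hb => ?_
      have h1 := Finset.card_erase_of_mem ha
      have h2 := Finset.card_erase_of_mem hb
      have h3 : 0 < T.card := Finset.card_pos.2 hne
      rw [blockSet_erase_inr, ih _ (by omega) _ rfl]
      simp [twoBlock, -finSumFinEquiv_apply_left, -finSumFinEquiv_apply_right]
    · intro x hx
      obtain ⟨y, rfl⟩ := finSumFinEquiv.surjective x
      rcases y with y | y
      · rw [mem_blockSet_inl] at hx; simp at hx
      · rw [mem_blockSet_inr] at hx
        have := T.min'_le y hx
        simp only [finSumFinEquiv_apply_right, Fin.le_def, Fin.val_natAdd]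
        rw [Fin.le_def] at this
        omega

/-- The off-diagonal blocks are scalar, so a pair across the blocks joins an index to its own copy.
`U` collects the indices matched in this way, and what remains splits into independent matchings in
the two blocks. The induction expands along the least index `a` of `S`. -/
lemma hafOn_twoBlock (A B : Matrix (Fin N) (Fin N) ℂ) (c : ℂ) (S T : Finset (Fin N)) :
    hafOn (twoBlock A B c) (blockSet S T) =
      ∑ U ∈ (S ∩ T).powerset, c ^ U.card * (hafOn A (S \ U) * hafOn B (T \ U)) := by
  induction hn : S.card using Nat.strong_induction_on generalizing S T with
  | _ n ih =>
    rcases S.eq_empty_or_nonempty with rfl | hne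
    · rw [hafOn_twoBlock_empty]; simp [hafOn_empty]
    have ha := S.min'_mem hne
    set a := S.min' hne with hadef
    have hmin : ∀ b ∈ S, a ≤ b := fun b hb => S.min'_le b hb
    have hSpos : 0 < S.card := Finset.card_pos.2 hne
    have h1 := Finset.card_erase_of_mem ha
    rw [hafOn_eq_sum (twoBlock A B c) (a := finSumFinEquiv (Sum.inl a)) (mem_blockSet_inl.2 ha),
      blockSet_erase_inl, sum_blockSet]
    swap
    · intro x hx
      obtain ⟨y, rfl⟩ := finSumFinEquiv.surjective x
      rcases y with y | y
      · rw [mem_blockSet_inl] at hx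
        have h2 := hmin y hx
        simp only [finSumFinEquiv_apply_left, Fin.le_def, Fin.val_castAdd]
        exact h2
      · simp only [finSumFinEquiv_apply_right, finSumFinEquiv_apply_left, Fin.le_def,
          Fin.val_natAdd, Fin.val_castAdd]
        omega
    have hA : ∀ b ∈ S.erase a,
        twoBlock A B c (finSumFinEquiv (Sum.inl a)) (finSumFinEquiv (Sum.inl b)) *
          hafOn (twoBlock A B c) ((blockSet (S.erase a) T).erase (finSumFinEquiv (Sum.inl b))) =
        ∑ U ∈ (((S.erase a).erase b) ∩ T).powerset,
          A a b * (c ^ U.card * (hafOn A (((S.erase a).erase b) \ U) * hafOn B (T \ U))) := by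
      intro b hb
      have h2 := Finset.card_erase_of_mem hb
      rw [blockSet_erase_inl, ih _ (by omega) _ _ rfl, Finset.mul_sum]
      simp [twoBlock, -finSumFinEquiv_apply_left, -finSumFinEquiv_apply_right]
    -- A partner of `a` in the second block can only be its own copy; these are the terms with `a ∈
    -- U`.
    have hB : ∑ b ∈ T,
        twoBlock A B c (finSumFinEquiv (Sum.inl a)) (finSumFinEquiv (Sum.inr b)) *
          hafOn (twoBlock A B c) ((blockSet (S.erase a) T).erase (finSumFinEquiv (Sum.inr b))) =
        ∑ U ∈ ((S ∩ T).powerset).filter (fun U => a ∈ U),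
          c ^ U.card * (hafOn A (S \ U) * hafOn B (T \ U)) := by
      have hent : ∀ b, twoBlock A B c (finSumFinEquiv (Sum.inl a)) (finSumFinEquiv (Sum.inr b)) =
          if a = b then c else 0 := by
        intro b
        simp [twoBlock, -finSumFinEquiv_apply_left, -finSumFinEquiv_apply_right, Matrix.one_apply]
      simp only [hent, ite_mul, zero_mul, Finset.sum_ite_eq]
      split_ifs with haT
      · rw [blockSet_erase_inr, ih _ (by omega) _ _ rfl, Finset.mul_sum]
        refine Finset.sum_bij' (fun U _ => insert a U) (fun U _ => U.erase a) ?_ ?_ ?_ ?_ ?_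
        · intro U hU
          rw [Finset.mem_powerset] at hU
          rw [Finset.mem_filter, Finset.mem_powerset]
          refine ⟨Finset.insert_subset (Finset.mem_inter.2 ⟨ha, haT⟩) fun x hx => ?_, by simp⟩
          have := hU hx
          simp only [Finset.mem_inter, Finset.mem_erase] at this ⊢
          tauto
        · intro U hU
          rw [Finset.mem_filter, Finset.mem_powerset] at hU
          rw [Finset.mem_powerset]
          intro x hx
          rw [Finset.mem_erase] at hx
          have := hU.1 hx.2
          simp only [Finset.mem_inter, Finset.mem_erase] at this ⊢
          tauto
        · intro U hU
          rw [Finset.mem_powerset] at hU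
          have : a ∉ U := fun h => by simpa using hU h
          simp [this]
        · intro U hU
          rw [Finset.mem_filter] at hU
          exact Finset.insert_erase hU.2
        · intro U hU
          rw [Finset.mem_powerset] at hU
          have haU : a ∉ U := fun h => by simpa using hU h
          have e1 : (S.erase a) \ U = S \ insert a U := by
            ext x; simp only [Finset.mem_sdiff, Finset.mem_erase, Finset.mem_insert]; tauto
          have e2 : (T.erase a) \ U = T \ insert a U := by
            ext x; simp only [Finset.mem_sdiff, Finset.mem_erase, Finset.mem_insert]; tauto
          rw [e1, e2, Finset.card_insert_of_notMem haU, pow_succ]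
          ring
      · rw [Finset.filter_false_of_mem, Finset.sum_empty]
        intro U hU h
        rw [Finset.mem_powerset] at hU
        exact haT (Finset.mem_inter.1 (hU h)).2
    rw [hB, Finset.sum_congr rfl hA,
      ← Finset.sum_filter_add_sum_filter_not ((S ∩ T).powerset) (fun U => a ∈ U), add_comm]
    congr 1
    -- For `a ∉ U` the partner `b` of `a` lies in the first block. Choosing `b` before `U` or `U`
    -- before `b` gives the same pairs, so the two sums are interchanged.
    rw [Finset.sum_sigma', eq_comm]
    have hexp : ∀ U ∈ ((S ∩ T).powerset).filter (fun U => a ∉ U),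
        c ^ U.card * (hafOn A (S \ U) * hafOn B (T \ U)) =
        ∑ b ∈ (S \ U).erase a,
          A a b * (c ^ U.card * (hafOn A (((S \ U).erase a).erase b) * hafOn B (T \ U))) := by
      intro U hU
      rw [Finset.mem_filter] at hU
      rw [hafOn_eq_sum A (S := S \ U) (a := a) (Finset.mem_sdiff.2 ⟨ha, hU.2⟩)
        fun b hb => hmin b (Finset.mem_sdiff.1 hb).1, Finset.sum_mul, Finset.mul_sum]
      refine Finset.sum_congr rfl fun b _ => ?_
      ring
    rw [Finset.sum_congr rfl hexp, Finset.sum_sigma']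
    refine Finset.sum_bij' (fun x _ => ⟨x.2, x.1⟩) (fun x _ => ⟨x.2, x.1⟩) ?_ ?_ ?_ ?_ ?_
    · rintro ⟨U, b⟩ h
      simp only [Finset.mem_sigma, Finset.mem_filter, Finset.mem_powerset, Finset.mem_erase,
        Finset.mem_sdiff] at h ⊢
      refine ⟨⟨h.2.1, h.2.2.1⟩, fun x hx => ?_⟩
      have h3 := h.1.1 hx
      simp only [Finset.mem_inter, Finset.mem_erase] at h3 ⊢
      refine ⟨⟨?_, ?_, h3.1⟩, h3.2⟩
      · rintro rfl; exact h.2.2.2 hx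
      · rintro rfl; exact h.1.2 hx
    · rintro ⟨b, U⟩ h
      simp only [Finset.mem_sigma, Finset.mem_filter, Finset.mem_powerset, Finset.mem_erase,
        Finset.mem_sdiff] at h ⊢
      refine ⟨⟨fun x hx => ?_, fun hx => ?_⟩, h.1.1, h.1.2, fun hx => ?_⟩
      · have h3 := h.2 hx
        simp only [Finset.mem_inter, Finset.mem_erase] at h3 ⊢
        tauto
      · have h3 := h.2 hx
        simp at h3
      · have h3 := h.2 hx
        simp at h3
    · intro _ _; rfl
    · intro _ _; rfl
    · rintro ⟨U, b⟩ h
      have e1 : ((S \ U).erase a).erase b = ((S.erase a).erase b) \ U := by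
        ext x; simp only [Finset.mem_sdiff, Finset.mem_erase]; tauto
      rw [e1]

lemma blockMatrix_eq_twoBlock {M : ℕ} (c : ℂ) (X : Matrix (Fin N) (Fin M) ℂ) :
    blockMatrix c X = twoBlock (X * X.transpose) ((X * X.transpose).map star) c := by
  unfold blockMatrix twoBlock
  congr 2
  ext i j
  simp [Matrix.mul_apply]

/-- The squared modulus of a principal subhafnian of `X Xᵀ`. -/
def hafSq {M : ℕ} (X : Matrix (Fin N) (Fin M) ℂ) (S : Finset (Fin N)) : ℝ :=
  ‖hafOn (X * X.transpose) S‖ ^ 2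

/-- The two diagonal blocks are entrywise conjugates, so their subhafnians multiply to a squared
modulus. All coefficients in `c` are therefore nonnegative. -/
lemma hafnian_blockMatrix {M : ℕ} (c : ℂ) (X : Matrix (Fin N) (Fin M) ℂ) :
    hafnian (blockMatrix c X) =
      ∑ S : Finset (Fin N), c ^ S.card * (hafSq X Sᶜ : ℂ) := by
  have h : (Finset.univ : Finset (Fin (N + N))) = blockSet Finset.univ Finset.univ := by
    ext x
    obtain ⟨y, rfl⟩ := finSumFinEquiv.surjective x
    rcases y with y | y
    · simp [mem_blockSet_inl, -finSumFinEquiv_apply_left]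
    · simp [mem_blockSet_inr, -finSumFinEquiv_apply_right]
  rw [hafnian_eq_hafOn, blockMatrix_eq_twoBlock, h, hafOn_twoBlock]
  simp only [Finset.inter_self, Finset.powerset_univ]
  refine Finset.sum_congr rfl fun S _ => ?_
  rw [hafOn_map_star, ← Finset.compl_eq_univ_sdiff, hafSq]
  congr 1
  rw [Complex.star_def, Complex.mul_conj, Complex.normSq_eq_norm_sq]

lemma idealProb_eq {M : ℕ} (X : Matrix (Fin N) (Fin M) ℂ) :
    idealProb X = (hafSq X Finset.univ : ℂ) := by
  rw [idealProb, hafnian_blockMatrix, Finset.sum_eq_single ∅]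
  · simp
  · intro S _ hS
    rw [zero_pow (by simpa using hS), zero_mul]
  · simp

end Block

/-! ## Moments of Gaussian hafnians -/

section Counting

/-- The number of perfect matchings of `n` points: `(n-1)!!` for even `n`, zero for odd `n`. -/
def matchingCount : ℕ → ℕ
  | 0 => 1
  | 1 => 0
  | n + 2 => (n + 1) * matchingCount n

variable {N M : ℕ}

/-- The number of points of `S` with colour `c`. -/
def fiberCard (S : Finset (Fin N)) (f : Fin N → Fin M) (c : Fin M) : ℕ :=
  (S.filter fun i => f i = c).card

/-- The number of perfect matchings of `S` without bichromatic pairs. -/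
def colourWeight (S : Finset (Fin N)) (f : Fin N → Fin M) : ℕ :=
  ∏ c, matchingCount (fiberCard S f c)

lemma fiberCard_erase {S : Finset (Fin N)} {a : Fin N} (ha : a ∈ S) (f : Fin N → Fin M)
    (c : Fin M) :
    fiberCard S f c = fiberCard (S.erase a) f c + if f a = c then 1 else 0 := by
  unfold fiberCard
  rw [Finset.filter_erase]
  split_ifs with h
  · rw [Finset.card_erase_add_one]
    simp [ha, h]
  · rw [Finset.erase_eq_of_notMem (by simp [h]), add_zero]

lemma fiberCard_congr {S : Finset (Fin N)} {f g : Fin N → Fin M} (h : ∀ i ∈ S, f i = g i)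
    (c : Fin M) : fiberCard S f c = fiberCard S g c := by
  unfold fiberCard
  congr 1
  exact Finset.filter_congr fun i hi => by rw [h i hi]

lemma colourWeight_congr {S : Finset (Fin N)} {f g : Fin N → Fin M} (h : ∀ i ∈ S, f i = g i) :
    colourWeight S f = colourWeight S g :=
  Finset.prod_congr rfl fun c _ => by rw [fiberCard_congr h]

lemma sum_fiberCard (S : Finset (Fin N)) (f : Fin N → Fin M) :
    ∑ c, fiberCard S f c = S.card :=
  (Finset.card_eq_sum_card_fiberwise fun _ _ => Finset.mem_coe.2 (Finset.mem_univ _)).symm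

/-- Removing two points of one colour lowers a single fibre by two, which is one step of the double
factorial recursion. -/
lemma colourWeight_eq_mul {S : Finset (Fin N)} {a b : Fin N} (ha : a ∈ S) (hb : b ∈ S.erase a)
    {f : Fin N → Fin M} (hf : f a = f b) :
    colourWeight S f =
      (fiberCard ((S.erase a).erase b) f (f a) + 1) * colourWeight ((S.erase a).erase b) f := by
  have hc : ∀ c, fiberCard S f c =
      fiberCard ((S.erase a).erase b) f c + if f a = c then 2 else 0 := by
    intro c
    rw [fiberCard_erase ha, fiberCard_erase hb, ← hf]
    split_ifs <;> rfl
  unfold colourWeight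
  rw [← Finset.mul_prod_erase _ _ (Finset.mem_univ (f a)),
    ← Finset.mul_prod_erase Finset.univ
      (fun c => matchingCount (fiberCard ((S.erase a).erase b) f c)) (Finset.mem_univ (f a)),
    hc, if_pos rfl, matchingCount, mul_assoc]
  congr 2
  refine Finset.prod_congr rfl fun c hcm => ?_
  rw [hc, if_neg (Finset.ne_of_mem_erase hcm).symm, add_zero]

/-- Matchings without bichromatic pairs are sorted by the partner `b` of `a`, which must share the
colour of `a`. -/
lemma colourWeight_eq_sum {S : Finset (Fin N)} {a : Fin N} (ha : a ∈ S) (f : Fin N → Fin M) :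
    colourWeight S f =
      ∑ b ∈ S.erase a, if f a = f b then colourWeight ((S.erase a).erase b) f else 0 := by
  have hcount : ∑ b ∈ S.erase a, (if f a = f b then 1 else 0) = fiberCard (S.erase a) f (f a) := by
    rw [fiberCard, Finset.card_filter]
    exact Finset.sum_congr rfl fun b _ => by simp only [eq_comm]
  rcases Nat.eq_zero_or_pos (fiberCard (S.erase a) f (f a)) with h0 | hpos
  · rw [Finset.sum_eq_zero]
    · refine Finset.prod_eq_zero (Finset.mem_univ (f a)) ?_
      rw [fiberCard_erase ha, h0, if_pos rfl]
      rfl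
    · intro b hb
      rw [h0, Finset.sum_eq_zero_iff] at hcount
      have := hcount b hb
      split_ifs with h
      · simp [h] at this
      · rfl
  -- Every admissible `b` gives the same weight, so the identity is checked after multiplying by the
  -- number of such `b`; this avoids a division.
  · refine Nat.eq_of_mul_eq_mul_left hpos ?_
    rw [Finset.mul_sum]
    nth_rewrite 1 [← hcount]
    rw [Finset.sum_mul]
    refine Finset.sum_congr rfl fun b hb => ?_
    split_ifs with h
    · rw [one_mul, colourWeight_eq_mul ha hb h, fiberCard_erase hb, if_pos h.symm]
    · simp

variable [NeZero M]

/-- Colourings of `S`, extended by zero. -/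
def colourings (M : ℕ) [NeZero M] (S : Finset (Fin N)) : Finset (Fin N → Fin M) :=
  Fintype.piFinset fun i => if i ∈ S then Finset.univ else {0}

lemma mem_colourings {S : Finset (Fin N)} {f : Fin N → Fin M} :
    f ∈ colourings M S ↔ ∀ i, i ∉ S → f i = 0 := by
  simp only [colourings, Fintype.mem_piFinset]
  refine forall_congr' fun i => ?_
  split_ifs with h <;> simp [h]

lemma sum_colourings {R : Type*} [AddCommMonoid R] {S : Finset (Fin N)} {a : Fin N} (ha : a ∈ S)
    (G : (Fin N → Fin M) → R) :
    ∑ f ∈ colourings M S, G f =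
      ∑ g ∈ colourings M (S.erase a), ∑ c, G (Function.update g a c) := by
  rw [← Finset.sum_product']
  refine Finset.sum_bij' (fun f _ => (Function.update f a 0, f a))
    (fun x _ => Function.update x.1 a x.2) ?_ ?_ ?_ ?_ ?_
  · intro f hf
    rw [Finset.mem_product, mem_colourings]
    rw [mem_colourings] at hf
    refine ⟨fun i hi => ?_, Finset.mem_univ _⟩
    by_cases h : i = a
    · subst h; simp
    · simp only [Function.update_of_ne h]
      exact hf i fun h' => hi (Finset.mem_erase.2 ⟨h, h'⟩)
  · rintro ⟨g, c⟩ hg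
    rw [Finset.mem_product, mem_colourings] at hg
    rw [mem_colourings]
    intro i hi
    have h : i ≠ a := fun h => hi (h ▸ ha)
    simp only [Function.update_of_ne h]
    exact hg.1 i fun h' => hi (Finset.mem_erase.1 h').2
  · intro f _; simp
  · rintro ⟨g, c⟩ hg
    rw [Finset.mem_product, mem_colourings] at hg
    have : g a = 0 := hg.1 a (by simp)
    simp [← this]
  · intro f _; simp

/-- `E |Haf(X Xᵀ)|²` for a `2m × M` Gaussian matrix `X`. -/
def hafMoment (M m : ℕ) : ℕ := ∏ k ∈ Finset.range m, (2 * k + 1) * (M + 2 * k)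

/-- With `|S| = 2(m + 1)` in the inductive step, there are `2m + 1` choices of a partner `b` for
`a`. Summing over the common colour `c` of the pair gives `∑ (n_c + 1) = 2m + M`, where `n_c` counts
the remaining points of colour `c`. These are the two factors of `hafMoment`. -/
lemma sum_colourWeight_sq {m : ℕ} {S : Finset (Fin N)} (hS : S.card = 2 * m) :
    ∑ f ∈ colourings M S, colourWeight S f ^ 2 = hafMoment M m := by
  induction m generalizing S with
  | zero =>
    have hS : S = ∅ := by rwa [mul_zero, Finset.card_eq_zero] at hS
    subst hS
    have : colourings M (∅ : Finset (Fin N)) = {fun _ => 0} := by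
      ext f
      rw [mem_colourings, Finset.mem_singleton]
      simp [funext_iff]
    rw [this]
    simp [colourWeight, fiberCard, matchingCount, hafMoment]
  | succ m ih =>
    have hne : S.Nonempty := by rw [← Finset.card_pos]; omega
    obtain ⟨a, ha⟩ := hne
    have h1 := Finset.card_erase_of_mem ha
    have hexp : ∀ f : Fin N → Fin M, colourWeight S f ^ 2 = ∑ b ∈ S.erase a, if f a = f b then
        (fiberCard ((S.erase a).erase b) f (f a) + 1) *
          colourWeight ((S.erase a).erase b) f ^ 2 else 0 := by
      intro f
      rw [sq]
      -- Only one of the two factors is expanded over partners; the other is then reduced for the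
      -- partner already chosen, so that a square reappears.
      nth_rewrite 2 [colourWeight_eq_sum ha f]
      rw [Finset.mul_sum]
      refine Finset.sum_congr rfl fun b hb => ?_
      split_ifs with h
      · rw [colourWeight_eq_mul ha hb h]; ring
      · rw [mul_zero]
    simp only [hexp]
    rw [Finset.sum_comm]
    have hb : ∀ b ∈ S.erase a, ∑ f ∈ colourings M S, (if f a = f b then
        (fiberCard ((S.erase a).erase b) f (f a) + 1) *
          colourWeight ((S.erase a).erase b) f ^ 2 else 0) = (M + 2 * m) * hafMoment M m := by
      intro b hb
      have h2 := Finset.card_erase_of_mem hb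
      have hba : b ≠ a := Finset.ne_of_mem_erase hb
      rw [sum_colourings ha, sum_colourings hb, ← ih (S := (S.erase a).erase b) (by omega),
        Finset.mul_sum]
      refine Finset.sum_congr rfl fun g _ => ?_
      have hw : ∀ x y, ∀ i ∈ (S.erase a).erase b,
          Function.update (Function.update g b x) a y i = g i := by
        intro x y i hi
        simp only [Finset.mem_erase] at hi
        rw [Function.update_of_ne hi.2.1, Function.update_of_ne hi.1]
      have hs : ∀ x y, (if Function.update (Function.update g b x) a y a =
          Function.update (Function.update g b x) a y b then
          (fiberCard ((S.erase a).erase b) (Function.update (Function.update g b x) a y)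
            (Function.update (Function.update g b x) a y a) + 1) *
          colourWeight ((S.erase a).erase b) (Function.update (Function.update g b x) a y) ^ 2
          else 0) = if x = y then (fiberCard ((S.erase a).erase b) g y + 1) *
          colourWeight ((S.erase a).erase b) g ^ 2 else 0 := by
        intro x y
        rw [colourWeight_congr (hw x y), fiberCard_congr (hw x y), Function.update_self,
          Function.update_of_ne hba, Function.update_self]
        simp only [eq_comm]
      simp only [hs, Finset.sum_ite_eq, Finset.mem_univ, if_true]
      rw [← Finset.sum_mul, Finset.sum_add_distrib, sum_fiberCard, h2, h1, hS]
      congr 1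
      simp
      omega
    rw [Finset.sum_congr rfl hb, Finset.sum_const, h1, hS, hafMoment, hafMoment,
      Finset.prod_range_succ, smul_eq_mul]
    rw [show 2 * (m + 1) - 1 = 2 * m + 1 by omega]
    ring

/-- Each entry of `X Xᵀ` is a sum over a column index. Giving this index as a colour to both ends of
the pair and exchanging the sums leaves, for each colouring, one monomial times the number of
matchings that respect it. -/
lemma hafOn_mul_transpose (X : Matrix (Fin N) (Fin M) ℂ) (S : Finset (Fin N)) :
    hafOn (X * X.transpose) S =
      ∑ f ∈ colourings M S, (colourWeight S f : ℂ) * ∏ i ∈ S, X i (f i) := by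
  induction hn : S.card using Nat.strong_induction_on generalizing S with
  | _ n ih =>
    rcases S.eq_empty_or_nonempty with rfl | hne
    · have : colourings M (∅ : Finset (Fin N)) = {fun _ => 0} := by
        ext f
        rw [mem_colourings, Finset.mem_singleton]
        simp [funext_iff]
      rw [hafOn_empty, this]
      simp [colourWeight, fiberCard, matchingCount]
    have ha := S.min'_mem hne
    rw [hafOn_eq_sum _ ha fun b hb => S.min'_le b hb]
    set a := S.min' hne
    simp only [colourWeight_eq_sum ha, Nat.cast_sum, Finset.sum_mul]
    rw [Finset.sum_comm]
    refine Finset.sum_congr rfl fun b hb => ?_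
    have h1 := Finset.card_erase_of_mem ha
    have h2 := Finset.card_erase_of_mem hb
    have h3 : 0 < S.card := Finset.card_pos.2 hne
    have hba : b ≠ a := Finset.ne_of_mem_erase hb
    rw [sum_colourings ha, sum_colourings hb, ih _ (by omega) _ rfl, Finset.mul_sum]
    refine Finset.sum_congr rfl fun g _ => ?_
    have hw : ∀ x y, ∀ i ∈ (S.erase a).erase b,
        Function.update (Function.update g b x) a y i = g i := by
      intro x y i hi
      simp only [Finset.mem_erase] at hi
      rw [Function.update_of_ne hi.2.1, Function.update_of_ne hi.1]
    have hs : ∀ x y, (((if Function.update (Function.update g b x) a y a =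
        Function.update (Function.update g b x) a y b then
        colourWeight ((S.erase a).erase b) (Function.update (Function.update g b x) a y)
        else 0 : ℕ) : ℂ) * ∏ i ∈ S, X i (Function.update (Function.update g b x) a y i)) =
        if x = y then X a y * X b y * (colourWeight ((S.erase a).erase b) g *
          ∏ i ∈ (S.erase a).erase b, X i (g i)) else 0 := by
      intro x y
      rw [colourWeight_congr (hw x y), Function.update_self, Function.update_of_ne hba,
        Function.update_self, ← Finset.mul_prod_erase S _ ha,
        ← Finset.mul_prod_erase (S.erase a) _ hb,
        Finset.prod_congr rfl fun i hi => by rw [hw x y i hi], Function.update_self,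
        Function.update_of_ne hba, Function.update_self]
      by_cases h : x = y
      · subst h; simp; ring
      · simp [h, Ne.symm h]
    simp only [hs, Finset.sum_ite_eq, Finset.mem_univ, if_true]
    rw [← Finset.sum_mul]
    simp [Matrix.mul_apply]

end Counting

/-! ### Orthogonality of monomials and second moments -/

section Gaussian

instance : IsProbabilityMeasure complexGaussian := by
  unfold complexGaussian
  refine Measure.isProbabilityMeasure_map ?_
  exact (Complex.measurableEquivRealProd.symm.measurable).aemeasurable

instance (N M : ℕ) : IsProbabilityMeasure (gaussianLaw N M) := by
  unfold gaussianLaw; infer_instance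

lemma complexGaussian_eq : complexGaussian =
    ((gaussianReal 0 (1 / 2)).prod (gaussianReal 0 (1 / 2))).map
      Complex.measurableEquivRealProd.symm := rfl

lemma integrable_complexGaussian {f : ℂ → ℂ}
    (h : Integrable (fun p : ℝ × ℝ => f ⟨p.1, p.2⟩)
      ((gaussianReal 0 (1 / 2)).prod (gaussianReal 0 (1 / 2)))) :
    Integrable f complexGaussian := by
  rw [complexGaussian_eq, Complex.measurableEquivRealProd.symm.measurableEmbedding.integrable_map_iff]
  exact h

lemma integral_complexGaussian (f : ℂ → ℂ) :
    ∫ z, f z ∂complexGaussian =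
      ∫ p : ℝ × ℝ, f ⟨p.1, p.2⟩ ∂((gaussianReal 0 (1 / 2)).prod (gaussianReal 0 (1 / 2))) := by
  rw [complexGaussian_eq, Complex.measurableEquivRealProd.symm.measurableEmbedding.integral_map]
  rfl

lemma integrable_id_gaussian : Integrable (fun x : ℝ => (x : ℂ)) (gaussianReal 0 (1 / 2)) :=
  ((memLp_id_gaussianReal' 1 (by simp)).integrable le_rfl).ofReal

lemma integrable_sq_gaussian :
    Integrable (fun x : ℝ => ((x ^ 2 : ℝ) : ℂ)) (gaussianReal 0 (1 / 2)) :=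
  ((memLp_id_gaussianReal' 2 (by simp)).integrable_sq).ofReal

lemma integral_sq_gaussian : ∫ x : ℝ, x ^ 2 ∂(gaussianReal 0 (1 / 2)) = 1 / 2 := by
  have h := variance_fun_id_gaussianReal (μ := 0) (v := 1 / 2)
  rw [variance_of_integral_eq_zero (by fun_prop) (by simp)] at h
  simpa using h

lemma integrable_complexGaussian_id : Integrable (fun z : ℂ => z) complexGaussian := by
  refine integrable_complexGaussian ?_
  have h : (fun p : ℝ × ℝ => (⟨p.1, p.2⟩ : ℂ)) = fun p => (p.1 : ℂ) + (p.2 : ℂ) * Complex.I := by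
    funext p; exact Complex.mk_eq_add_mul_I _ _
  rw [h]
  exact (integrable_id_gaussian.comp_fst _).add ((integrable_id_gaussian.comp_snd _).mul_const _)

lemma integrable_complexGaussian_star : Integrable (fun z : ℂ => star z) complexGaussian := by
  have h := integrable_complexGaussian_id
  exact (Complex.conjLIE.integrable_comp_iff (φ := fun z : ℂ => z)).2 h

lemma integrable_complexGaussian_mul_star :
    Integrable (fun z : ℂ => z * star z) complexGaussian := by
  refine integrable_complexGaussian ?_
  have h : (fun p : ℝ × ℝ => (⟨p.1, p.2⟩ : ℂ) * star (⟨p.1, p.2⟩ : ℂ)) =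
      fun p => ((p.1 ^ 2 : ℝ) : ℂ) + ((p.2 ^ 2 : ℝ) : ℂ) := by
    funext p
    rw [Complex.star_def, Complex.mul_conj, Complex.normSq_mk]; push_cast; ring
  rw [h]
  exact (integrable_sq_gaussian.comp_fst _).add (integrable_sq_gaussian.comp_snd _)

lemma integral_complexGaussian_id : ∫ z, z ∂complexGaussian = 0 := by
  rw [integral_complexGaussian (fun z => z)]
  have h : (fun p : ℝ × ℝ => (⟨p.1, p.2⟩ : ℂ)) = fun p => (p.1 : ℂ) + (p.2 : ℂ) * Complex.I := by
    funext p; exact Complex.mk_eq_add_mul_I _ _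
  have h0 : ∫ x : ℝ, (x : ℂ) ∂(gaussianReal 0 (1 / 2)) = 0 := by
    rw [integral_complex_ofReal]; simp
  rw [h, integral_add (integrable_id_gaussian.comp_fst _)
    ((integrable_id_gaussian.comp_snd _).mul_const _), integral_mul_const,
    integral_fun_fst (fun x : ℝ => (x : ℂ)), integral_fun_snd (fun x : ℝ => (x : ℂ)), h0]
  simp

lemma integral_complexGaussian_mul_star : ∫ z, z * star z ∂complexGaussian = 1 := by
  rw [integral_complexGaussian (fun z => z * star z)]
  have h : (fun p : ℝ × ℝ => (⟨p.1, p.2⟩ : ℂ) * star (⟨p.1, p.2⟩ : ℂ)) =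
      fun p => ((p.1 ^ 2 : ℝ) : ℂ) + ((p.2 ^ 2 : ℝ) : ℂ) := by
    funext p
    rw [Complex.star_def, Complex.mul_conj, Complex.normSq_mk]; push_cast; ring
  have h0 : ∫ x : ℝ, ((x ^ 2 : ℝ) : ℂ) ∂(gaussianReal 0 (1 / 2)) = 1 / 2 := by
    rw [integral_complex_ofReal, integral_sq_gaussian]; norm_num
  rw [h, integral_add (integrable_sq_gaussian.comp_fst _) (integrable_sq_gaussian.comp_snd _),
    integral_fun_fst (fun x : ℝ => ((x ^ 2 : ℝ) : ℂ)),
    integral_fun_snd (fun x : ℝ => ((x ^ 2 : ℝ) : ℂ)), h0]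
  norm_num

/-- The law of a row of a Gaussian matrix. -/
def rowLaw (M : ℕ) : Measure (Fin M → ℂ) := Measure.pi fun _ => complexGaussian

instance (M : ℕ) : IsProbabilityMeasure (rowLaw M) := by
  unfold rowLaw; infer_instance

lemma row_mul_star {M : ℕ} (c d : Fin M) (x : Fin M → ℂ) : x c * star (x d) =
    ∏ k, ((if k = c then x k else 1) * (if k = d then star (x k) else 1)) := by
  rw [Finset.prod_mul_distrib]
  simp

lemma integrable_row_mul_star {M : ℕ} (c d : Fin M) :
    Integrable (fun x : Fin M → ℂ => x c * star (x d)) (rowLaw M) := by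
  simp only [row_mul_star]
  refine Integrable.fintype_prod
    (f := fun k z => (if k = c then z else 1) * (if k = d then star z else 1)) fun k => ?_
  by_cases h1 : k = c <;> by_cases h2 : k = d <;>
    simp only [h1, h2, if_true, if_false, mul_one]
  · split_ifs
    · exact integrable_complexGaussian_mul_star
    · simpa using integrable_complexGaussian_id
  · split_ifs
    · exact integrable_complexGaussian_mul_star
    · simpa using integrable_complexGaussian_id
  · split_ifs
    · exact integrable_complexGaussian_mul_star
    · simpa using integrable_complexGaussian_star
  · simp

lemma integral_row_mul_star {M : ℕ} (c d : Fin M) :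
    ∫ x : Fin M → ℂ, x c * star (x d) ∂(rowLaw M) = if c = d then 1 else 0 := by
  simp only [row_mul_star]
  rw [rowLaw, integral_fintype_prod_eq_prod
    (f := fun k z => (if k = c then z else 1) * (if k = d then star z else 1))]
  split_ifs with h
  · subst h
    refine Finset.prod_eq_one fun k _ => ?_
    split_ifs
    · exact integral_complexGaussian_mul_star
    · simp
  · refine Finset.prod_eq_zero (Finset.mem_univ c) ?_
    simp only [if_true, h, if_false, mul_one]
    exact integral_complexGaussian_id

lemma monomial_mul_star {N M : ℕ} (S : Finset (Fin N)) (f g : Fin N → Fin M)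
    (X : Fin N → Fin M → ℂ) :
    (∏ i ∈ S, X i (f i)) * star (∏ i ∈ S, X i (g i)) =
      ∏ i, if i ∈ S then X i (f i) * star (X i (g i)) else 1 := by
  rw [star_prod, ← Finset.prod_mul_distrib, Finset.prod_ite_mem, Finset.univ_inter]

lemma integrable_monomial_mul_star {N M : ℕ} (S : Finset (Fin N)) (f g : Fin N → Fin M) :
    Integrable (fun X : Fin N → Fin M → ℂ =>
      (∏ i ∈ S, X i (f i)) * star (∏ i ∈ S, X i (g i))) (gaussianLaw N M) := by
  simp only [monomial_mul_star]
  refine Integrable.fintype_prod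
    (f := fun i (x : Fin M → ℂ) => if i ∈ S then x (f i) * star (x (g i)) else 1) fun i => ?_
  split_ifs
  · exact integrable_row_mul_star _ _
  · exact integrable_const (μ := rowLaw M) (1 : ℂ)

variable {N M : ℕ} [NeZero M]

/-- Each monomial takes exactly one entry from each row in `S`. By independence only `E z = 0` and
`E |z|² = 1` enter, and a row where the colourings differ contributes a factor `0`. -/
lemma integral_monomial_mul_star (S : Finset (Fin N)) {f g : Fin N → Fin M}
    (hf : f ∈ colourings M S) (hg : g ∈ colourings M S) :
    ∫ X : Fin N → Fin M → ℂ, (∏ i ∈ S, X i (f i)) * star (∏ i ∈ S, X i (g i)) ∂(gaussianLaw N M) =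
      if f = g then 1 else 0 := by
  simp only [monomial_mul_star]
  have := integral_fintype_prod_eq_prod (μ := fun _ : Fin N => rowLaw M)
    (f := fun i (x : Fin M → ℂ) => if i ∈ S then x (f i) * star (x (g i)) else 1)
  rw [gaussianLaw]
  refine this.trans ?_
  split_ifs with h
  · subst h
    refine Finset.prod_eq_one fun i _ => ?_
    split_ifs
    · rw [integral_row_mul_star, if_pos rfl]
    · simp
  · obtain ⟨i, hi⟩ := Function.ne_iff.1 h
    have hiS : i ∈ S := by
      by_contra hiS
      exact hi ((mem_colourings.1 hf i hiS).trans (mem_colourings.1 hg i hiS).symm)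
    refine Finset.prod_eq_zero (Finset.mem_univ i) ?_
    simp only [hiS, if_true]
    rw [integral_row_mul_star, if_neg hi]

lemma hafSq_eq_sum (S : Finset (Fin N)) (X : Fin N → Fin M → ℂ) :
    (hafSq (Matrix.of X) S : ℂ) = ∑ f ∈ colourings M S, ∑ g ∈ colourings M S,
      ((colourWeight S f : ℂ) * (colourWeight S g : ℂ)) *
        ((∏ i ∈ S, X i (f i)) * star (∏ i ∈ S, X i (g i))) := by
  have h : (hafSq (Matrix.of X) S : ℂ) = hafOn (Matrix.of X * (Matrix.of X).transpose) S *
      star (hafOn (Matrix.of X * (Matrix.of X).transpose) S) := by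
    rw [Complex.star_def, Complex.mul_conj, Complex.normSq_eq_norm_sq, hafSq]
  rw [h, hafOn_mul_transpose, star_sum, Finset.sum_mul_sum]
  refine Finset.sum_congr rfl fun f _ => Finset.sum_congr rfl fun g _ => ?_
  simp only [Matrix.of_apply, star_mul', star_natCast]
  ring

lemma integrable_hafSq (S : Finset (Fin N)) :
    Integrable (fun X : Fin N → Fin M → ℂ => hafSq (Matrix.of X) S) (gaussianLaw N M) := by
  have h : Integrable (fun X : Fin N → Fin M → ℂ => (hafSq (Matrix.of X) S : ℂ))
      (gaussianLaw N M) := by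
    simp only [hafSq_eq_sum]
    exact integrable_finsetSum _ fun f _ => integrable_finsetSum _ fun g _ =>
      (integrable_monomial_mul_star S f g).const_mul _
  simpa using h.re

/-- Parseval: the subhafnian is a combination of orthonormal monomials, so its second moment is the
sum of the squared coefficients. -/
lemma integral_hafSq {m : ℕ} {S : Finset (Fin N)} (hS : S.card = 2 * m) :
    ∫ X : Fin N → Fin M → ℂ, hafSq (Matrix.of X) S ∂(gaussianLaw N M) = hafMoment M m := by
  have h : ∫ X : Fin N → Fin M → ℂ, (hafSq (Matrix.of X) S : ℂ) ∂(gaussianLaw N M) =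
      hafMoment M m := by
    simp only [hafSq_eq_sum]
    rw [integral_finsetSum _ fun f _ => integrable_finsetSum _ fun g _ =>
      (integrable_monomial_mul_star S f g).const_mul _]
    rw [← sum_colourWeight_sq (M := M) hS]
    push_cast
    refine Finset.sum_congr rfl fun f hf => ?_
    rw [integral_finsetSum _ fun g _ => (integrable_monomial_mul_star S f g).const_mul _,
      Finset.sum_eq_single f]
    · rw [integral_const_mul, integral_monomial_mul_star S hf hf, if_pos rfl, mul_one, sq]
    · intro g hg hgf
      rw [integral_const_mul, integral_monomial_mul_star S hf hg, if_neg hgf.symm, mul_zero]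
    · exact fun h => absurd hf h
  rw [integral_complex_ofReal] at h
  exact_mod_cast h

end Gaussian

/-! ## Euler's transformation and the factor `Q` -/

section Euler

open PowerSeries

/-- The hypergeometric differential operator. -/
def hypergeometricOp (a b c : ℝ) (f : ℝ⟦X⟧) : ℝ⟦X⟧ :=
  X * d⁄dX ℝ (d⁄dX ℝ f) - X * (X * d⁄dX ℝ (d⁄dX ℝ f)) + C c * d⁄dX ℝ f
    - C (a + b + 1) * (X * d⁄dX ℝ f) - C (a * b) * f

lemma coeff_X_mul_derivative (f : ℝ⟦X⟧) (n : ℕ) :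
    coeff n (X * d⁄dX ℝ f) = n * coeff n f := by
  cases n with
  | zero => simp
  | succ n => rw [coeff_succ_X_mul, coeff_derivative]; push_cast; ring

lemma coeff_hypergeometricOp (a b c : ℝ) (f : ℝ⟦X⟧) (n : ℕ) :
    coeff n (hypergeometricOp a b c f) =
      (n + 1) * (n + c) * coeff (n + 1) f - (n + a) * (n + b) * coeff n f := by
  have h : coeff n (X * (X * d⁄dX ℝ (d⁄dX ℝ f))) = n * (n - 1) * coeff n f := by
    cases n with
    | zero => simp
    | succ n =>
      rw [coeff_succ_X_mul, coeff_X_mul_derivative, coeff_derivative]; push_cast; ring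
  rw [hypergeometricOp, map_sub, map_sub, map_add (coeff n), map_sub]
  simp only [coeff_C_mul, coeff_X_mul_derivative, h]
  rw [coeff_derivative]
  ring

/-- Conjugation by `(1 - X)^m` carries one hypergeometric equation to the other. The factor `(1 -
X)²` clears denominators: the derivatives of `(1 - X)^m` are expressed through lower ones only after
multiplication by `1 - X`. -/
lemma hypergeometricOp_euler {a b c : ℝ} {m : ℕ} (hm : (m : ℝ) = a + b - c) (f : ℝ⟦X⟧) :
    (1 - X) ^ 2 * hypergeometricOp (c - a) (c - b) c ((1 - X) ^ m * f) =
      (1 - X) ^ 2 * (1 - X) ^ m * hypergeometricOp a b c f := by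
  set P : ℝ⟦X⟧ := (1 - X) ^ m with hP
  have hm' : (m : ℝ⟦X⟧) = C a + C b - C c := by
    rw [← map_natCast (C (R := ℝ)) m, hm]; simp
  have e1 : (1 - X) * d⁄dX ℝ P = -(m : ℝ⟦X⟧) * P := by
    rw [hP, derivative_pow]
    cases m with
    | zero => simp
    | succ k => simp only [map_sub, derivative_one, derivative_X, Nat.add_sub_cancel, pow_succ]; ring
  have e2 : (1 - X) * d⁄dX ℝ (d⁄dX ℝ P) = (1 - (m : ℝ⟦X⟧)) * d⁄dX ℝ P := by
    have := congrArg (d⁄dX ℝ) e1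
    simp only [Derivation.leibniz, map_sub, derivative_one, derivative_X, smul_eq_mul, map_neg,
      Derivation.map_natCast] at this
    linear_combination this
  have h1 : d⁄dX ℝ (P * f) = d⁄dX ℝ P * f + P * d⁄dX ℝ f := by
    rw [Derivation.leibniz]; simp only [smul_eq_mul]; ring
  have h2 : d⁄dX ℝ (d⁄dX ℝ (P * f)) =
      d⁄dX ℝ (d⁄dX ℝ P) * f + 2 * (d⁄dX ℝ P * d⁄dX ℝ f) + P * d⁄dX ℝ (d⁄dX ℝ f) := by
    rw [h1, map_add, Derivation.leibniz, Derivation.leibniz]; simp only [smul_eq_mul]; ring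
  rw [hypergeometricOp, hypergeometricOp, h2, h1]
  simp only [map_add, map_sub, map_mul, map_one]
  generalize d⁄dX ℝ (d⁄dX ℝ P) = P2 at *
  generalize d⁄dX ℝ P = P1 at *
  generalize d⁄dX ℝ (d⁄dX ℝ f) = F2 at *
  generalize d⁄dX ℝ f = F1 at *
  generalize P = P0 at *
  rw [hm'] at e1 e2
  generalize C a = A at *
  generalize C b = B at *
  generalize C c = G at *
  -- `e2` eliminates the second derivative of the power and `e1` then its first derivative; the
  -- multipliers are the coefficients of these derivatives.
  linear_combination (X * (1 - X) ^ 2 * f) * e2 + (X * (1 - X) * (1 - (A + B - G)) * f +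
    2 * X * (1 - X) ^ 2 * F1 +
    (1 - X) * (G - ((G - A) + (G - B) + 1) * X) * f) * e1

lemma hasSum_one_sub_X_mul {f : ℝ⟦X⟧} {z s : ℝ} (h : HasSum (fun n => coeff n f * z ^ n) s) :
    HasSum (fun n => coeff n ((1 - X) * f) * z ^ n) ((1 - z) * s) := by
  have h1 : HasSum (fun n => coeff n (X * f) * z ^ n) (z * s) := by
    rw [← hasSum_nat_add_iff' 1]
    simp only [Finset.range_one, Finset.sum_singleton, coeff_zero_X_mul, zero_mul, sub_zero,
      coeff_succ_X_mul]
    have := h.mul_left z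
    refine this.congr_fun ?_
    intro n; rw [pow_succ]; ring
  have := h.sub h1
  rw [show (1 - z) * s = s - z * s by ring]
  refine this.congr_fun ?_
  intro n; rw [sub_mul, one_mul, map_sub]; ring

lemma hasSum_one_sub_X_pow_mul {f : ℝ⟦X⟧} {z s : ℝ} (m : ℕ)
    (h : HasSum (fun n => coeff n f * z ^ n) s) :
    HasSum (fun n => coeff n ((1 - X) ^ m * f) * z ^ n) ((1 - z) ^ m * s) := by
  induction m with
  | zero => simpa using h
  | succ m ih =>
    rw [pow_succ', pow_succ', mul_assoc, mul_assoc]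
    exact hasSum_one_sub_X_mul ih

/-- The hypergeometric power series. -/
def hypergeometricSeries (a b c : ℝ) : ℝ⟦X⟧ :=
  PowerSeries.mk (ordinaryHypergeometricCoefficient a b c)

lemma hypergeometricOp_series {a b c : ℝ} (hc : ∀ n : ℕ, (n : ℝ) + c ≠ 0) :
    hypergeometricOp a b c (hypergeometricSeries a b c) = 0 := by
  ext n
  have h1 : (ascPochhammer ℝ n).eval c ≠ 0 := by
    rw [Ne, ascPochhammer_eval_eq_zero_iff]
    rintro ⟨k, -, hk⟩
    exact hc k (by rw [hk]; ring)
  have h2 := hc n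
  have h3 : ((n.factorial : ℕ) : ℝ) ≠ 0 := by positivity
  have h4 : c + n ≠ 0 := by rw [add_comm]; exact h2
  rw [coeff_hypergeometricOp]
  simp only [hypergeometricSeries, coeff_mk, ordinaryHypergeometricCoefficient,
    ascPochhammer_succ_eval, Nat.factorial_succ]
  simp only [map_zero, Nat.cast_mul, Nat.cast_add, Nat.cast_one]
  field_simp
  ring

lemma summable_hypergeometric {a b c z : ℝ} (ha : ∀ n : ℕ, (n : ℝ) ≠ -a)
    (hb : ∀ n : ℕ, (n : ℝ) ≠ -b) (hc : ∀ n : ℕ, (n : ℝ) ≠ -c) (hz : |z| < 1) :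
    HasSum (fun n => coeff n (hypergeometricSeries a b c) * z ^ n)
      (ordinaryHypergeometric a b c z) := by
  have hr := ordinaryHypergeometricSeries_radius_eq_one ℝ a b c fun n => ⟨ha n, hb n, hc n⟩
  have hs : Summable fun n => ordinaryHypergeometricSeries ℝ a b c n fun _ => z := by
    refine Summable.of_norm (FormalMultilinearSeries.summable_norm_apply _ ?_)
    rw [hr]
    simpa [enorm_eq_nnnorm, ← NNReal.coe_lt_coe] using hz
  have := hs.hasSum
  rw [ordinaryHypergeometric, FormalMultilinearSeries.sum]
  refine this.congr_fun ?_
  intro n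
  rw [ordinaryHypergeometricSeries_apply_eq, hypergeometricSeries, coeff_mk, smul_eq_mul]

/-- Euler's transformation when it produces a polynomial. -/
lemma euler_transformation {a b c z : ℝ} {m n : ℕ} (ha : 0 < a) (hb : 0 < b) (hc : 0 < c)
    (hm : (m : ℝ) = a + b - c) (hn : (n : ℝ) = b - c) (hz : |z| < 1) (t : ℕ → ℝ) (ht0 : t 0 = 1)
    (ht : ∀ k, (k + 1) * (k + c) * t (k + 1) = (k + (c - a)) * (k + (c - b)) * t k) :
    (1 - z) ^ m * ordinaryHypergeometric a b c z = ∑ k ∈ Finset.range (n + 1), t k * z ^ k := by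
  have hc' : ∀ k : ℕ, (k : ℝ) + c ≠ 0 := fun k => by positivity
  have hneg : ∀ x : ℝ, 0 < x → ∀ k : ℕ, (k : ℝ) ≠ -x := fun x hx k h => by
    have : (0 : ℝ) ≤ k := Nat.cast_nonneg k
    linarith
  set G := (1 - X) ^ m * hypergeometricSeries a b c with hG
  -- Power series over `ℝ` have no zero divisors, so the factor `(1 - X)²` can be cancelled.
  have hop : hypergeometricOp (c - a) (c - b) c G = 0 := by
    have h := hypergeometricOp_euler hm (hypergeometricSeries a b c)
    rw [hypergeometricOp_series hc', mul_zero] at h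
    have hne : (1 - X : ℝ⟦X⟧) ≠ 0 := by
      intro h0
      have := congrArg (coeff (R := ℝ) 0) h0
      simp at this
    exact (mul_eq_zero.1 h).resolve_left (pow_ne_zero _ hne)
  have hcoeff : ∀ k, coeff k G = t k := by
    intro k
    induction k with
    | zero => rw [ht0, hG]; simp [hypergeometricSeries, ordinaryHypergeometricCoefficient]
    | succ k ih =>
      have h1 := congrArg (coeff (R := ℝ) k) hop
      rw [coeff_hypergeometricOp, ih, map_zero, sub_eq_zero, ← ht k] at h1
      exact mul_left_cancel₀ (mul_ne_zero (by positivity) (hc' k)) h1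
  -- At `k = n = b - c` the factor `k + (c - b)` of the recursion vanishes, so the series stops.
  have hzero : ∀ k, n + 1 ≤ k → t k = 0 := by
    intro k hk
    induction k, hk using Nat.le_induction with
    | base =>
      have := ht n
      rw [hn, show (b - c + (c - b) : ℝ) = 0 by ring, mul_zero, zero_mul, ← hn] at this
      exact (mul_eq_zero.1 this).resolve_left (mul_ne_zero (by positivity) (hc' n))
    | succ k _ ih =>
      have := ht k
      rw [ih, mul_zero] at this
      exact (mul_eq_zero.1 this).resolve_left (mul_ne_zero (by positivity) (hc' k))
  have hs := hasSum_one_sub_X_pow_mul m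
    (summable_hypergeometric (hneg a ha) (hneg b hb) (hneg c hc) hz)
  rw [← hG] at hs
  simp only [hcoeff] at hs
  rw [← hs.tsum_eq]
  refine tsum_eq_sum fun k hk => ?_
  rw [hzero k (by simpa using hk), zero_mul]

end Euler

/-! ### The factor `Q` as a polynomial, and its size -/

section QFactor

/-- The coefficients of `Q` as a polynomial. -/
def qCoeff (N M : ℕ) (k : ℕ) : ℝ :=
  ∏ i ∈ Finset.range k, (((M : ℝ) + N - 1 - 2 * i) * (N - 2 * i)) / ((2 * i + 1) * (2 * i + 2))

/-- `Q` as a polynomial in `z = (1 - η)² tanh² r`. -/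
def qPoly (N M : ℕ) (z : ℝ) : ℝ := ∑ k ∈ Finset.range (N / 2 + 1), qCoeff N M k * z ^ k

lemma qCoeff_succ (N M k : ℕ) : qCoeff N M (k + 1) =
    qCoeff N M k * ((((M : ℝ) + N - 1 - 2 * k) * (N - 2 * k)) / ((2 * k + 1) * (2 * k + 2))) :=
  Finset.prod_range_succ _ _

/-- Here `a + b - c = M/2 + N` is exactly the exponent in `Q`, and `b - c = N/2` is the degree at
which the transformed series stops. Evenness makes both integers. -/
lemma Q_eq_qPoly {N M : ℕ} (hN : 0 < N) (hNe : Even N) (hMe : Even M) {r η : ℝ}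
    (hz : (1 - η) ^ 2 * Real.tanh r ^ 2 < 1) :
    Q N M r η = qPoly N M ((1 - η) ^ 2 * Real.tanh r ^ 2) := by
  have hN2 : ((N / 2 : ℕ) : ℝ) = N / 2 := by
    obtain ⟨k, rfl⟩ := hNe
    rw [← two_mul, Nat.mul_div_cancel_left _ (by norm_num)]; push_cast; ring
  have hM2 : ((M / 2 : ℕ) : ℝ) = M / 2 := by
    obtain ⟨k, rfl⟩ := hMe
    rw [← two_mul, Nat.mul_div_cancel_left _ (by norm_num)]; push_cast; ring
  have hNpos : (0 : ℝ) < N := by exact_mod_cast hN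
  refine euler_transformation (n := N / 2) (by positivity) (by positivity) (by norm_num) ?_ ?_ ?_ _
    ?_ ?_
  · push_cast; rw [hM2]; ring
  · rw [hN2]; ring
  · rwa [abs_of_nonneg (by positivity)]
  · simp [qCoeff]
  · intro k
    rw [qCoeff_succ]
    field_simp
    ring

lemma qCoeff_nonneg {N M k : ℕ} (hM : 0 < M) (hk : k ≤ N / 2) : 0 ≤ qCoeff N M k := by
  refine Finset.prod_nonneg fun i hi => ?_
  have hi' : 2 * (i + 1) ≤ N := by
    have := Finset.mem_range.1 hi
    omega
  have h1 : 2 * ((i : ℝ) + 1) ≤ N := by exact_mod_cast hi'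
  have h2 : (1 : ℝ) ≤ M := by exact_mod_cast hM
  refine div_nonneg (mul_nonneg ?_ ?_) (by positivity) <;> linarith

lemma qCoeff_le {N M k : ℕ} (hM : 0 < M) (hk : k ≤ N / 2) :
    qCoeff N M k ≤ (((M : ℝ) + N) * N) ^ k / (2 * k).factorial := by
  induction k with
  | zero => simp [qCoeff]
  | succ k ih =>
    have hk' : 2 * (k + 1) ≤ N := by omega
    have h1 : 2 * ((k : ℝ) + 1) ≤ N := by exact_mod_cast hk'
    have h2 : (1 : ℝ) ≤ M := by exact_mod_cast hM
    have hk0 : (0 : ℝ) ≤ k := Nat.cast_nonneg k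
    rw [qCoeff_succ, show 2 * (k + 1) = 2 * k + 1 + 1 by ring, Nat.factorial_succ,
      Nat.factorial_succ, pow_succ]
    have h3 : (((M : ℝ) + N - 1 - 2 * k) * (N - 2 * k)) / ((2 * k + 1) * (2 * k + 2)) ≤
        (((M : ℝ) + N) * N) / ((2 * k + 1) * (2 * k + 2)) := by
      gcongr
      · linarith
      · linarith
      · linarith
    refine (mul_le_mul (ih (by omega)) h3 ?_ (by positivity)).trans_eq ?_
    · refine div_nonneg (mul_nonneg ?_ ?_) (by positivity) <;> linarith
    · push_cast
      have : ((2 * k).factorial : ℝ) ≠ 0 := by positivity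
      field_simp
      ring

lemma one_le_qPoly {N M : ℕ} (hM : 0 < M) {z : ℝ} (hz : 0 ≤ z) : 1 ≤ qPoly N M z := by
  unfold qPoly
  rw [Finset.sum_range_succ']
  have h0 : qCoeff N M 0 = 1 := by simp [qCoeff]
  rw [h0, pow_zero, mul_one, le_add_iff_nonneg_left]
  refine Finset.sum_nonneg fun k hk => mul_nonneg (qCoeff_nonneg hM ?_) (by positivity)
  have := Finset.mem_range.1 hk
  omega

lemma sum_pow_div_factorial_even_le_exp {x : ℝ} (hx : 0 ≤ x) (n : ℕ) :
    ∑ k ∈ Finset.range n, x ^ (2 * k) / (2 * k).factorial ≤ Real.exp x := by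
  have h1 : ∑ k ∈ Finset.range n, x ^ (2 * k) / (2 * k).factorial ≤
      ∑ j ∈ Finset.range (2 * n), x ^ j / j.factorial := by
    refine (Finset.sum_image (f := fun j => x ^ j / (j.factorial : ℝ)) (g := fun k => 2 * k)
      (fun a _ b _ h => by simpa using h)).symm.trans_le ?_
    refine Finset.sum_le_sum_of_subset_of_nonneg ?_ fun _ _ _ => by positivity
    intro j hj
    simp only [Finset.mem_image, Finset.mem_range] at hj ⊢
    obtain ⟨k, hk, rfl⟩ := hj
    omega
  exact h1.trans (Real.sum_le_exp_of_nonneg hx _)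

/-- Dropping the subtracted terms bounds `Q` by the even part of an exponential series. -/
lemma qPoly_le_exp {N M : ℕ} (hM : 0 < M) {z x : ℝ} (hz : 0 ≤ z) (hx : 0 ≤ x)
    (h : ((M : ℝ) + N) * N * z ≤ x ^ 2) : qPoly N M z ≤ Real.exp x := by
  refine le_trans (Finset.sum_le_sum fun k hk => ?_)
    (sum_pow_div_factorial_even_le_exp hx (N / 2 + 1))
  have hk' : k ≤ N / 2 := by have := Finset.mem_range.1 hk; omega
  calc qCoeff N M k * z ^ k ≤ (((M : ℝ) + N) * N) ^ k / (2 * k).factorial * z ^ k := by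
        gcongr; exact qCoeff_le hM hk'
    _ = (((M : ℝ) + N) * N * z) ^ k / (2 * k).factorial := by
        rw [div_mul_eq_mul_div, ← mul_pow]
    _ ≤ (x ^ 2) ^ k / (2 * k).factorial := by gcongr
    _ = x ^ (2 * k) / (2 * k).factorial := by rw [pow_mul]

end QFactor

/-! ## Extrapolation to zero -/

section Lagrange

/-- The weights of polynomial extrapolation to `0` from the nodes `z 0, …, z d`. -/
def weight (d : ℕ) (z : ℕ → ℝ) (i : ℕ) : ℝ :=
  ∏ j ∈ (Finset.range (d + 1)).erase i, z j / (z j - z i)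

/-- Lagrange interpolation reproduces monomials of degree at most `d`; the weights are the basis
polynomials evaluated at `0`. -/
lemma sum_weight_mul_pow {d : ℕ} {z : ℕ → ℝ} (hz : Set.InjOn z (Finset.range (d + 1))) {k : ℕ}
    (hk : k ≤ d) : ∑ i ∈ Finset.range (d + 1), weight d z i * z i ^ k = if k = 0 then 1 else 0 := by
  have h := Lagrange.eq_interpolate (f := (Polynomial.X : Polynomial ℝ) ^ k) hz (by
    rw [Polynomial.degree_X_pow, Finset.card_range]; exact_mod_cast Nat.lt_succ_of_le hk)
  have h0 := congrArg (Polynomial.eval 0) h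
  rw [Lagrange.interpolate_apply, Polynomial.eval_finsetSum] at h0
  have hw : ∀ i, Polynomial.eval 0 (Lagrange.basis (Finset.range (d + 1)) z i) = weight d z i := by
    intro i
    rw [Lagrange.basis, Polynomial.eval_prod, weight]
    refine Finset.prod_congr rfl fun j _ => ?_
    simp only [Lagrange.basisDivisor, Polynomial.eval_mul, Polynomial.eval_C, Polynomial.eval_sub,
      Polynomial.eval_X]
    rw [zero_sub, ← neg_sub, inv_neg, neg_mul_neg, div_eq_inv_mul]
  simp only [Polynomial.eval_mul, Polynomial.eval_C, hw, Polynomial.eval_pow,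
    Polynomial.eval_X] at h0
  rw [zero_pow_eq] at h0
  rw [h0]
  exact Finset.sum_congr rfl fun i _ => mul_comm _ _

lemma prod_abs_sub {d i : ℕ} (hi : i ≤ d) :
    ∏ j ∈ (Finset.range (d + 1)).erase i, |(j : ℝ) - i| = (i.factorial : ℝ) * (d - i).factorial := by
  induction d, hi using Nat.le_induction with
  | base =>
    rw [Finset.range_add_one, Finset.erase_insert (by simp), Nat.sub_self, Nat.factorial_zero,
      Nat.cast_one, mul_one, ← Finset.prod_range_reflect, ← Finset.prod_range_add_one_eq_factorial,
      Nat.cast_prod]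
    refine Finset.prod_congr rfl fun j hj => ?_
    have hj' : j + 1 ≤ i := Finset.mem_range.1 hj
    have h1 : ((j + 1 : ℕ) : ℝ) ≤ i := by exact_mod_cast hj'
    rw [Nat.sub_sub, Nat.cast_sub (by omega)]
    rw [show ((i : ℝ) - ((1 + j : ℕ) : ℝ) - i) = -((j + 1 : ℕ) : ℝ) by push_cast; ring, abs_neg,
      Nat.abs_cast]
  | succ d hd ih =>
    rw [Finset.range_add_one, Finset.erase_insert_of_ne (by omega),
      Finset.prod_insert (by simp), ih, Nat.succ_sub hd, Nat.factorial_succ]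
    have h1 : (i : ℝ) ≤ d := by exact_mod_cast hd
    rw [abs_of_nonneg (by push_cast; linarith)]
    push_cast [Nat.cast_sub hd]
    ring

lemma sum_inv_factorial_mul (d : ℕ) :
    ∑ i ∈ Finset.range (d + 1), ((i.factorial : ℝ) * (d - i).factorial)⁻¹ =
      2 ^ d / d.factorial := by
  have h : (2 : ℝ) ^ d = ∑ i ∈ Finset.range (d + 1), ((d.choose i : ℕ) : ℝ) := by
    rw [← Nat.cast_sum, Nat.sum_range_choose]; push_cast; rfl
  rw [h, Finset.sum_div]
  refine Finset.sum_congr rfl fun i hi => ?_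
  rw [Nat.cast_choose ℝ (Nat.lt_succ_iff.1 (Finset.mem_range.1 hi))]
  have : (d.factorial : ℝ) ≠ 0 := by positivity
  field_simp

/-- If `z i` were proportional to `(d + 2i)²`, the quotient would be `(d + 2j)² / (4 |j - i| (d + i
+ j))`. The hypothesis `hmono` says that `z` spreads at least this fast, which only makes the
quotient smaller. -/
lemma abs_div_sub_le {d i j : ℕ} (hd : 0 < d) (hi : i ≤ d) (hj : j ≤ d) (hij : j ≠ i) {z : ℕ → ℝ}
    (hpos : ∀ i, i ≤ d → 0 < z i)
    (hmono : ∀ i j, i < j → j ≤ d → z i * (d + 2 * j : ℝ) ^ 2 ≤ z j * (d + 2 * i : ℝ) ^ 2) :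
    |z j / (z j - z i)| ≤ 9 * d / 8 * |(j : ℝ) - i|⁻¹ := by
  have hdR : (1 : ℝ) ≤ d := by exact_mod_cast hd
  have hiR : (i : ℝ) ≤ d := by exact_mod_cast hi
  have hjR : (j : ℝ) ≤ d := by exact_mod_cast hj
  have hi0 : (0 : ℝ) ≤ i := Nat.cast_nonneg i
  have hj0 : (0 : ℝ) ≤ j := Nat.cast_nonneg j
  have hzj := hpos j hj
  have hzi := hpos i hi
  -- Equality holds for `j = d`, `i = 0`; this is the source of the constant `9/8`.
  have hkey : 2 * (d + 2 * j : ℝ) ^ 2 ≤ 9 * d * (d + i + j) := by nlinarith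
  rw [abs_div, abs_of_pos hzj]
  rcases lt_or_gt_of_ne hij with h | h
  · have hlt : (j : ℝ) + 1 ≤ i := by exact_mod_cast h
    have hm := hmono j i h hi
    have hsub : z j * (4 * (i - j) * (d + i + j)) ≤ (z i - z j) * (d + 2 * j : ℝ) ^ 2 := by
      nlinarith
    have hpos' : 0 < z i - z j := by
      have h1 : 0 < z j * (4 * (i - j) * (d + i + j) : ℝ) := by
        have : (0 : ℝ) < i - j := by linarith
        positivity
      exact pos_of_mul_pos_left (h1.trans_le hsub) (by positivity)
    rw [abs_sub_comm, abs_of_pos hpos', abs_sub_comm, abs_of_pos (by linarith : (0 : ℝ) < i - j),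
      ← div_eq_mul_inv, div_le_div_iff₀ hpos' (by linarith)]
    have h3 : 0 < (d + i + j : ℝ) := by positivity
    have h2 : (z i - z j) * (2 * (d + 2 * j : ℝ) ^ 2) ≤ (z i - z j) * (9 * d * (d + i + j)) :=
      mul_le_mul_of_nonneg_left hkey hpos'.le
    have : (z j * (i - j)) * (d + i + j) ≤ (9 * d / 8 * (z i - z j)) * (d + i + j) := by
      nlinarith
    exact le_of_mul_le_mul_right this h3
  · have hlt : (i : ℝ) + 1 ≤ j := by exact_mod_cast h
    have hm := hmono i j h hj
    have hsub : z j * (4 * (j - i) * (d + i + j)) ≤ (z j - z i) * (d + 2 * j : ℝ) ^ 2 := by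
      nlinarith
    have hpos' : 0 < z j - z i := by
      have h1 : 0 < z j * (4 * (j - i) * (d + i + j) : ℝ) := by
        have : (0 : ℝ) < j - i := by linarith
        positivity
      exact pos_of_mul_pos_left (h1.trans_le hsub) (by positivity)
    rw [abs_of_pos hpos', abs_of_pos (by linarith : (0 : ℝ) < j - i),
      ← div_eq_mul_inv, div_le_div_iff₀ hpos' (by linarith)]
    have h3 : 0 < (d + i + j : ℝ) := by positivity
    have h2 : (z j - z i) * (2 * (d + 2 * j : ℝ) ^ 2) ≤ (z j - z i) * (9 * d * (d + i + j)) :=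
      mul_le_mul_of_nonneg_left hkey hpos'.le
    have : (z j * (j - i)) * (d + i + j) ≤ (9 * d / 8 * (z j - z i)) * (d + i + j) := by
      nlinarith
    exact le_of_mul_le_mul_right this h3

lemma sum_abs_weight_le {d : ℕ} (hd : 0 < d) {z : ℕ → ℝ} (hpos : ∀ i, i ≤ d → 0 < z i)
    (hmono : ∀ i j, i < j → j ≤ d → z i * (d + 2 * j : ℝ) ^ 2 ≤ z j * (d + 2 * i : ℝ) ^ 2) :
    ∑ i ∈ Finset.range (d + 1), |weight d z i| ≤ Real.exp (2 * d) := by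
  have h1 : ∀ i ∈ Finset.range (d + 1), |weight d z i| ≤
      (9 * d / 8) ^ d * ((i.factorial : ℝ) * (d - i).factorial)⁻¹ := by
    intro i hi
    have hi' : i ≤ d := Nat.lt_succ_iff.1 (Finset.mem_range.1 hi)
    rw [weight, Finset.abs_prod]
    have h2 : ∏ j ∈ (Finset.range (d + 1)).erase i, |z j / (z j - z i)| ≤
        ∏ j ∈ (Finset.range (d + 1)).erase i, (9 * d / 8 * |(j : ℝ) - i|⁻¹) := by
      refine Finset.prod_le_prod (fun _ _ => abs_nonneg _) fun j hj => ?_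
      rw [Finset.mem_erase, Finset.mem_range] at hj
      exact abs_div_sub_le hd hi' (Nat.lt_succ_iff.1 hj.2) hj.1 hpos hmono
    refine h2.trans_eq ?_
    rw [Finset.prod_mul_distrib, Finset.prod_const, Finset.card_erase_of_mem hi, Finset.card_range,
      Nat.add_sub_cancel, Finset.prod_inv_distrib, prod_abs_sub hi']
  refine (Finset.sum_le_sum h1).trans ?_
  rw [← Finset.mul_sum, sum_inv_factorial_mul]
  -- The factor `2^d` from the binomial sum turns `9/8` into `9/4 < e`, and `d^d / d! ≤ e^d` gives
  -- the second factor `e^d`.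
  have h3 : (9 * d / 8 : ℝ) ^ d * (2 ^ d / d.factorial) = (9 / 4) ^ d * (d ^ d / d.factorial) := by
    rw [← mul_div_assoc, ← mul_pow, ← mul_div_assoc, ← mul_pow]; congr 2; ring
  rw [h3, two_mul, Real.exp_add]
  have he : (9 / 4 : ℝ) ^ d ≤ Real.exp d := by
    rw [← Real.exp_one_pow]
    have := Real.exp_one_gt_d9
    gcongr
    linarith
  have := Real.pow_div_factorial_le_exp (d : ℝ) (Nat.cast_nonneg d) d
  gcongr

end Lagrange

/-! ## Hafnians as polynomials in the loss parameter -/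

section LossPolynomial

variable {N M : ℕ}

/-- The coefficient of `z ^ j` in the rescaled lossy probability, without the factor `Q`. -/
def lossCoeff (X : Matrix (Fin N) (Fin M) ℂ) (j : ℕ) : ℝ :=
  (M : ℝ) ^ (2 * j) * ∑ S : Finset (Fin N) with S.card = 2 * j, hafSq X Sᶜ

/-- The polynomial `∑ lossCoeff X j * z ^ j`. -/
def lossPoly (X : Matrix (Fin N) (Fin M) ℂ) (z : ℝ) : ℝ :=
  ∑ j ∈ Finset.range (N / 2 + 1), lossCoeff X j * z ^ j

lemma hafSq_nonneg (X : Matrix (Fin N) (Fin M) ℂ) (S : Finset (Fin N)) : 0 ≤ hafSq X S := by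
  unfold hafSq; positivity

lemma lossCoeff_nonneg (X : Matrix (Fin N) (Fin M) ℂ) (j : ℕ) : 0 ≤ lossCoeff X j :=
  mul_nonneg (by positivity) (Finset.sum_nonneg fun _ _ => hafSq_nonneg _ _)

/-- For odd `|S|` the complement is odd as well and has no perfect matching, so only even powers of
`c` survive. -/
lemma hafnian_blockMatrix_eq_lossPoly (hN : Even N) (X : Matrix (Fin N) (Fin M) ℂ) {c z : ℝ}
    (hc : c ^ 2 = (M : ℝ) ^ 2 * z) : hafnian (blockMatrix (c : ℂ) X) = (lossPoly X z : ℂ) := by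
  rw [hafnian_blockMatrix]
  have h1 : ∑ S : Finset (Fin N), (c : ℂ) ^ S.card * (hafSq X Sᶜ : ℂ) =
      ((∑ S : Finset (Fin N), c ^ S.card * hafSq X Sᶜ : ℝ) : ℂ) := by push_cast; rfl
  rw [h1]
  congr 1
  have h2 : ∑ S : Finset (Fin N), c ^ S.card * hafSq X Sᶜ =
      ∑ S : Finset (Fin N) with Even S.card, c ^ S.card * hafSq X Sᶜ := by
    rw [Finset.sum_filter]
    refine Finset.sum_congr rfl fun S _ => ?_
    split_ifs with h
    · rfl
    · have hodd : Odd Sᶜ.card := by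
        rw [Finset.card_compl, Fintype.card_fin]
        rw [Nat.not_even_iff_odd] at h
        have hle := S.card_le_univ
        rw [Fintype.card_fin] at hle
        exact Nat.Even.sub_odd hle hN h
      rw [hafSq, hafOn_eq_zero_of_odd _ _ hodd]; simp
  rw [h2, lossPoly, ← Finset.sum_fiberwise_of_maps_to (t := Finset.range (N / 2 + 1))
    (g := fun S : Finset (Fin N) => S.card / 2)]
  · refine Finset.sum_congr rfl fun j _ => ?_
    rw [lossCoeff, Finset.mul_sum, Finset.sum_mul, Finset.filter_filter]
    refine Finset.sum_congr ?_ fun S hS => ?_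
    · ext S
      simp only [Finset.mem_filter, Finset.mem_univ, true_and]
      constructor
      · rintro ⟨⟨k, hk⟩, h⟩; omega
      · intro h; exact ⟨⟨j, by omega⟩, by omega⟩
    · rw [Finset.mem_filter] at hS
      rw [hS.2, pow_mul, hc, mul_pow, pow_mul]
      ring
  · intro S _
    have hle := S.card_le_univ
    rw [Fintype.card_fin] at hle
    rw [Finset.mem_range]
    exact Nat.lt_succ_of_le (Nat.div_le_div_right hle)

lemma lossCoeff_zero (X : Matrix (Fin N) (Fin M) ℂ) :
    ((lossCoeff X 0 : ℝ) : ℂ) = idealProb X := by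
  rw [idealProb_eq, lossCoeff]
  have : (Finset.univ.filter fun S : Finset (Fin N) => S.card = 2 * 0) = {∅} := by
    ext S; simp
  rw [this]
  simp

lemma integrable_lossCoeff [NeZero M] (j : ℕ) :
    Integrable (fun X : Fin N → Fin M → ℂ => lossCoeff (Matrix.of X) j) (gaussianLaw N M) :=
  (integrable_finsetSum _ fun _ _ => integrable_hafSq _).const_mul _

/-- Passing from `j` to `j + 1` multiplies the falling factorial by `(2k + 2)(2k + 1)` and removes
the factor `(2k + 1)(M + 2k)` from the moment, with `k = n - j - 1`. The bound then follows from `M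
≤ M + 2k` and `2k + 2 ≤ 2n`. -/
lemma hafMoment_ratio (M n : ℕ) {j : ℕ} (hj : j ≤ n) :
    (2 * n).choose (2 * j) * (2 * j).factorial * hafMoment M (n - j) * M ^ j ≤
      hafMoment M n * (2 * n) ^ j := by
  induction j with
  | zero => simp
  | succ j ih =>
    have ih := ih (by omega)
    obtain ⟨k, rfl⟩ := Nat.exists_eq_add_of_le' hj
    have e1 : k + (j + 1) - j = k + 1 := by omega
    have e2 : k + (j + 1) - (j + 1) = k := by omega
    rw [e1, hafMoment, Finset.prod_range_succ, ← hafMoment] at ih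
    rw [e2]
    have h1 : (2 * (k + (j + 1))).choose (2 * (j + 1)) * (2 * (j + 1)).factorial =
        (2 * (k + (j + 1))).choose (2 * j) * (2 * j).factorial * ((2 * k + 2) * (2 * k + 1)) := by
      rw [mul_comm, ← Nat.descFactorial_eq_factorial_mul_choose,
        mul_comm (Nat.choose _ _), ← Nat.descFactorial_eq_factorial_mul_choose,
        show 2 * (j + 1) = 2 * j + 1 + 1 by ring, Nat.descFactorial_succ, Nat.descFactorial_succ,
        show 2 * (k + (j + 1)) - (2 * j + 1) = 2 * k + 1 by omega,
        show 2 * (k + (j + 1)) - 2 * j = 2 * k + 2 by omega]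
      ring
    rw [h1]
    calc _ = (2 * (k + (j + 1))).choose (2 * j) * (2 * j).factorial *
          (hafMoment M k * ((2 * k + 1) * M)) * M ^ j * (2 * k + 2) := by ring
      _ ≤ (2 * (k + (j + 1))).choose (2 * j) * (2 * j).factorial *
          (hafMoment M k * ((2 * k + 1) * (M + 2 * k))) * M ^ j * (2 * (k + (j + 1))) := by
        gcongr <;> omega
      _ ≤ hafMoment M (k + (j + 1)) * (2 * (k + (j + 1))) ^ j * (2 * (k + (j + 1))) := by gcongr
      _ = _ := by ring

/-- The unit of error is exactly the Gaussian mean of `P(X)`, so all moment bounds come out in this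
unit. -/
lemma errorUnit_eq (hN : Even N) (hM : Even M) (hM0 : 0 < M) :
    errorUnit N M = hafMoment M (N / 2) := by
  obtain ⟨n, rfl⟩ := hN
  obtain ⟨m, rfl⟩ := hM
  rw [← two_mul, ← two_mul, errorUnit, Nat.mul_div_cancel_left _ (by norm_num),
    Nat.mul_div_cancel_left _ (by norm_num)]
  have h : ∀ n, hafMoment (2 * m) n * n.factorial = m.ascFactorial n * (2 * n).factorial := by
    intro n
    induction n with
    | zero => simp [hafMoment]
    | succ n ih =>
      rw [hafMoment, Finset.prod_range_succ, ← hafMoment, Nat.ascFactorial_succ,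
        show 2 * (n + 1) = 2 * n + 1 + 1 by ring, Nat.factorial_succ, Nat.factorial_succ,
        Nat.factorial_succ]
      linear_combination ((2 * n + 1) * (2 * m + 2 * n) * (n + 1)) * ih
  have h2 := h n
  rw [Nat.ascFactorial_eq_factorial_mul_choose'] at h2
  have h3 : hafMoment (2 * m) n = (m + n - 1).choose n * (2 * n).factorial :=
    Nat.eq_of_mul_eq_mul_right n.factorial_pos (by rw [h2]; ring)
  rw [h3]; push_cast; rfl

/-- There are `(N choose 2j)` sets `S`, each contributing the moment of a subhafnian of size `N -
2j`; `hafMoment_ratio` compares the product with the full moment. The factorial `(2j)!` left in the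
denominator is what makes truncation possible. -/
lemma integral_lossCoeff_le [NeZero M] (hN : Even N) (hM : Even M) {j : ℕ} (hj : j ≤ N / 2)
    {z x : ℝ} (hz : 0 ≤ z) (hx : (N : ℝ) * M * z ≤ x ^ 2) :
    (∫ X : Fin N → Fin M → ℂ, lossCoeff (Matrix.of X) j ∂(gaussianLaw N M)) * z ^ j ≤
      errorUnit N M * (x ^ (2 * j) / (2 * j).factorial) := by
  rw [errorUnit_eq hN hM (NeZero.pos M)]
  obtain ⟨n, rfl⟩ := hN
  rw [← two_mul] at *
  rw [Nat.mul_div_cancel_left _ (by norm_num)] at *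
  have h1 : ∫ X : Fin (2 * n) → Fin M → ℂ, lossCoeff (Matrix.of X) j ∂(gaussianLaw (2 * n) M) =
      (M : ℝ) ^ (2 * j) * ((2 * n).choose (2 * j) * hafMoment M (n - j)) := by
    simp only [lossCoeff]
    rw [integral_const_mul, integral_finsetSum _ fun _ _ => integrable_hafSq _,
      Finset.sum_congr rfl (g := fun _ => (hafMoment M (n - j) : ℝ)), Finset.sum_const]
    · rw [← Finset.powerset_univ, ← Finset.powersetCard_eq_filter, Finset.card_powersetCard,
        Finset.card_univ, Fintype.card_fin, nsmul_eq_mul]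
    · intro S hS
      rw [Finset.mem_filter] at hS
      refine integral_hafSq ?_
      rw [Finset.card_compl, Fintype.card_fin, hS.2]
      omega
  have h2 : ((2 * n).choose (2 * j) * (2 * j).factorial * hafMoment M (n - j) * M ^ j : ℝ) ≤
      hafMoment M n * (2 * n) ^ j := by exact_mod_cast hafMoment_ratio M n hj
  have hf : (0 : ℝ) < (2 * j).factorial := by positivity
  rw [h1]
  calc (M : ℝ) ^ (2 * j) * ((2 * n).choose (2 * j) * hafMoment M (n - j)) * z ^ j
      = ((2 * n).choose (2 * j) * (2 * j).factorial * hafMoment M (n - j) * M ^ j) *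
          (M * z) ^ j / (2 * j).factorial := by
        rw [mul_pow, two_mul j, pow_add]; field_simp
    _ ≤ (hafMoment M n * (2 * n) ^ j) * (M * z) ^ j / (2 * j).factorial := by gcongr
    _ = hafMoment M n * (((2 * n : ℕ) : ℝ) * M * z) ^ j / (2 * j).factorial := by
        rw [mul_assoc, ← mul_pow]; push_cast; ring
    _ ≤ hafMoment M n * (x ^ 2) ^ j / (2 * j).factorial := by gcongr
    _ = hafMoment M n * (x ^ (2 * j) / (2 * j).factorial) := by rw [pow_mul]; ring

end LossPolynomial

/-! ## The extrapolated estimate and its error -/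

section Estimate

lemma tanh_squeezing_sq {N M : ℕ} {τ : ℝ} (hM : 0 < M) (hτ : 0 < τ) :
    Real.tanh (squeezing N M τ) ^ 2 = N / (τ * M + N) := by
  have hM' : (0 : ℝ) < M := by exact_mod_cast hM
  have hx : (0 : ℝ) ≤ (N : ℝ) / (τ * M) := by positivity
  rw [squeezing, Real.tanh_arsinh, div_pow, Real.sq_sqrt hx, Real.sq_sqrt (by positivity)]
  have : τ * M ≠ 0 := by positivity
  field_simp

lemma lossyProb_eq {N M : ℕ} (hN : 0 < N) (hNe : Even N) (hM : 0 < M) (hMe : Even M) {τ η : ℝ}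
    (hτ : 0 < τ) (hη : (1 - η) ^ 2 < 1) (X : Matrix (Fin N) (Fin M) ℂ) :
    lossyProb (squeezing N M τ) η X =
      ((lossPoly X ((1 - η) ^ 2 * (N / (τ * M + N))) /
        qPoly N M ((1 - η) ^ 2 * (N / (τ * M + N))) : ℝ) : ℂ) := by
  have hM' : (0 : ℝ) < M := by exact_mod_cast hM
  have hN' : (0 : ℝ) < N := by exact_mod_cast hN
  have ht := tanh_squeezing_sq (N := N) hM hτ
  have hlt : (1 - η) ^ 2 * Real.tanh (squeezing N M τ) ^ 2 < 1 := by
    rw [ht]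
    have h1 : (N : ℝ) / (τ * M + N) ≤ 1 := by
      rw [div_le_one (by positivity)]
      have : 0 < τ * M := by positivity
      linarith
    calc (1 - η) ^ 2 * ((N : ℝ) / (τ * M + N)) ≤ (1 - η) ^ 2 * 1 := by gcongr
      _ < 1 := by linarith
  rw [lossyProb, Q_eq_qPoly hN hNe hMe hlt,
    hafnian_blockMatrix_eq_lossPoly hNe X (z := (1 - η) ^ 2 * (N / (τ * M + N))), ht]
  · rw [Complex.ofReal_div]; exact (div_eq_inv_mul _ _).symm
  · rw [← ht]; ring

lemma abs_readReal_div_sub_le {b : ℕ} {x : ℝ} (hx : |x| ≤ 2 ^ b) :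
    |(readReal b x : ℝ) / 2 ^ b - x| ≤ (2 ^ b)⁻¹ := by
  obtain ⟨h1, h2⟩ := abs_le.1 hx
  have hb : (0 : ℝ) < 2 ^ b := by positivity
  have e4 : (4 : ℝ) ^ b = 2 ^ b * 2 ^ b := by rw [← mul_pow]; norm_num
  have h3 : ⌊2 ^ b * x⌋ ≤ (4 : ℤ) ^ b := by
    have : (⌊2 ^ b * x⌋ : ℝ) ≤ (4 : ℝ) ^ b := (Int.floor_le _).trans (by rw [e4]; gcongr)
    exact_mod_cast this
  have h4 : -(4 : ℤ) ^ b ≤ ⌊2 ^ b * x⌋ := by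
    rw [Int.le_floor]; push_cast; rw [e4]; nlinarith
  rw [readReal, min_eq_right h3, max_eq_right h4]
  have h5 := Int.floor_le (2 ^ b * x)
  have h6 := Int.lt_floor_add_one (2 ^ b * x)
  rw [abs_sub_comm, abs_of_nonneg]
  · rw [sub_le_iff_le_add, ← one_div, ← add_div, le_div_iff₀ hb]; linarith
  · rw [sub_nonneg, div_le_iff₀ hb]; linarith

/-- The weights reproduce `A 0` and annihilate the degrees `1, …, d`. What is left is the error in
the values and the terms of degree above `d`, both amplified by the sum of the absolute weights;
nonnegativity of `A` lets the tail be measured at the last node alone. -/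
lemma abs_extrapolate_sub_le {n d : ℕ} (hd : 0 < d) {A z q r : ℕ → ℝ} {e : ℝ}
    (hA : ∀ j, 0 ≤ A j) (hpos : ∀ i, i ≤ d → 0 < z i)
    (hmono : ∀ i j, i < j → j ≤ d → z i * (d + 2 * j : ℝ) ^ 2 ≤ z j * (d + 2 * i : ℝ) ^ 2)
    (hinj : Set.InjOn z (Finset.range (d + 1))) (hle : ∀ i, i ≤ d → z i ≤ z d)
    (hr : ∀ i, i ≤ d → |q i * r i - ∑ j ∈ Finset.range (n + 1), A j * z i ^ j| ≤ e) :
    |∑ i ∈ Finset.range (d + 1), weight d z i * (q i * r i) - A 0| ≤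
      Real.exp (2 * d) *
        (e + ∑ j ∈ Finset.range (n + 1) with d < j, A j * z d ^ j) := by
  have hmem : ∀ i ∈ Finset.range (d + 1), i ≤ d := fun i hi =>
    Nat.lt_succ_iff.1 (Finset.mem_range.1 hi)
  have hW := sum_abs_weight_le hd hpos hmono
  have he : 0 ≤ e := (abs_nonneg _).trans (hr 0 (Nat.zero_le _))
  have hT : 0 ≤ ∑ j ∈ Finset.range (n + 1) with d < j, A j * z d ^ j :=
    Finset.sum_nonneg fun j _ => mul_nonneg (hA j) (pow_nonneg (hpos d le_rfl).le _)
  have h1 : ∑ i ∈ Finset.range (d + 1),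
      weight d z i * (∑ j ∈ Finset.range (n + 1), A j * z i ^ j) - A 0 =
      ∑ j ∈ Finset.range (n + 1) with d < j,
        A j * ∑ i ∈ Finset.range (d + 1), weight d z i * z i ^ j := by
    have h2 : ∑ i ∈ Finset.range (d + 1),
        weight d z i * (∑ j ∈ Finset.range (n + 1), A j * z i ^ j) =
        ∑ j ∈ Finset.range (n + 1),
          A j * ∑ i ∈ Finset.range (d + 1), weight d z i * z i ^ j := by
      simp only [Finset.mul_sum]
      rw [Finset.sum_comm]
      exact Finset.sum_congr rfl fun _ _ => Finset.sum_congr rfl fun _ _ => by ring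
    have h3 : A 0 = ∑ j ∈ Finset.range (n + 1) with ¬ d < j,
        A j * ∑ i ∈ Finset.range (d + 1), weight d z i * z i ^ j := by
      rw [Finset.sum_eq_single 0]
      · rw [sum_weight_mul_pow hinj (Nat.zero_le d), if_pos rfl, mul_one]
      · intro j hj hj0
        rw [Finset.mem_filter, not_lt] at hj
        rw [sum_weight_mul_pow hinj hj.2, if_neg hj0, mul_zero]
      · intro h; simp at h
    rw [h2, sub_eq_iff_eq_add, ← Finset.sum_filter_add_sum_filter_not _ (fun j => d < j), ← h3]
  have h4 : ∑ i ∈ Finset.range (d + 1), weight d z i * (q i * r i) - A 0 =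
      ∑ i ∈ Finset.range (d + 1),
        weight d z i * (q i * r i - ∑ j ∈ Finset.range (n + 1), A j * z i ^ j) +
      ∑ j ∈ Finset.range (n + 1) with d < j,
        A j * ∑ i ∈ Finset.range (d + 1), weight d z i * z i ^ j := by
    rw [← h1]
    simp only [mul_sub, Finset.sum_sub_distrib]
    ring
  rw [h4, mul_add]
  refine (abs_add_le _ _).trans (add_le_add ?_ ?_)
  · refine (Finset.abs_sum_le_sum_abs _ _).trans
      (le_trans ?_ (mul_le_mul_of_nonneg_right hW he))
    rw [Finset.sum_mul]
    refine Finset.sum_le_sum fun i hi => ?_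
    rw [abs_mul]
    exact mul_le_mul_of_nonneg_left (hr i (hmem i hi)) (abs_nonneg _)
  · rw [Finset.mul_sum]
    refine (Finset.abs_sum_le_sum_abs _ _).trans (Finset.sum_le_sum fun j _ => ?_)
    rw [abs_mul, abs_of_nonneg (hA j), mul_left_comm]
    refine mul_le_mul_of_nonneg_left ?_ (hA j)
    refine (Finset.abs_sum_le_sum_abs _ _).trans (le_trans ?_
      (mul_le_mul_of_nonneg_right hW (pow_nonneg (hpos d le_rfl).le j)))
    rw [Finset.sum_mul]
    refine Finset.sum_le_sum fun i hi => ?_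
    rw [abs_mul, abs_of_nonneg (pow_nonneg (hpos i (hmem i hi)).le j)]
    have := hpos i (hmem i hi)
    have := hle i (hmem i hi)
    gcongr

/-- The loss `1 - η` at the `i`-th node. -/
def nodeLoss (u₀ : ℝ) (d i : ℕ) : ℝ := u₀ * (d + 2 * i) / d

/-- The value of `(1 - η)² tanh² r` at the `i`-th node. -/
def nodeParam (s : SqueezingRule) (N M : ℕ) (ηstar u₀ : ℝ) (d i : ℕ) : ℝ :=
  nodeLoss u₀ d i ^ 2 * (N / (s.rate ηstar (1 - nodeLoss u₀ d i) * M + N))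

/-- The estimate of `P(X)` by extrapolation. -/
def estimate (s : SqueezingRule) {N M : ℕ} (ηstar u₀ : ℝ) (d prec : ℕ) (O : Oracle N M)
    (X : Matrix (Fin N) (Fin M) ℂ) : ℝ :=
  ∑ i ∈ Finset.range (d + 1), weight d (nodeParam s N M ηstar u₀ d) i *
    (qPoly N M (nodeParam s N M ηstar u₀ d i) *
      ((readReal prec (O (1 - nodeLoss u₀ d i) X) : ℝ) / 2 ^ prec))

/-! ### Position and order of the nodes -/

section Nodes

variable {s : SqueezingRule} {N M : ℕ} {ηstar u₀ : ℝ} {d : ℕ}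

/-- With `1 - η* ≤ u₀` this keeps every rate asked for below the maximal one. -/
lemma le_nodeLoss (hu0 : 0 ≤ u₀) (hd : 0 < d) (i : ℕ) : u₀ ≤ nodeLoss u₀ d i := by
  have hd' : (0 : ℝ) < d := by exact_mod_cast hd
  rw [nodeLoss, le_div_iff₀ hd']
  have : (0 : ℝ) ≤ i := Nat.cast_nonneg i
  nlinarith

lemma nodeLoss_le (hu0 : 0 ≤ u₀) (hd : 0 < d) {i : ℕ} (hi : i ≤ d) : nodeLoss u₀ d i ≤ 3 * u₀ := by
  have hd' : (0 : ℝ) < d := by exact_mod_cast hd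
  have hi' : (i : ℝ) ≤ d := by exact_mod_cast hi
  rw [nodeLoss, div_le_iff₀ hd']
  nlinarith

lemma le_nodeRate (hu0 : 0 ≤ u₀) (hu3 : 3 * u₀ ≤ 1 / 4) (hη : 3 / 4 ≤ ηstar) (hd : 0 < d) {i : ℕ}
    (hi : i ≤ d) : 3 / 4 ≤ s.rate ηstar (1 - nodeLoss u₀ d i) := by
  have := nodeLoss_le hu0 hd hi
  cases s
  · simp only [SqueezingRule.rate]; linarith
  · exact hη

lemma nodeParam_pos (hN : 0 < N) (hu0 : 0 < u₀) (hu3 : 3 * u₀ ≤ 1 / 4) (hη : 3 / 4 ≤ ηstar)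
    (hd : 0 < d) {i : ℕ} (hi : i ≤ d) : 0 < nodeParam s N M ηstar u₀ d i := by
  have h1 := le_nodeRate (s := s) hu0.le hu3 hη hd hi
  have h2 := hu0.trans_le (le_nodeLoss hu0.le hd i)
  have h3 : (0 : ℝ) < N := by exact_mod_cast hN
  unfold nodeParam
  positivity

/-- Divided by the square of the loss, the parameter is `tanh² r`. It is constant when the squeezing
is fixed, and it grows with the loss when the squeezing is matched to the queried rate, so both
conventions satisfy the spreading hypothesis of the weight bound. -/
lemma nodeParam_mul_sq_le (hN : 0 < N) (hu0 : 0 < u₀) (hu3 : 3 * u₀ ≤ 1 / 4) (hη : 3 / 4 ≤ ηstar)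
    (hd : 0 < d) {i j : ℕ} (hij : i < j) (hj : j ≤ d) :
    nodeParam s N M ηstar u₀ d i * (d + 2 * j : ℝ) ^ 2 ≤
      nodeParam s N M ηstar u₀ d j * (d + 2 * i : ℝ) ^ 2 := by
  have hN' : (0 : ℝ) < N := by exact_mod_cast hN
  have hij' : (i : ℝ) ≤ j := by exact_mod_cast hij.le
  have h1 := le_nodeRate (s := s) hu0.le hu3 hη hd hj
  have h2 : s.rate ηstar (1 - nodeLoss u₀ d j) ≤ s.rate ηstar (1 - nodeLoss u₀ d i) := by
    cases s
    · simp only [SqueezingRule.rate, nodeLoss]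
      gcongr
    · exact le_rfl
  have h3 : (N : ℝ) / (s.rate ηstar (1 - nodeLoss u₀ d i) * M + N) ≤
      N / (s.rate ηstar (1 - nodeLoss u₀ d j) * M + N) := by gcongr
  have e : ∀ k, nodeLoss u₀ d k = u₀ / d * (d + 2 * k) := fun k => by rw [nodeLoss]; ring
  unfold nodeParam
  calc _ = (u₀ / d * (d + 2 * i) * (d + 2 * j)) ^ 2 *
        (N / (s.rate ηstar (1 - nodeLoss u₀ d i) * M + N)) := by rw [e i]; ring
    _ ≤ (u₀ / d * (d + 2 * i) * (d + 2 * j)) ^ 2 *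
        (N / (s.rate ηstar (1 - nodeLoss u₀ d j) * M + N)) := by gcongr
    _ = _ := by rw [e j]; ring

lemma nodeParam_lt (hN : 0 < N) (hu0 : 0 < u₀) (hu3 : 3 * u₀ ≤ 1 / 4) (hη : 3 / 4 ≤ ηstar)
    (hd : 0 < d) {i j : ℕ} (hij : i < j) (hj : j ≤ d) :
    nodeParam s N M ηstar u₀ d i < nodeParam s N M ηstar u₀ d j := by
  have h1 := nodeParam_mul_sq_le (s := s) (M := M) hN hu0 hu3 hη hd hij hj
  have hd' : (0 : ℝ) < d := by exact_mod_cast hd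
  have h2 : ((d : ℝ) + 2 * i) ^ 2 < (d + 2 * j : ℝ) ^ 2 := by
    have : (i : ℝ) < j := by exact_mod_cast hij
    gcongr
  have h3 := nodeParam_pos (s := s) (M := M) hN hu0 hu3 hη hd hj
  have h4 : 0 < (d + 2 * j : ℝ) ^ 2 := by positivity
  by_contra hcon
  rw [not_lt] at hcon
  nlinarith

lemma injOn_nodeParam (hN : 0 < N) (hu0 : 0 < u₀) (hu3 : 3 * u₀ ≤ 1 / 4) (hη : 3 / 4 ≤ ηstar)
    (hd : 0 < d) : Set.InjOn (nodeParam s N M ηstar u₀ d) (Finset.range (d + 1)) := by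
  intro i hi j hj h
  rw [Finset.mem_coe, Finset.mem_range, Nat.lt_succ_iff] at hi hj
  rcases lt_trichotomy i j with hij | hij | hij
  · exact absurd h (nodeParam_lt hN hu0 hu3 hη hd hij hj).ne
  · exact hij
  · exact absurd h (nodeParam_lt hN hu0 hu3 hη hd hij hi).ne'

end Nodes

lemma measure_lt_le {α : Type*} [MeasurableSpace α] {μ : Measure α} [IsProbabilityMeasure μ]
    {f : α → ℝ} (hf : ∀ x, 0 ≤ f x) (hint : Integrable f μ) {θ p : ℝ} (hθ : 0 < θ)
    (h : ∫ x, f x ∂μ ≤ p * θ) : μ {x | θ < f x} ≤ ENNReal.ofReal p := by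
  have h1 := mul_meas_ge_le_integral_of_nonneg (ae_of_all μ hf) hint θ
  have h2 : μ.real {x | θ ≤ f x} ≤ p := by
    rw [← mul_le_mul_iff_right₀ hθ]; linarith
  calc μ {x | θ < f x} ≤ μ {x | θ ≤ f x} := measure_mono fun x (hx : θ < f x) => (hx.le : θ ≤ f x)
    _ = ENNReal.ofReal (μ.real {x | θ ≤ f x}) := by
      rw [measureReal_def, ENNReal.ofReal_toReal (measure_ne_top _ _)]
    _ ≤ ENNReal.ofReal p := ENNReal.ofReal_le_ofReal h2

/-- From `(2j)! ≥ (2j/e)^(2j)` and `4g / (2j) ≤ 1/16` each term is at most `(e/16)^(2j)`, and this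
is at most `32^(-j)` because `e² ≤ 8`. The rest is a geometric series. -/
lemma sum_tail_le {g d n : ℕ} (hg : 0 < g) (hd : 32 * g ≤ d) :
    ∑ j ∈ Finset.range (n + 1) with d < j, (4 * (g : ℝ)) ^ (2 * j) / (2 * j).factorial ≤
      (1 / 32) ^ d / 16 := by
  have h1 : ∀ j, d < j → (4 * (g : ℝ)) ^ (2 * j) / (2 * j).factorial ≤ (1 / 32) ^ j := by
    intro j hj
    have hgR : (1 : ℝ) ≤ g := by exact_mod_cast hg
    have hj' : 32 * (g : ℝ) ≤ j := by exact_mod_cast (hd.trans hj.le)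
    have hjpos : (0 : ℝ) < 2 * j := by linarith
    have h2 := Real.pow_div_factorial_le_exp (2 * j : ℝ) hjpos.le (2 * j)
    have h3 : (4 * (g : ℝ)) ^ (2 * j) / (2 * j).factorial =
        (4 * (g : ℝ) / (2 * j)) ^ (2 * j) * ((2 * j : ℝ) ^ (2 * j) / (2 * j).factorial) := by
      rw [div_pow]; field_simp
    have h4 : 4 * (g : ℝ) / (2 * j) ≤ 1 / 16 := by
      rw [div_le_div_iff₀ hjpos (by norm_num)]; linarith
    rw [h3]
    calc (4 * (g : ℝ) / (2 * j)) ^ (2 * j) * ((2 * j : ℝ) ^ (2 * j) / (2 * j).factorial)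
        ≤ (1 / 16) ^ (2 * j) * Real.exp (2 * j) := by gcongr
      _ = ((1 / 16) ^ 2 * Real.exp 1 ^ 2) ^ j := by
        rw [mul_pow, ← pow_mul, ← pow_mul, Real.exp_one_pow]; push_cast; rfl
      _ ≤ (1 / 32) ^ j := by
        have := Real.exp_one_lt_d9
        have h0 := Real.exp_pos 1
        gcongr
        nlinarith
  have h2 : ∀ m, ∑ j ∈ Finset.Ico (d + 1) m, (1 / 32 : ℝ) ^ j ≤ (1 / 32) ^ d / 16 := by
    intro m
    have h3 : ∀ k, ∑ i ∈ Finset.range k, (1 / 32 : ℝ) ^ i ≤ 2 - (1 / 32) ^ k := by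
      intro k
      induction k with
      | zero => norm_num
      | succ k ih =>
        rw [Finset.sum_range_succ, pow_succ]
        have : (0 : ℝ) ≤ (1 / 32) ^ k := by positivity
        have h : (1 / 32 : ℝ) ^ k ≤ 1 := pow_le_one₀ (by norm_num) (by norm_num)
        rcases Nat.eq_zero_or_pos k with rfl | hk
        · norm_num
        · have h5 : ∑ i ∈ Finset.range k, (1 / 32 : ℝ) ^ i = (1 - (1 / 32) ^ k) * (32 / 31) := by
            rw [geom_sum_eq (by norm_num)]; ring
          rw [h5]
          have h6 : (1 / 32 : ℝ) ^ k ≤ 1 / 32 := by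
            calc (1 / 32 : ℝ) ^ k ≤ (1 / 32) ^ 1 :=
                  pow_le_pow_of_le_one (by norm_num) (by norm_num) hk
              _ = 1 / 32 := by norm_num
          linarith
    rw [Finset.sum_Ico_eq_sum_range]
    simp only [pow_add, ← Finset.mul_sum]
    have h4 := h3 (m - (d + 1))
    have h5 : (0 : ℝ) ≤ (1 / 32) ^ (m - (d + 1)) := by positivity
    calc (1 / 32 : ℝ) ^ d * (1 / 32) ^ 1 * ∑ i ∈ Finset.range (m - (d + 1)), (1 / 32 : ℝ) ^ i
        ≤ (1 / 32 : ℝ) ^ d * (1 / 32) ^ 1 * 2 := by gcongr; linarith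
      _ = (1 / 32) ^ d / 16 := by ring
  have h3 : (Finset.range (n + 1)).filter (fun j => d < j) = Finset.Ico (d + 1) (n + 1) := by
    ext j; simp only [Finset.mem_filter, Finset.mem_range, Finset.mem_Ico]; omega
  rw [h3]
  refine (Finset.sum_le_sum fun j hj => h1 j ?_).trans (h2 _)
  rw [Finset.mem_Ico] at hj; omega

/-- The terms of degree above `d` of `lossPoly`. -/
def lossTail {N M : ℕ} (d : ℕ) (X : Matrix (Fin N) (Fin M) ℂ) (z : ℝ) : ℝ :=
  ∑ j ∈ Finset.range (N / 2 + 1) with d < j, lossCoeff X j * z ^ j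

lemma measure_lossTail_lt_le {N M : ℕ} [NeZero M] (hNe : Even N) (hMe : Even M) {d : ℕ}
    {z x θ p : ℝ} (hz : 0 ≤ z) (hx : (N : ℝ) * M * z ≤ x ^ 2) (hθ : 0 < θ)
    (h : errorUnit N M * ∑ j ∈ Finset.range (N / 2 + 1) with d < j,
      x ^ (2 * j) / (2 * j).factorial ≤ p * θ) :
    gaussianLaw N M {X | θ < lossTail d (Matrix.of X) z} ≤ ENNReal.ofReal p := by
  refine measure_lt_le (f := fun X => lossTail d (Matrix.of X) z)
    (fun X => Finset.sum_nonneg fun j _ =>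
      mul_nonneg (lossCoeff_nonneg _ _) (pow_nonneg hz _)) ?_ hθ (le_trans ?_ h)
  · unfold lossTail
    exact integrable_finsetSum _ fun j _ => (integrable_lossCoeff j).mul_const _
  · unfold lossTail
    rw [integral_finsetSum _ fun j _ => (integrable_lossCoeff j).mul_const _, Finset.mul_sum]
    refine Finset.sum_le_sum fun j hj => ?_
    rw [Finset.mem_filter, Finset.mem_range, Nat.lt_succ_iff] at hj
    rw [integral_mul_const]
    exact integral_lossCoeff_le hNe hMe hj.1 hz hx

lemma measure_lossPoly_lt_le {N M : ℕ} [NeZero M] (hNe : Even N) (hMe : Even M)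
    {z x θ p : ℝ} (hz : 0 ≤ z) (hx0 : 0 ≤ x) (hx : (N : ℝ) * M * z ≤ x ^ 2) (hθ : 0 < θ)
    (h : errorUnit N M * Real.exp x ≤ p * θ) :
    gaussianLaw N M {X | θ < lossPoly (Matrix.of X) z} ≤ ENNReal.ofReal p := by
  have hB : 0 ≤ errorUnit N M := by unfold errorUnit; positivity
  refine measure_lt_le (f := fun X => lossPoly (Matrix.of X) z)
    (fun X => Finset.sum_nonneg fun j _ =>
      mul_nonneg (lossCoeff_nonneg _ _) (pow_nonneg hz _)) ?_ hθ (le_trans ?_ h)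
  · unfold lossPoly
    exact integrable_finsetSum _ fun j _ => (integrable_lossCoeff j).mul_const _
  · unfold lossPoly
    rw [integral_finsetSum _ fun j _ => (integrable_lossCoeff j).mul_const _]
    refine le_trans ?_ (mul_le_mul_of_nonneg_left
      (sum_pow_div_factorial_even_le_exp hx0 (N / 2 + 1)) hB)
    rw [Finset.mul_sum]
    refine Finset.sum_le_sum fun j hj => ?_
    rw [Finset.mem_range, Nat.lt_succ_iff] at hj
    rw [integral_mul_const]
    exact integral_lossCoeff_le hNe hMe hj hz hx

set_option maxHeartbeats 1000000 in
/-- The estimate is accurate outside a set of small probability. -/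
theorem measure_estimate_error_le (s : SqueezingRule) {N M : ℕ} (hN : 0 < N) (hNe : Even N)
    (hM : 0 < M) (hMe : Even M) {ηstar u₀ ε₀ δ₀ ε δ : ℝ} {d₀ g d prec : ℕ} (O : Oracle N M)
    (hη1 : ηstar ≤ 1) (hη : 3 / 4 ≤ ηstar) (hu : 1 - ηstar ≤ u₀) (hu0 : 0 < u₀)
    (hu3 : 3 * u₀ ≤ 1 / 4) (hg : 0 < g) (hug : u₀ * N ≤ 65 / 64 * g) (hd : d = d₀ + 32 * g)
    (hε₀ : 0 < ε₀) (hδ₀ : 0 < δ₀)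
    (hd₀ : (N : ℝ) ≤ ε₀ * δ₀ * 3 ^ d₀)
    (hprec₁ : 5 * errorUnit N M * Real.exp (4 * g) ≤ δ₀ * 2 ^ prec)
    (hprec₂ : 4 * (Real.exp (2 * d) * Real.exp (4 * g)) ≤ ε₀ * 2 ^ prec)
    (hεle : Real.exp (2 * d) * Real.exp (4 * g) * ε ≤ ε₀ / 4) (hεδ : ε * δ₀ ≤ 1)
    (hδle : (d + 1) * δ ≤ δ₀ / 4) (hO : SolvesGHED s ηstar ε δ O) :
    gaussianLaw N M {X | ¬ ‖((estimate s ηstar u₀ d prec O (Matrix.of X) : ℝ) : ℂ) -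
      idealProb (Matrix.of X)‖ ≤ ε₀ * errorUnit N M} ≤ ENNReal.ofReal δ₀ := by
  have : NeZero M := ⟨hM.ne'⟩
  have hM' : (1 : ℝ) ≤ M := by exact_mod_cast hM
  have hN' : (1 : ℝ) ≤ N := by exact_mod_cast hN
  have hg' : (1 : ℝ) ≤ g := by exact_mod_cast hg
  have hdpos : 0 < d := by omega
  have hdR : (1 : ℝ) ≤ d := by exact_mod_cast hdpos
  set u := nodeLoss u₀ d with hudef
  set z := nodeParam s N M ηstar u₀ d with hzdef
  set τ : ℕ → ℝ := fun i => s.rate ηstar (1 - u i) with hτdef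
  have hz_eq : ∀ i, z i = u i ^ 2 * (N / (τ i * M + N)) := fun i => rfl
  have hu_ge : ∀ i, u₀ ≤ u i := le_nodeLoss hu0.le hdpos
  have hu_le : ∀ i, i ≤ d → u i ≤ 3 * u₀ := fun i => nodeLoss_le hu0.le hdpos
  have hτ_ge : ∀ i, i ≤ d → 3 / 4 ≤ τ i := fun i => le_nodeRate hu0.le hu3 hη hdpos
  have hτ_le : ∀ i, τ i ≤ 1 := by
    intro i
    have := hu_ge i
    cases s
    · simp only [hτdef, SqueezingRule.rate]; linarith
    · simp only [hτdef, SqueezingRule.rate]; exact hη1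
  have hden : ∀ i, i ≤ d → 0 < τ i * M + N := by
    intro i hi
    have := hτ_ge i hi
    positivity
  have hzpos : ∀ i, i ≤ d → 0 < z i := fun i => nodeParam_pos hN hu0 hu3 hη hdpos
  have hmono : ∀ i j, i < j → j ≤ d → z i * (d + 2 * j : ℝ) ^ 2 ≤ z j * (d + 2 * i : ℝ) ^ 2 :=
    fun i j => nodeParam_mul_sq_le hN hu0 hu3 hη hdpos
  have hlt : ∀ i j, i < j → j ≤ d → z i < z j := fun i j => nodeParam_lt hN hu0 hu3 hη hdpos
  have hinj : Set.InjOn z (Finset.range (d + 1)) := injOn_nodeParam hN hu0 hu3 hη hdpos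
  have hle : ∀ i, i ≤ d → z i ≤ z d := by
    intro i hi
    rcases hi.lt_or_eq with h | h
    · exact (hlt i d h le_rfl).le
    · rw [h]
  -- The losses are at most `3 u₀`, the rates at least `3/4`, and `u₀ N ≤ (65/64) g`; the result `12
  -- (65/64)² < 16` is where `4g` comes from.
  have hkey : ∀ i, i ≤ d → ((M : ℝ) + N) * N * z i ≤ (4 * g) ^ 2 := by
    intro i hi
    have h1 := hden i hi
    have h2 := hτ_ge i hi
    have h3 := hτ_le i
    have h4 := hu_le i hi
    have h5 : 0 < u i := hu0.trans_le (hu_ge i)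
    have h6 : ((M : ℝ) + N) / (τ i * M + N) ≤ 4 / 3 := by
      rw [div_le_div_iff₀ h1 (by norm_num)]; nlinarith
    calc ((M : ℝ) + N) * N * z i = (u i * N) ^ 2 * ((M + N) / (τ i * M + N)) := by
          rw [hz_eq]; ring
      _ ≤ (3 * u₀ * N) ^ 2 * (4 / 3) := by gcongr
      _ = 12 * (u₀ * N) ^ 2 := by ring
      _ ≤ 12 * (65 / 64 * g) ^ 2 := by gcongr
      _ ≤ (4 * g) ^ 2 := by nlinarith
  have hkey' : (N : ℝ) * M * z d ≤ (4 * g) ^ 2 := by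
    refine le_trans ?_ (hkey d le_rfl)
    have := hzpos d le_rfl
    have h1 : (N : ℝ) * M ≤ (M + N) * N := by nlinarith
    gcongr
  have hB0 : (1 : ℝ) ≤ errorUnit N M := by
    rw [errorUnit_eq hNe hMe hM]
    have : 0 < hafMoment M (N / 2) := Finset.prod_pos fun k _ => by positivity
    exact_mod_cast this
  set B := errorUnit N M with hBdef
  have hBpos : 0 < B := by linarith
  set E2 := Real.exp (2 * d) with hE2
  set E4 := Real.exp (4 * g) with hE4
  have hE2pos : 0 < E2 := Real.exp_pos _
  have hE4one : 1 ≤ E4 := Real.one_le_exp (by positivity)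
  have hq_le : ∀ i, i ≤ d → qPoly N M (z i) ≤ E4 := fun i hi =>
    qPoly_le_exp hM (hzpos i hi).le (by positivity) (hkey i hi)
  have hq_ge : ∀ i, i ≤ d → 1 ≤ qPoly N M (z i) := fun i hi => one_le_qPoly hM (hzpos i hi).le
  have hprob : ∀ i, i ≤ d → ∀ X : Matrix (Fin N) (Fin M) ℂ,
      lossyProb (squeezing N M (s.rate ηstar (1 - u i))) (1 - u i) X =
        ((lossPoly X (z i) / qPoly N M (z i) : ℝ) : ℂ) := by
    intro i hi X
    have h2 := hτ_ge i hi
    have h4 := hu_le i hi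
    have h5 : 0 < u i := hu0.trans_le (hu_ge i)
    rw [lossyProb_eq hN hNe hM hMe (by simp only [hτdef] at h2; linarith) (by nlinarith)]
    simp only [sub_sub_cancel]
    rfl
  have hzd := (hzpos d le_rfl).le
  -- The tail may use half of the error after amplification by `E2`. Since `e² / 32 ≤ 1/3`, the
  -- amplified mean is below `3^(-d₀) ≤ ε₀ δ₀` in units of `B`, up to a factor `1/16`.
  have htail_bound : gaussianLaw N M {X | ε₀ * B / (2 * E2) < lossTail d (Matrix.of X) (z d)} ≤
      ENNReal.ofReal (δ₀ / 4) := by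
    refine measure_lossTail_lt_le hNe hMe hzd hkey' (by positivity) ?_
    refine (mul_le_mul_of_nonneg_left (sum_tail_le hg (by omega)) hBpos.le).trans ?_
    have h1 : E2 * (1 / 32) ^ d ≤ (1 / 3) ^ d := by
      have : E2 = (Real.exp 1 ^ 2) ^ d := by
        rw [hE2, ← pow_mul, Real.exp_one_pow]; push_cast; rfl
      rw [this, ← mul_pow]
      have := Real.exp_one_lt_d9
      have h0 := Real.exp_pos 1
      gcongr
      nlinarith
    have h2 : (1 / 3 : ℝ) ^ d ≤ (1 / 3) ^ d₀ :=
      pow_le_pow_of_le_one (by norm_num) (by norm_num) (by omega)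
    have h3 : (1 / 3 : ℝ) ^ d₀ ≤ ε₀ * δ₀ := by
      rw [one_div, inv_pow, inv_le_iff_one_le_mul₀ (by positivity)]
      linarith
    have h4 : E2 * (1 / 32) ^ d ≤ ε₀ * δ₀ := by linarith
    rw [div_mul_div_comm, le_div_iff₀ (by positivity)]
    calc B * ((1 / 32) ^ d / 16) * (4 * (2 * E2)) = B * (E2 * (1 / 32) ^ d) / 2 := by ring
      _ ≤ B * (ε₀ * δ₀) / 2 := by gcongr
      _ ≤ δ₀ * (ε₀ * B) := by
        have : 0 < B * (ε₀ * δ₀) := by positivity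
        linarith
  -- This event only serves the reading of answers: outside it they lie within the range that `prec`
  -- bits can represent.
  have htop_bound : gaussianLaw N M {X | 4 * B * E4 / δ₀ < lossPoly (Matrix.of X) (z d)} ≤
      ENNReal.ofReal (δ₀ / 4) := by
    refine measure_lossPoly_lt_le hNe hMe hzd (by positivity) hkey' (by positivity) ?_
    rw [← hE4, ← hBdef]
    refine le_of_eq ?_
    field_simp
  have horacle : ∀ i ∈ Finset.range (d + 1), gaussianLaw N M {X | ε * B <
      ‖((O (1 - u i) (Matrix.of X) : ℝ) : ℂ) -
        lossyProb (squeezing N M (s.rate ηstar (1 - u i))) (1 - u i) (Matrix.of X)‖} ≤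
      ENNReal.ofReal δ := by
    intro i hi
    have hi' := Nat.lt_succ_iff.1 (Finset.mem_range.1 hi)
    have h4 := hu_le i hi'
    have h5 := hu_ge i
    exact hO (1 - u i) (by linarith) (by linarith)
  -- Off the three bad events the error splits into at most `ε₀ B / 2` from the tail, `ε₀ B / 4`
  -- from the oracle and `ε₀ B / 4` from rounding.
  have hsub : {X : Fin N → Fin M → ℂ |
      ¬ ‖((estimate s ηstar u₀ d prec O (Matrix.of X) : ℝ) : ℂ) -
        idealProb (Matrix.of X)‖ ≤ ε₀ * B} ⊆
      (⋃ i ∈ Finset.range (d + 1), {X | ε * B < ‖((O (1 - u i) (Matrix.of X) : ℝ) : ℂ) -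
        lossyProb (squeezing N M (s.rate ηstar (1 - u i))) (1 - u i) (Matrix.of X)‖}) ∪
      ({X | ε₀ * B / (2 * E2) < lossTail d (Matrix.of X) (z d)} ∪
        {X | 4 * B * E4 / δ₀ < lossPoly (Matrix.of X) (z d)}) := by
    intro X hX
    by_contra hcon
    simp only [Set.mem_union, Set.mem_iUnion, Set.mem_ofPred_eq, not_or, not_exists, not_lt] at hcon
    obtain ⟨hc1, hc2, hc3⟩ := hcon
    apply hX
    have hpoly_le : ∀ i, i ≤ d → lossPoly (Matrix.of X) (z i) ≤ lossPoly (Matrix.of X) (z d) := by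
      intro i hi
      refine Finset.sum_le_sum fun j _ => ?_
      have := hle i hi
      have := hzpos i hi
      have := lossCoeff_nonneg (Matrix.of X) j
      gcongr
    have hpoly_nonneg : ∀ i, i ≤ d → 0 ≤ lossPoly (Matrix.of X) (z i) := fun i hi =>
      Finset.sum_nonneg fun j _ => mul_nonneg (lossCoeff_nonneg _ _) (pow_nonneg (hzpos i hi).le _)
    have hans : ∀ i, i ≤ d →
        |O (1 - u i) (Matrix.of X) - lossPoly (Matrix.of X) (z i) / qPoly N M (z i)| ≤ ε * B := by
      intro i hi
      have := hc1 i (Finset.mem_range.2 (Nat.lt_succ_iff.2 hi))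
      rw [hprob i hi, ← Complex.ofReal_sub, Complex.norm_real, Real.norm_eq_abs] at this
      exact this
    have hread : ∀ i, i ≤ d → |O (1 - u i) (Matrix.of X)| ≤ 2 ^ prec := by
      intro i hi
      have h1 : |lossPoly (Matrix.of X) (z i) / qPoly N M (z i)| ≤ 4 * B * E4 / δ₀ := by
        rw [abs_of_nonneg (div_nonneg (hpoly_nonneg i hi) (by linarith [hq_ge i hi]))]
        refine (div_le_self (hpoly_nonneg i hi) (hq_ge i hi)).trans ?_
        exact (hpoly_le i hi).trans hc3
      have h2 := abs_add_le (O (1 - u i) (Matrix.of X) -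
        lossPoly (Matrix.of X) (z i) / qPoly N M (z i))
        (lossPoly (Matrix.of X) (z i) / qPoly N M (z i))
      rw [sub_add_cancel] at h2
      have h3 := hans i hi
      have h4 : ε * B ≤ B * E4 / δ₀ := by
        rw [le_div_iff₀ hδ₀]
        calc ε * B * δ₀ = ε * δ₀ * B := by ring
          _ ≤ 1 * B := by gcongr
          _ = B * 1 := by ring
          _ ≤ B * E4 := by gcongr
      have h5 : 4 * B * E4 / δ₀ + B * E4 / δ₀ ≤ 2 ^ prec := by
        rw [← add_div, div_le_iff₀ hδ₀]
        linarith
      linarith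
    have hr : ∀ i, i ≤ d → |qPoly N M (z i) *
        ((readReal prec (O (1 - u i) (Matrix.of X)) : ℝ) / 2 ^ prec) -
        ∑ j ∈ Finset.range (N / 2 + 1), lossCoeff (Matrix.of X) j * z i ^ j| ≤
        E4 * (ε * B + (2 ^ prec)⁻¹) := by
      intro i hi
      have h1 := abs_readReal_div_sub_le (hread i hi)
      have h2 := hans i hi
      have h3 := hq_ge i hi
      have h4 := hq_le i hi
      have e : qPoly N M (z i) * ((readReal prec (O (1 - u i) (Matrix.of X)) : ℝ) / 2 ^ prec) -
          ∑ j ∈ Finset.range (N / 2 + 1), lossCoeff (Matrix.of X) j * z i ^ j =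
          qPoly N M (z i) * ((O (1 - u i) (Matrix.of X) -
            lossPoly (Matrix.of X) (z i) / qPoly N M (z i)) +
            ((readReal prec (O (1 - u i) (Matrix.of X)) : ℝ) / 2 ^ prec -
              O (1 - u i) (Matrix.of X))) := by
        have h5 : qPoly N M (z i) ≠ 0 := by linarith
        have h6 : ∑ j ∈ Finset.range (N / 2 + 1), lossCoeff (Matrix.of X) j * z i ^ j =
          lossPoly (Matrix.of X) (z i) := rfl
        rw [h6]
        field_simp
        ring
      rw [e, abs_mul, abs_of_nonneg (by linarith)]
      refine mul_le_mul h4 ((abs_add_le _ _).trans (add_le_add h2 h1)) (abs_nonneg _) (by linarith)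
    have hfin := abs_extrapolate_sub_le (n := N / 2) hdpos
      (A := fun j => lossCoeff (Matrix.of X) j) (fun j => lossCoeff_nonneg _ j) hzpos hmono hinj hle
      hr
    rw [← lossCoeff_zero, ← Complex.ofReal_sub, Complex.norm_real, Real.norm_eq_abs]
    refine hfin.trans ?_
    have h1 : E2 * lossTail d (Matrix.of X) (z d) ≤ ε₀ * B / 2 := by
      calc E2 * lossTail d (Matrix.of X) (z d) ≤ E2 * (ε₀ * B / (2 * E2)) := by gcongr
        _ = ε₀ * B / 2 := by field_simp
    have h2 : E2 * (E4 * (ε * B)) ≤ ε₀ * B / 4 := by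
      calc E2 * (E4 * (ε * B)) = E2 * E4 * ε * B := by ring
        _ ≤ ε₀ / 4 * B := by gcongr
        _ = ε₀ * B / 4 := by ring
    have h3 : E2 * (E4 * (2 ^ prec)⁻¹) ≤ ε₀ * B / 4 := by
      rw [← mul_assoc, ← div_eq_mul_inv, div_le_iff₀ (by positivity)]
      have : ε₀ * 2 ^ prec * 1 ≤ ε₀ * 2 ^ prec * B := by gcongr
      linarith
    calc E2 * (E4 * (ε * B + (2 ^ prec)⁻¹) + lossTail d (Matrix.of X) (z d))
        = E2 * (E4 * (ε * B)) + E2 * (E4 * (2 ^ prec)⁻¹) +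
          E2 * lossTail d (Matrix.of X) (z d) := by ring
      _ ≤ ε₀ * B := by linarith
  refine (measure_mono hsub).trans ?_
  refine (measure_union_le _ _).trans ?_
  have hu1 : gaussianLaw N M (⋃ i ∈ Finset.range (d + 1), {X | ε * B <
      ‖((O (1 - u i) (Matrix.of X) : ℝ) : ℂ) -
        lossyProb (squeezing N M (s.rate ηstar (1 - u i))) (1 - u i) (Matrix.of X)‖}) ≤
      ENNReal.ofReal (δ₀ / 4) := by
    -- Subadditivity holds for arbitrary sets, so no measurability of the oracle is required.
    refine (measure_biUnion_finset_le _ _).trans ((Finset.sum_le_sum horacle).trans ?_)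
    rw [Finset.sum_const, Finset.card_range, ← ENNReal.ofReal_nsmul]
    refine ENNReal.ofReal_le_ofReal ?_
    rw [nsmul_eq_mul]; push_cast; exact hδle
  calc _ ≤ ENNReal.ofReal (δ₀ / 4) + (ENNReal.ofReal (δ₀ / 4) + ENNReal.ofReal (δ₀ / 4)) :=
        add_le_add hu1 ((measure_union_le _ _).trans (add_le_add htail_bound htop_bound))
    _ = ENNReal.ofReal (δ₀ / 4 + (δ₀ / 4 + δ₀ / 4)) := by
        rw [← ENNReal.ofReal_add (by positivity) (by positivity),
          ← ENNReal.ofReal_add (by positivity) (by positivity)]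
    _ ≤ ENNReal.ofReal δ₀ := ENNReal.ofReal_le_ofReal (by linarith)

end Estimate

/-! ## Verification of programs -/

section Bits

lemma bits_le_iff {a : ℤ} {n : ℕ} : bits a ≤ n ↔ a.natAbs < 2 ^ n := Nat.size_le

lemma natAbs_lt_two_pow_bits (a : ℤ) : a.natAbs < 2 ^ bits a := Nat.lt_size_self _

lemma bits_mono {a b : ℤ} (h : a.natAbs ≤ b.natAbs) : bits a ≤ bits b := Nat.size_le_size h

lemma bits_add_le (a b : ℤ) : bits (a + b) ≤ bits a + bits b + 1 := by
  rw [bits_le_iff]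
  have h1 := natAbs_lt_two_pow_bits a
  have h2 := natAbs_lt_two_pow_bits b
  have h3 : 2 ^ bits a ≤ 2 ^ (bits a + bits b) := Nat.pow_le_pow_right (by norm_num) (by omega)
  have h4 : 2 ^ bits b ≤ 2 ^ (bits a + bits b) := Nat.pow_le_pow_right (by norm_num) (by omega)
  have h5 := Int.natAbs_add_le a b
  rw [pow_succ]
  omega

lemma bits_neg (a : ℤ) : bits (-a) = bits a := by simp [bits]

lemma bits_sub_le (a b : ℤ) : bits (a - b) ≤ bits a + bits b + 1 := by
  rw [sub_eq_add_neg, ← bits_neg b]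
  exact bits_add_le _ _

lemma bits_mul_le (a b : ℤ) : bits (a * b) ≤ bits a + bits b := by
  rw [bits_le_iff, Int.natAbs_mul, pow_add]
  exact Nat.mul_lt_mul'' (natAbs_lt_two_pow_bits a) (natAbs_lt_two_pow_bits b)

lemma bits_fdiv_le (a b : ℤ) : bits (Int.fdiv a b) ≤ bits a := by
  refine bits_mono ?_
  rcases lt_trichotomy b 0 with hb | hb | hb
  · have h1 : Int.fdiv a b = Int.fdiv (-a) (-b) := (Int.neg_fdiv_neg a b).symm
    rw [h1, Int.fdiv_eq_ediv_of_nonneg _ (by omega), ← Int.natAbs_neg a]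
    exact Int.natAbs_ediv_le_natAbs _ _
  · subst hb; simp
  · rw [Int.fdiv_eq_ediv_of_nonneg _ hb.le]
    exact Int.natAbs_ediv_le_natAbs _ _

lemma bits_natCast_le (n : ℕ) : bits n ≤ n := by
  rw [bits_le_iff, Int.natAbs_natCast]; exact Nat.lt_two_pow_self

lemma bits_one : bits 1 = 1 := by simp [bits]

lemma bits_prod_le {ι : Type*} (s : Finset ι) (f : ι → ℤ) {g : ℕ} (h : ∀ i ∈ s, bits (f i) ≤ g) :
    bits (∏ i ∈ s, f i) ≤ 1 + s.card * g := by
  classical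
  induction s using Finset.induction_on with
  | empty => simp [bits_one]
  | insert a s ha ih =>
    rw [Finset.prod_insert ha, Finset.card_insert_of_notMem ha]
    have h1 := bits_mul_le (f a) (∏ i ∈ s, f i)
    have h2 := h a (Finset.mem_insert_self _ _)
    have h3 := ih fun i hi => h i (Finset.mem_insert_of_mem hi)
    rw [add_mul]
    omega

lemma bits_readReal_le (b : ℕ) (x : ℝ) : bits (readReal b x) ≤ 2 * b + 1 := by
  rw [bits_le_iff]
  have h : (readReal b x).natAbs ≤ 4 ^ b := by
    have h0 : (0 : ℤ) ≤ 4 ^ b := by positivity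
    zify
    rw [abs_le]
    constructor
    · exact le_max_left _ _
    · exact max_le (by linarith) (min_le_left _ _)
  have h2 : (4 : ℕ) ^ b = 2 ^ (2 * b) := by rw [pow_mul]; norm_num
  have h3 : 0 < 2 ^ (2 * b) := by positivity
  rw [pow_succ]
  omega

end Bits

/-! ### A calculus of preconditions that also bounds time -/

section Costs

/-- All registers have at most `G` bits. -/
def BitBounded (G : ℕ) (m : ℕ → ℤ) : Prop := ∀ i, bits (m i) ≤ G

/-- The size of an expression. -/
def Expr.size : Expr → ℕ
  | .reg _ => 1
  | .lit c => 1 + bits c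
  | .add a b => a.size + b.size + 1
  | .sub a b => a.size + b.size + 1
  | .mul a b => a.size + b.size + 1
  | .div a b => a.size + b.size + 1

/-- Each operation yields at most the sum of the two bit lengths plus one, so lengths add up along
the expression tree. -/
lemma Expr.bits_val_le {G : ℕ} {m : ℕ → ℤ} (hm : BitBounded G m) (e : Expr) :
    bits (e.val m) ≤ e.size * (G + 1) := by
  induction e with
  | reg i => simp only [Expr.val, Expr.size]; have := hm i; omega
  | lit c => simp only [Expr.val, Expr.size]; nlinarith [Nat.zero_le (bits c)]
  | add a b iha ihb =>
    have := bits_add_le (a.val m) (b.val m)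
    simp only [Expr.val, Expr.size, add_mul]; omega
  | sub a b iha ihb =>
    have := bits_sub_le (a.val m) (b.val m)
    simp only [Expr.val, Expr.size, add_mul]; omega
  | mul a b iha ihb =>
    have := bits_mul_le (a.val m) (b.val m)
    simp only [Expr.val, Expr.size, add_mul]; omega
  | div a b iha ihb =>
    have := bits_fdiv_le (a.val m) (b.val m)
    simp only [Expr.val, Expr.size, add_mul]; omega

/-- The charge at a node is a product of two lengths, each linear in the size of its subtree. A
cubic bound in the size absorbs this charge on top of the two subtree costs. -/
lemma cost_step {G a b x y s t : ℕ} (ha : x ≤ s ^ 3 * (G + 1) ^ 2) (hb : y ≤ t ^ 3 * (G + 1) ^ 2)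
    (ha' : a ≤ s * (G + 1)) (hb' : b ≤ t * (G + 1)) :
    x + y + (1 + a) * (1 + b) ≤ (s + t + 1) ^ 3 * (G + 1) ^ 2 := by
  have h1 : 1 + a ≤ (s + 1) * (G + 1) := by nlinarith
  have h2 : 1 + b ≤ (t + 1) * (G + 1) := by nlinarith
  have h3 : (1 + a) * (1 + b) ≤ (s + 1) * (t + 1) * (G + 1) ^ 2 := by
    calc (1 + a) * (1 + b) ≤ ((s + 1) * (G + 1)) * ((t + 1) * (G + 1)) := Nat.mul_le_mul h1 h2
      _ = (s + 1) * (t + 1) * (G + 1) ^ 2 := by ring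
  have h4 : s ^ 3 + t ^ 3 + (s + 1) * (t + 1) ≤ (s + t + 1) ^ 3 := by
    have e : (s + t + 1) ^ 3 = s ^ 3 + t ^ 3 + (s + 1) * (t + 1) +
        (3 * s ^ 2 * t + 3 * s * t ^ 2 + 3 * s ^ 2 + 3 * t ^ 2 + 5 * s * t + 2 * s + 2 * t) := by
      ring
    rw [e]; exact Nat.le_add_right _ _
  calc x + y + (1 + a) * (1 + b)
      ≤ (s ^ 3 + t ^ 3 + (s + 1) * (t + 1)) * (G + 1) ^ 2 := by
        rw [show (s ^ 3 + t ^ 3 + (s + 1) * (t + 1)) * (G + 1) ^ 2 = s ^ 3 * (G + 1) ^ 2 +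
          t ^ 3 * (G + 1) ^ 2 + (s + 1) * (t + 1) * (G + 1) ^ 2 by ring]
        exact add_le_add (add_le_add ha hb) h3
    _ ≤ _ := Nat.mul_le_mul_right _ h4

lemma Expr.cost_le {G : ℕ} {m : ℕ → ℤ} (hm : BitBounded G m) (e : Expr) :
    e.cost m ≤ e.size ^ 3 * (G + 1) ^ 2 := by
  induction e with
  | reg i => simp only [Expr.cost, Expr.size]; have := hm i; nlinarith
  | lit c =>
    simp only [Expr.cost, Expr.size]
    have h1 : 1 + bits c ≤ (1 + bits c) ^ 3 := Nat.le_self_pow (by norm_num) _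
    have h2 : 1 ≤ (G + 1) ^ 2 := Nat.one_le_pow _ _ (by omega)
    calc 1 + bits c ≤ (1 + bits c) ^ 3 * 1 := by rw [mul_one]; exact h1
      _ ≤ _ := Nat.mul_le_mul_left _ h2
  | add a b iha ihb =>
    exact cost_step iha ihb (a.bits_val_le hm) (b.bits_val_le hm)
  | sub a b iha ihb =>
    exact cost_step iha ihb (a.bits_val_le hm) (b.bits_val_le hm)
  | mul a b iha ihb =>
    exact cost_step iha ihb (a.bits_val_le hm) (b.bits_val_le hm)
  | div a b iha ihb =>
    exact cost_step iha ihb (a.bits_val_le hm) (b.bits_val_le hm)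

/-- The time of a program whose registers have at most `G` bits and whose loop counts and
precisions are at most `L`. -/
def Program.timeBound (G L : ℕ) : Program → ℕ
  | .skip => 1
  | .assign _ e => 1 + e.size ^ 3 * (G + 1) ^ 2
  | .seq p q => p.timeBound G L + q.timeBound G L
  | .branch e p q => 1 + e.size ^ 3 * (G + 1) ^ 2 + (p.timeBound G L + q.timeBound G L)
  | .loop e p => 1 + e.size ^ 3 * (G + 1) ^ 2 + L * (p.timeBound G L + 1)
  | .flip _ => 1
  | .entry _ _ j k b => 1 + j.size ^ 3 * (G + 1) ^ 2 + k.size ^ 3 * (G + 1) ^ 2 +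
      b.size ^ 3 * (G + 1) ^ 2 + 2 * L
  | .ask _ e d b => 1 + e.size ^ 3 * (G + 1) ^ 2 + d.size ^ 3 * (G + 1) ^ 2 +
      b.size ^ 3 * (G + 1) ^ 2 + 2 * L

/-- A sufficient condition on the registers for a program without coin flips and without access to
single entries to keep its registers below `G` bits and its loop counts and precisions below `L`,
and to establish `Q`. -/
def Program.wp {N M : ℕ} (O : Oracle N M) (X : Matrix (Fin N) (Fin M) ℂ) (G L : ℕ) :
    Program → ((ℕ → ℤ) → Prop) → (ℕ → ℤ) → Prop
  | .skip, Q, m => Q m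
  | .assign i e, Q, m => bits (e.val m) ≤ G ∧ Q (Function.update m i (e.val m))
  | .seq p q, Q, m => p.wp O X G L (q.wp O X G L Q) m
  | .branch e p q, Q, m => if 0 < e.val m then p.wp O X G L Q m else q.wp O X G L Q m
  | .loop e p, Q, m => (e.val m).toNat ≤ L ∧ ∃ I : ℕ → (ℕ → ℤ) → Prop, I 0 m ∧
      (∀ t < (e.val m).toNat, ∀ m', I t m' → p.wp O X G L (I (t + 1)) m') ∧
      ∀ m', I (e.val m).toNat m' → Q m'
  | .flip _, _, _ => False
  | .entry _ _ _ _ _, _, _ => False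
  | .ask i e d b, Q, m => (b.val m).toNat ≤ L ∧ 2 * L + 1 ≤ G ∧
      Q (Function.update m i
        (readReal (b.val m).toNat (O ((e.val m : ℝ) / (d.val m : ℝ)) X)))

lemma BitBounded.update {G : ℕ} {m : ℕ → ℤ} (hm : BitBounded G m) (i : ℕ) {a : ℤ}
    (ha : bits a ≤ G) : BitBounded G (Function.update m i a) := by
  intro j
  by_cases h : j = i
  · subst h; simpa using ha
  · rw [Function.update_of_ne h]; exact hm j

/-- Since the bit bound holds throughout, every step has a cost determined by `G` and `L` alone.
Coin flips have a false precondition, so the conclusion is uniform in `ω`. -/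
lemma Program.wp_sound {N M : ℕ} (O : Oracle N M) (X : Matrix (Fin N) (Fin M) ℂ) (ω : ℕ → Bool)
    (G L : ℕ) (p : Program) : ∀ (Q : (ℕ → ℤ) → Prop) (c : Config), BitBounded G c.reg →
      p.wp O X G L Q c.reg → BitBounded G (p.run O X ω c).reg ∧ Q (p.run O X ω c).reg ∧
        (p.run O X ω c).time ≤ c.time + p.timeBound G L := by
  induction p with
  | skip => intro Q c hc h; exact ⟨hc, h, le_rfl⟩
  | assign i e =>
    intro Q c hc h
    refine ⟨hc.update i h.1, h.2, ?_⟩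
    have := e.cost_le hc
    simp only [Program.run, Config.spend, Config.set, Program.timeBound]
    omega
  | seq p q ihp ihq =>
    intro Q c hc h
    obtain ⟨h1, h2, h3⟩ := ihp _ c hc h
    obtain ⟨h4, h5, h6⟩ := ihq Q _ h1 h2
    refine ⟨h4, h5, ?_⟩
    simp only [Program.run, Program.timeBound]
    omega
  | branch e p q ihp ihq =>
    intro Q c hc h
    have hcost := e.cost_le hc
    simp only [Program.wp] at h
    simp only [Program.run, Program.timeBound]
    split_ifs at h ⊢ with he
    · obtain ⟨h1, h2, h3⟩ := ihp Q (c.spend (1 + e.cost c.reg)) hc h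
      refine ⟨h1, h2, h3.trans ?_⟩
      simp only [Config.spend]
      omega
    · obtain ⟨h1, h2, h3⟩ := ihq Q (c.spend (1 + e.cost c.reg)) hc h
      refine ⟨h1, h2, h3.trans ?_⟩
      simp only [Config.spend]
      omega
  | loop e p ih =>
    intro Q c hc h
    have hcost := e.cost_le hc
    obtain ⟨hL, I, h0, hstep, hend⟩ := h
    simp only [Program.run, Program.timeBound]
    have key : ∀ t ≤ (e.val c.reg).toNat,
        BitBounded G ((fun c' => (p.run O X ω c').spend 1)^[t] (c.spend (1 + e.cost c.reg))).reg ∧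
        I t ((fun c' => (p.run O X ω c').spend 1)^[t] (c.spend (1 + e.cost c.reg))).reg ∧
        ((fun c' => (p.run O X ω c').spend 1)^[t] (c.spend (1 + e.cost c.reg))).time ≤
          c.time + (1 + e.size ^ 3 * (G + 1) ^ 2) + t * (p.timeBound G L + 1) := by
      intro t
      induction t with
      | zero =>
        intro _
        refine ⟨hc, h0, ?_⟩
        simp only [Function.iterate_zero, id, Config.spend]
        omega
      | succ t iht =>
        intro ht
        obtain ⟨i1, i2, i3⟩ := iht (by omega)
        rw [Function.iterate_succ_apply']
        obtain ⟨h1, h2, h3⟩ := ih (I (t + 1)) _ i1 (hstep t (by omega) _ i2)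
        refine ⟨h1, h2, ?_⟩
        rw [add_mul]
        simp only [Config.spend] at h3 i3 ⊢
        omega
    obtain ⟨k1, k2, k3⟩ := key _ le_rfl
    refine ⟨k1, hend _ k2, k3.trans ?_⟩
    have := Nat.mul_le_mul_right (p.timeBound G L + 1) hL
    omega
  | flip i => intro Q c hc h; exact h.elim
  | entry i im j k b => intro Q c hc h; exact h.elim
  | ask i e d b =>
    intro Q c hc h
    obtain ⟨hL, hG, hQ⟩ := h
    refine ⟨hc.update i ((bits_readReal_le _ _).trans (by omega)), hQ, ?_⟩
    have h1 := e.cost_le hc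
    have h2 := d.cost_le hc
    have h3 := b.cost_le hc
    simp only [Program.run, Config.spend, Config.set, Program.timeBound]
    omega

end Costs

/-! ### Closure properties of polynomial bounds -/

section PolyBounded

/-- `f` is bounded by a power of `base`. -/
def PolyBounded {ι : Type*} (base : ι → ℝ) (f : ι → ℕ) : Prop :=
  ∃ k : ℕ, ∀ x, (f x : ℝ) ≤ base x ^ k

variable {ι : Type*} {base : ι → ℝ} {f g : ι → ℕ}

lemma PolyBounded.mono (hg : PolyBounded base g) (h : ∀ x, f x ≤ g x) : PolyBounded base f := by
  obtain ⟨k, hk⟩ := hg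
  exact ⟨k, fun x => le_trans (by exact_mod_cast h x) (hk x)⟩

lemma PolyBounded.const (hb : ∀ x, 2 ≤ base x) (c : ℕ) : PolyBounded base fun _ => c := by
  refine ⟨c, fun x => ?_⟩
  have h1 : (c : ℝ) ≤ 2 ^ c := by exact_mod_cast (Nat.lt_two_pow_self (n := c)).le
  have h2 := hb x
  exact h1.trans (by gcongr)

lemma PolyBounded.add (hb : ∀ x, 2 ≤ base x) (hf : PolyBounded base f) (hg : PolyBounded base g) :
    PolyBounded base fun x => f x + g x := by
  obtain ⟨k, hk⟩ := hf
  obtain ⟨l, hl⟩ := hg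
  refine ⟨k + l + 1, fun x => ?_⟩
  have h2 := hb x
  have h1 : base x ^ k ≤ base x ^ (k + l) := pow_le_pow_right₀ (by linarith) (by omega)
  have h3 : base x ^ l ≤ base x ^ (k + l) := pow_le_pow_right₀ (by linarith) (by omega)
  have h4 : 0 ≤ base x ^ (k + l) := by positivity
  have h5 := hk x
  have h6 := hl x
  push_cast
  rw [pow_succ]
  nlinarith

lemma PolyBounded.mul (hb : ∀ x, 2 ≤ base x) (hf : PolyBounded base f) (hg : PolyBounded base g) :
    PolyBounded base fun x => f x * g x := by
  obtain ⟨k, hk⟩ := hf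
  obtain ⟨l, hl⟩ := hg
  refine ⟨k + l, fun x => ?_⟩
  have h2 := hb x
  have h5 := hk x
  have h6 := hl x
  push_cast
  rw [pow_add]
  gcongr

lemma PolyBounded.pow (hb : ∀ x, 2 ≤ base x) (hf : PolyBounded base f) (n : ℕ) :
    PolyBounded base fun x => f x ^ n := by
  induction n with
  | zero => simpa using PolyBounded.const hb 1
  | succ n ih => simpa only [pow_succ] using ih.mul hb hf

lemma PolyBounded.timeBound (hb : ∀ x, 2 ≤ base x) {G L : ι → ℕ} (hG : PolyBounded base G)
    (hL : PolyBounded base L) (p : Program) :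
    PolyBounded base fun x => p.timeBound (G x) (L x) := by
  have hc := PolyBounded.const (base := base) hb
  have he : ∀ e : Expr, PolyBounded base fun x => e.size ^ 3 * (G x + 1) ^ 2 := fun e =>
    (hc _).mul hb ((hG.add hb (hc 1)).pow hb 2)
  induction p with
  | skip => exact hc 1
  | assign i e => exact (hc 1).add hb (he e)
  | seq p q ihp ihq => exact ihp.add hb ihq
  | branch e p q ihp ihq => exact ((hc 1).add hb (he e)).add hb (ihp.add hb ihq)
  | loop e p ih => exact ((hc 1).add hb (he e)).add hb (hL.mul hb (ih.add hb (hc 1)))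
  | flip i => exact hc 1
  | entry i im j k b =>
    exact ((((hc 1).add hb (he j)).add hb (he k)).add hb (he b)).add hb ((hc 2).mul hb hL)
  | ask i e d b =>
    exact ((((hc 1).add hb (he e)).add hb (he d)).add hb (he b)).add hb ((hc 2).mul hb hL)

end PolyBounded

/-! ## The extrapolation program -/

section ProgramText

/-- `un * (d + 2 j)`: the numerator of the loss at the node `j`. -/
def lossNumE (j : Expr) : Expr := .mul (.reg 10) (.add (.reg 9) (.mul (.lit 2) j))

/-- The numerator of the rate to which the squeezing is matched. -/
def rateNumE (s : SqueezingRule) (j : Expr) : Expr :=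
  match s with
  | .queried => .sub (.reg 11) (lossNumE j)
  | .maximal => .reg 2

/-- The denominator of the rate to which the squeezing is matched. -/
def rateDenE (s : SqueezingRule) : Expr :=
  match s with
  | .queried => .reg 11
  | .maximal => .reg 3

/-- The numerator of the node parameter. -/
def paramNumE (s : SqueezingRule) (j : Expr) : Expr :=
  .mul (.mul (lossNumE j) (lossNumE j)) (.mul (.reg 0) (rateDenE s))

/-- The denominator of the node parameter. -/
def paramDenE (s : SqueezingRule) (j : Expr) : Expr :=
  .mul (.mul (.reg 11) (.reg 11))
    (.add (.mul (rateNumE s j) (.reg 1)) (.mul (.reg 0) (rateDenE s)))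

/-- A factor of the numerator of the extrapolation weight. -/
def weightNumE (s : SqueezingRule) : Expr :=
  .mul (paramNumE s (.reg 18)) (paramDenE s (.reg 15))

/-- A factor of the denominator of the extrapolation weight. -/
def weightDenE (s : SqueezingRule) : Expr :=
  .sub (.mul (paramNumE s (.reg 18)) (paramDenE s (.reg 15)))
    (.mul (paramNumE s (.reg 15)) (paramDenE s (.reg 18)))

/-- The numerator of the quotient of consecutive terms of `Q`. -/
def termNumE (s : SqueezingRule) : Expr :=
  .mul (.mul (.sub (.sub (.add (.reg 1) (.reg 0)) (.lit 1)) (.mul (.lit 2) (.reg 22)))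
    (.sub (.reg 0) (.mul (.lit 2) (.reg 22)))) (paramNumE s (.reg 15))

/-- The denominator of the quotient of consecutive terms of `Q`. -/
def termDenE (s : SqueezingRule) : Expr :=
  .mul (.mul (.add (.mul (.lit 2) (.reg 22)) (.lit 1)) (.add (.mul (.lit 2) (.reg 22)) (.lit 2)))
    (paramDenE s (.reg 15))

/-- Registers `16`, `17`: numerator and denominator of the extrapolation weight. -/
def weightProgram (s : SqueezingRule) : Program :=
  .seq (.assign 16 (.lit 1)) <| .seq (.assign 17 (.lit 1)) <| .seq (.assign 18 (.lit 0)) <|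
    .loop (.add (.reg 9) (.lit 1)) <|
      -- The square of the difference is positive exactly when the two indices differ.
      .seq (.branch (.mul (.sub (.reg 18) (.reg 15)) (.sub (.reg 18) (.reg 15)))
        (.seq (.assign 16 (.mul (.reg 16) (weightNumE s)))
          (.assign 17 (.mul (.reg 17) (weightDenE s)))) .skip)
        (.assign 18 (.add (.reg 18) (.lit 1)))

/-- Registers `20`, `21`: numerator and denominator of `Q`. -/
def qProgram (s : SqueezingRule) : Program :=
  .seq (.assign 19 (.lit 1)) <| .seq (.assign 20 (.lit 1)) <| .seq (.assign 21 (.lit 1)) <|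
    .seq (.assign 22 (.lit 0)) <| .loop (.div (.reg 0) (.lit 2)) <|
      .seq (.assign 19 (.mul (.reg 19) (termNumE s))) <|
        -- Term and partial sum share the running denominator in register `21`. Register `19`
        -- already holds the numerator of the next term, so the old sum alone is multiplied by the
        -- new factor.
        .seq (.assign 20 (.add (.mul (.reg 20) (termDenE s)) (.reg 19))) <|
          .seq (.assign 21 (.mul (.reg 21) (termDenE s))) (.assign 22 (.add (.reg 22) (.lit 1)))

/-- Adds the contribution of one node to the estimate. -/
def nodeProgram (s : SqueezingRule) : Program :=
  .seq (weightProgram s) <| .seq (qProgram s) <|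
    .seq (.ask 23 (.sub (.reg 11) (lossNumE (.reg 15))) (.reg 11) (.reg 12)) <|
      -- Addition of fractions without reduction. The numerator is updated first because it needs
      -- the old denominator in register `14`.
      .seq (.assign 13 (.add (.mul (.reg 13) (.mul (.reg 17) (.reg 21)))
        (.mul (.mul (.mul (.reg 16) (.reg 20)) (.reg 23)) (.reg 14)))) <|
        .seq (.assign 14 (.mul (.reg 14) (.mul (.reg 17) (.reg 21))))
          (.assign 15 (.add (.reg 15) (.lit 1)))

/-- Register `9`: the number of nodes that the required accuracy needs. -/
def degreeProgram : Program :=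
  .seq (.assign 13 (.add (.div (.mul (.mul (.reg 0) (.reg 5)) (.reg 7)) (.mul (.reg 4) (.reg 6)))
    (.lit 1))) <|
  .seq (.assign 8 (.lit 1)) <| .seq (.assign 9 (.lit 0)) <|
  -- The number of repetitions is fixed on entry; once the power of three has reached register `13`,
  -- the remaining rounds do nothing.
  .seq (.loop (.reg 13) (.branch (.sub (.reg 13) (.reg 8))
    (.seq (.assign 8 (.mul (.lit 3) (.reg 8))) (.assign 9 (.add (.reg 9) (.lit 1)))) .skip)) <|
  .assign 9 (.add (.reg 9) (.mul (.lit 32)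
    (.add (.div (.mul (.sub (.reg 3) (.reg 2)) (.reg 0)) (.reg 3)) (.lit 1))))

/-- Registers `10`, `11`, `12`, `24`: the nodes, the precision and the corresponding power of two. -/
def precisionProgram : Program :=
  .seq (.assign 10 (.add (.mul (.mul (.lit 64) (.reg 0)) (.sub (.reg 3) (.reg 2))) (.reg 3))) <|
  .seq (.assign 11 (.mul (.mul (.mul (.lit 64) (.reg 0)) (.reg 3)) (.reg 9))) <|
  .seq (.assign 12 (.add (.add (.mul (.lit 4) (.reg 9))
    (.add (.add (.div (.reg 7) (.reg 6)) (.lit 1)) (.add (.div (.reg 5) (.reg 4)) (.lit 1))))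
    (.add (.mul (.add (.mul (.lit 2) (.reg 0)) (.reg 1)) (.reg 0)) (.lit 4)))) <|
  .seq (.assign 24 (.lit 1)) (.loop (.reg 12) (.assign 24 (.mul (.lit 2) (.reg 24))))

/-- The program that estimates `P(X)` by extrapolation. -/
def extrapolation (s : SqueezingRule) : Program :=
  .seq degreeProgram <| .seq precisionProgram <|
  .seq (.assign 13 (.lit 0)) <| .seq (.assign 14 (.lit 1)) <| .seq (.assign 15 (.lit 0)) <|
  .seq (.loop (.add (.reg 9) (.lit 1)) (nodeProgram s)) <|
  -- The answers are integers in units of `2^(-prec)`, so the power of two enters the denominator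
  -- only once, at the end.
  .seq (.assign 0 (.reg 13)) (.assign 1 (.mul (.reg 14) (.reg 24)))

end ProgramText

/-! ### Integers computed by the program, and their bit lengths -/

section Values

/-- The integers from which the nodes are computed. -/
structure NodeData where
  N : ℕ
  M : ℕ
  rateNum : ℤ
  rateDen : ℤ
  d : ℕ
  lossNum : ℤ
  den : ℤ
  prec : ℕ

namespace NodeData

variable (v : NodeData) (s : SqueezingRule)

/-- The registers hold the data `v`. -/
structure Holds (m : ℕ → ℤ) : Prop where
  h0 : m 0 = v.N
  h1 : m 1 = v.M
  h2 : m 2 = v.rateNum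
  h3 : m 3 = v.rateDen
  h9 : m 9 = v.d
  h10 : m 10 = v.lossNum
  h11 : m 11 = v.den
  h12 : m 12 = v.prec

/-- `un * (d + 2 j)`. -/
def a (j : ℤ) : ℤ := v.lossNum * (v.d + 2 * j)

/-- The numerator of the rate to which the squeezing is matched. -/
def tn (j : ℤ) : ℤ :=
  match s with
  | .queried => v.den - v.a j
  | .maximal => v.rateNum

/-- The denominator of the rate to which the squeezing is matched. -/
def td : ℤ :=
  match s with
  | .queried => v.den
  | .maximal => v.rateDen

/-- The numerator of the node parameter. -/
def p (j : ℤ) : ℤ := v.a j * v.a j * (v.N * v.td s)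

/-- The denominator of the node parameter. -/
def q (j : ℤ) : ℤ := v.den * v.den * (v.tn s j * v.M + v.N * v.td s)

/-- A factor of the numerator of the extrapolation weight. -/
def wn (i j : ℤ) : ℤ := v.p s j * v.q s i

/-- A factor of the denominator of the extrapolation weight. -/
def wd (i j : ℤ) : ℤ := v.p s j * v.q s i - v.p s i * v.q s j

/-- The numerator of the quotient of consecutive terms of `Q`. -/
def rn (i k : ℤ) : ℤ := (v.M + v.N - 1 - 2 * k) * (v.N - 2 * k) * v.p s i

/-- The denominator of the quotient of consecutive terms of `Q`. -/
def rd (i k : ℤ) : ℤ := (2 * k + 1) * (2 * k + 2) * v.q s i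

variable {v}

lemma Holds.lossNumE {m : ℕ → ℤ} (h : v.Holds m) (j : Expr) :
    (lossNumE j).val m = v.a (j.val m) := by
  simp [LossyGBS.lossNumE, Expr.val, h.h10, h.h9, a]

lemma Holds.rateNumE {m : ℕ → ℤ} (h : v.Holds m) (j : Expr) :
    (rateNumE s j).val m = v.tn s (j.val m) := by
  cases s <;> simp [LossyGBS.rateNumE, Expr.val, h.h11, h.h2, tn, h.lossNumE]

lemma Holds.rateDenE {m : ℕ → ℤ} (h : v.Holds m) : (rateDenE s).val m = v.td s := by
  cases s <;> simp [LossyGBS.rateDenE, Expr.val, h.h11, h.h3, td]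

lemma Holds.paramNumE {m : ℕ → ℤ} (h : v.Holds m) (j : Expr) :
    (paramNumE s j).val m = v.p s (j.val m) := by
  simp [LossyGBS.paramNumE, Expr.val, h.lossNumE, h.rateDenE, h.h0, p]

lemma Holds.paramDenE {m : ℕ → ℤ} (h : v.Holds m) (j : Expr) :
    (paramDenE s j).val m = v.q s (j.val m) := by
  simp [LossyGBS.paramDenE, Expr.val, h.rateNumE, h.rateDenE, h.h0, h.h1, h.h11, q]

lemma Holds.weightNumE {m : ℕ → ℤ} (h : v.Holds m) :
    (weightNumE s).val m = v.wn s (m 15) (m 18) := by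
  simp [LossyGBS.weightNumE, Expr.val, h.paramNumE, h.paramDenE, wn]

lemma Holds.weightDenE {m : ℕ → ℤ} (h : v.Holds m) :
    (weightDenE s).val m = v.wd s (m 15) (m 18) := by
  simp [LossyGBS.weightDenE, Expr.val, h.paramNumE, h.paramDenE, wd]

lemma Holds.termNumE {m : ℕ → ℤ} (h : v.Holds m) :
    (termNumE s).val m = v.rn s (m 15) (m 22) := by
  simp [LossyGBS.termNumE, Expr.val, h.paramNumE, h.h0, h.h1, rn]

lemma Holds.termDenE {m : ℕ → ℤ} (h : v.Holds m) :
    (termDenE s).val m = v.rd s (m 15) (m 22) := by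
  simp [LossyGBS.termDenE, Expr.val, h.paramDenE, rd]

lemma Holds.of_agree {m m' : ℕ → ℤ} (h : v.Holds m) (hm : ∀ r, r < 13 → m' r = m r) :
    v.Holds m' where
  h0 := by rw [hm _ (by norm_num), h.h0]
  h1 := by rw [hm _ (by norm_num), h.h1]
  h2 := by rw [hm _ (by norm_num), h.h2]
  h3 := by rw [hm _ (by norm_num), h.h3]
  h9 := by rw [hm _ (by norm_num), h.h9]
  h10 := by rw [hm _ (by norm_num), h.h10]
  h11 := by rw [hm _ (by norm_num), h.h11]
  h12 := by rw [hm _ (by norm_num), h.h12]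

variable (v)

/-- The numbers in `v` have at most `L` bits, and `L` bounds the loop counts. -/
structure Bounded (L : ℕ) : Prop where
  d_lt : v.d + 1 ≤ L
  N_le : v.N ≤ L
  M_le : v.M ≤ L
  prec_le : v.prec ≤ L
  rateNum_le : bits v.rateNum ≤ L
  rateDen_le : bits v.rateDen ≤ L
  lossNum_le : bits v.lossNum ≤ L
  den_le : bits v.den ≤ L

/-- A register file that holds `v` and given values of the counters. -/
def mem (i j k : ℤ) : ℕ → ℤ
  | 0 => v.N
  | 1 => v.M
  | 2 => v.rateNum
  | 3 => v.rateDen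
  | 9 => v.d
  | 10 => v.lossNum
  | 11 => v.den
  | 12 => v.prec
  | 15 => i
  | 18 => j
  | 22 => k
  | _ => 0

lemma holds_mem (i j k : ℤ) : v.Holds (v.mem i j k) := by
  constructor <;> rfl

/-- A bound for the number of bits of a factor. -/
def factorBits (L : ℕ) : ℕ :=
  ((weightNumE s).size + (weightDenE s).size + (termNumE s).size + (termDenE s).size) * (L + 1)

variable {v}

lemma Bounded.bitBounded_mem {L : ℕ} (h : v.Bounded L) {i j k : ℕ} (hi : i ≤ L) (hj : j ≤ L)
    (hk : k ≤ L) : BitBounded L (v.mem i j k) := by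
  intro r
  have hb := bits_natCast_le
  unfold mem
  split
  · exact (hb _).trans h.N_le
  · exact (hb _).trans h.M_le
  · exact h.rateNum_le
  · exact h.rateDen_le
  · exact (hb _).trans (by have := h.d_lt; omega)
  · exact h.lossNum_le
  · exact h.den_le
  · exact (hb _).trans h.prec_le
  · exact (hb _).trans hi
  · exact (hb _).trans hj
  · exact (hb _).trans hk
  · simp [bits]

/-- The number is the value of an expression on the artificial register file `mem`, so the general
bound for expressions applies; the next three bounds are obtained in the same way. -/
lemma Bounded.wn_le {L : ℕ} (h : v.Bounded L) {i j : ℕ} (hi : i ≤ L) (hj : j ≤ L) :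
    bits (v.wn s i j) ≤ factorBits s L := by
  have h1 := (weightNumE s).bits_val_le (h.bitBounded_mem hi hj (Nat.zero_le L))
  rw [(v.holds_mem _ _ _).weightNumE] at h1
  exact h1.trans (Nat.mul_le_mul_right _ (by omega))

lemma Bounded.wd_le {L : ℕ} (h : v.Bounded L) {i j : ℕ} (hi : i ≤ L) (hj : j ≤ L) :
    bits (v.wd s i j) ≤ factorBits s L := by
  have h1 := (weightDenE s).bits_val_le (h.bitBounded_mem hi hj (Nat.zero_le L))
  rw [(v.holds_mem _ _ _).weightDenE] at h1
  exact h1.trans (Nat.mul_le_mul_right _ (by omega))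

lemma Bounded.rn_le {L : ℕ} (h : v.Bounded L) {i k : ℕ} (hi : i ≤ L) (hk : k ≤ L) :
    bits (v.rn s i k) ≤ factorBits s L := by
  have h1 := (termNumE s).bits_val_le (h.bitBounded_mem hi (Nat.zero_le L) hk)
  rw [(v.holds_mem _ _ _).termNumE] at h1
  exact h1.trans (Nat.mul_le_mul_right _ (by omega))

lemma Bounded.rd_le {L : ℕ} (h : v.Bounded L) {i k : ℕ} (hi : i ≤ L) (hk : k ≤ L) :
    bits (v.rd s i k) ≤ factorBits s L := by
  have h1 := (termDenE s).bits_val_le (h.bitBounded_mem hi (Nat.zero_le L) hk)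
  rw [(v.holds_mem _ _ _).termDenE] at h1
  exact h1.trans (Nat.mul_le_mul_right _ (by omega))

variable (v)

/-- The numerator of the extrapolation weight. -/
def weightNum (i t : ℕ) : ℤ := ∏ j ∈ (Finset.range t).erase i, v.wn s i j

/-- The denominator of the extrapolation weight. -/
def weightDen (i t : ℕ) : ℤ := ∏ j ∈ (Finset.range t).erase i, v.wd s i j

/-- The numerator of a term of `Q`. -/
def termNum (i k : ℕ) : ℤ := ∏ l ∈ Finset.range k, v.rn s i l

/-- The denominator of a term of `Q`. -/
def termDen (i k : ℕ) : ℤ := ∏ l ∈ Finset.range k, v.rd s i l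

/-- The numerator of a partial sum of `Q`. -/
def qNum (i : ℕ) : ℕ → ℤ
  | 0 => 1
  | k + 1 => qNum i k * v.rd s i k + v.termNum s i (k + 1)

/-- The denominator of the contribution of a node to the estimate. -/
def nodeDen (i : ℕ) : ℤ := v.weightDen s i (v.d + 1) * v.termDen s i (v.N / 2)

/-- The denominator of the estimate. -/
def sumDen (t : ℕ) : ℤ := ∏ i ∈ Finset.range t, v.nodeDen s i

/-- The numerator of the estimate, for given answers of the oracle. -/
def sumNum (ans : ℕ → ℤ) : ℕ → ℤ
  | 0 => 0
  | t + 1 => sumNum ans t * v.nodeDen s t +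
      v.weightNum s t (v.d + 1) * v.qNum s t (v.N / 2) * ans t * v.sumDen s t

/-- A bound for the bits of a product of factors. -/
def prodBits (L : ℕ) : ℕ := 1 + L * factorBits s L

/-- A bound for the bits of `qNum`. -/
def qBits (L : ℕ) : ℕ := 1 + L * (factorBits s L + prodBits s L + 1)

/-- A bound for the bits of `sumDen`. -/
def sumDenBits (L : ℕ) : ℕ := 1 + L * (prodBits s L + prodBits s L)

/-- A bound for the bits of `sumNum`. -/
def sumNumBits (L : ℕ) : ℕ :=
  L * ((prodBits s L + prodBits s L) +
    (prodBits s L + qBits s L + (2 * L + 1) + sumDenBits s L) + 1)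

/-- A bound for the bits of all registers. -/
def regBits (L : ℕ) : ℕ :=
  prodBits s L + qBits s L + sumDenBits s L + sumNumBits s L + (3 * L + 10)

variable {v}

lemma Bounded.weightNum_le {L : ℕ} (h : v.Bounded L) {i t : ℕ} (hi : i ≤ L) (ht : t ≤ L) :
    bits (v.weightNum s i t) ≤ prodBits s L := by
  refine (bits_prod_le _ _ (g := factorBits s L) fun j hj => ?_).trans ?_
  · have := Finset.mem_range.1 (Finset.mem_of_mem_erase hj)
    exact h.wn_le s hi (by omega)
  · have : ((Finset.range t).erase i).card ≤ L :=
      (Finset.card_erase_le).trans (by simpa using ht)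
    exact Nat.add_le_add_left (Nat.mul_le_mul_right _ this) _

lemma Bounded.weightDen_le {L : ℕ} (h : v.Bounded L) {i t : ℕ} (hi : i ≤ L) (ht : t ≤ L) :
    bits (v.weightDen s i t) ≤ prodBits s L := by
  refine (bits_prod_le _ _ (g := factorBits s L) fun j hj => ?_).trans ?_
  · have := Finset.mem_range.1 (Finset.mem_of_mem_erase hj)
    exact h.wd_le s hi (by omega)
  · have : ((Finset.range t).erase i).card ≤ L :=
      (Finset.card_erase_le).trans (by simpa using ht)
    exact Nat.add_le_add_left (Nat.mul_le_mul_right _ this) _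

lemma Bounded.termNum_le {L : ℕ} (h : v.Bounded L) {i k : ℕ} (hi : i ≤ L) (hk : k ≤ L) :
    bits (v.termNum s i k) ≤ prodBits s L := by
  refine (bits_prod_le _ _ (g := factorBits s L) fun j hj => ?_).trans ?_
  · have := Finset.mem_range.1 hj
    exact h.rn_le s hi (by omega)
  · rw [Finset.card_range]
    exact Nat.add_le_add_left (Nat.mul_le_mul_right _ hk) _

lemma Bounded.termDen_le {L : ℕ} (h : v.Bounded L) {i k : ℕ} (hi : i ≤ L) (hk : k ≤ L) :
    bits (v.termDen s i k) ≤ prodBits s L := by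
  refine (bits_prod_le _ _ (g := factorBits s L) fun j hj => ?_).trans ?_
  · have := Finset.mem_range.1 hj
    exact h.rd_le s hi (by omega)
  · rw [Finset.card_range]
    exact Nat.add_le_add_left (Nat.mul_le_mul_right _ hk) _

/-- Each round adds the length of one factor, the length of one term and one carry bit, so the
growth is linear in `k`. -/
lemma Bounded.qNum_le {L : ℕ} (h : v.Bounded L) {i k : ℕ} (hi : i ≤ L) (hk : k ≤ L) :
    bits (v.qNum s i k) ≤ qBits s L := by
  have key : bits (v.qNum s i k) ≤ 1 + k * (factorBits s L + prodBits s L + 1) := by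
    induction k with
    | zero => simp [qNum, bits_one]
    | succ k ih =>
      have h1 := ih (by omega)
      have h2 := bits_add_le (v.qNum s i k * v.rd s i k) (v.termNum s i (k + 1))
      have h3 := bits_mul_le (v.qNum s i k) (v.rd s i k)
      have h4 := h.rd_le s hi (k := k) (by omega)
      have h5 := h.termNum_le s hi hk
      rw [qNum, add_mul]
      omega
  exact key.trans (Nat.add_le_add_left (Nat.mul_le_mul_right _ hk) _)

lemma Bounded.nodeDen_le {L : ℕ} (h : v.Bounded L) {i : ℕ} (hi : i ≤ L) :
    bits (v.nodeDen s i) ≤ prodBits s L + prodBits s L := by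
  refine (bits_mul_le _ _).trans (add_le_add (h.weightDen_le s hi h.d_lt) (h.termDen_le s hi ?_))
  have := h.N_le
  omega

lemma Bounded.sumDen_le {L : ℕ} (h : v.Bounded L) {t : ℕ} (ht : t ≤ L) :
    bits (v.sumDen s t) ≤ sumDenBits s L := by
  refine (bits_prod_le _ _ (g := prodBits s L + prodBits s L) fun j hj => ?_).trans ?_
  · have := Finset.mem_range.1 hj
    exact h.nodeDen_le s (by omega)
  · rw [Finset.card_range]
    exact Nat.add_le_add_left (Nat.mul_le_mul_right _ ht) _

lemma Bounded.sumNum_le {L : ℕ} (h : v.Bounded L) {ans : ℕ → ℤ}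
    (hans : ∀ i, bits (ans i) ≤ 2 * L + 1) {t : ℕ} (ht : t ≤ L) :
    bits (v.sumNum s ans t) ≤ sumNumBits s L := by
  have key : bits (v.sumNum s ans t) ≤ t * ((prodBits s L + prodBits s L) +
      (prodBits s L + qBits s L + (2 * L + 1) + sumDenBits s L) + 1) := by
    induction t with
    | zero => simp [sumNum, bits]
    | succ t ih =>
      have h1 := ih (by omega)
      have h2 := bits_add_le (v.sumNum s ans t * v.nodeDen s t)
        (v.weightNum s t (v.d + 1) * v.qNum s t (v.N / 2) * ans t * v.sumDen s t)
      have h3 := bits_mul_le (v.sumNum s ans t) (v.nodeDen s t)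
      have h4 := h.nodeDen_le s (i := t) (by omega)
      have h5 := bits_mul_le (v.weightNum s t (v.d + 1) * v.qNum s t (v.N / 2) * ans t)
        (v.sumDen s t)
      have h6 := bits_mul_le (v.weightNum s t (v.d + 1) * v.qNum s t (v.N / 2)) (ans t)
      have h7 := bits_mul_le (v.weightNum s t (v.d + 1)) (v.qNum s t (v.N / 2))
      have h8 := h.weightNum_le s (i := t) (by omega) h.d_lt
      have h9 := h.qNum_le s (i := t) (k := v.N / 2) (by omega) (by have := h.N_le; omega)
      have h10 := hans t
      have h11 := h.sumDen_le s (t := t) (by omega)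
      rw [sumNum, add_mul]
      omega
  exact key.trans (Nat.mul_le_mul_right _ ht)

end NodeData

end Values

/-! ### Specifications of the subprograms -/

section Correctness

namespace NodeData

variable {v : NodeData} {s : SqueezingRule} {L : ℕ} {O : Oracle v.N v.M}
  {X : Matrix (Fin v.N) (Fin v.M) ℂ} {m : ℕ → ℤ}

lemma weightNum_succ (i t : ℕ) : v.weightNum s i (t + 1) =
    if t = i then v.weightNum s i t else v.weightNum s i t * v.wn s i t := by
  unfold weightNum
  split_ifs with h
  · subst h
    rw [Finset.range_add_one, Finset.erase_insert (by simp), Finset.erase_eq_of_notMem (by simp)]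
  · rw [Finset.range_add_one, Finset.erase_insert_of_ne h, Finset.prod_insert (by simp), mul_comm]

lemma weightDen_succ (i t : ℕ) : v.weightDen s i (t + 1) =
    if t = i then v.weightDen s i t else v.weightDen s i t * v.wd s i t := by
  unfold weightDen
  split_ifs with h
  · subst h
    rw [Finset.range_add_one, Finset.erase_insert (by simp), Finset.erase_eq_of_notMem (by simp)]
  · rw [Finset.range_add_one, Finset.erase_insert_of_ne h, Finset.prod_insert (by simp), mul_comm]

lemma termDen_succ (i k : ℕ) : v.termDen s i (k + 1) = v.termDen s i k * v.rd s i k :=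
  Finset.prod_range_succ _ _

lemma sumDen_succ (t : ℕ) : v.sumDen s (t + 1) =
    v.sumDen s t * (v.weightDen s t (v.d + 1) * v.termDen s t (v.N / 2)) :=
  Finset.prod_range_succ _ _

/-- This and the following specifications are in continuation form: final values together with a
frame condition on untouched registers imply an arbitrary `Q`, so they chain through `seq`. -/
lemma wp_weightProgram (h : v.Holds m) (hb : v.Bounded L) {i : ℕ} (hi : i ≤ L) (hm : m 15 = i)
    {Q : (ℕ → ℤ) → Prop}
    (hQ : ∀ m', (∀ r, r < 16 ∨ 18 < r → m' r = m r) → m' 16 = v.weightNum s i (v.d + 1) →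
      m' 17 = v.weightDen s i (v.d + 1) → Q m') :
    (weightProgram s).wp O X (regBits s L) L Q m := by
  have hone : 1 ≤ regBits s L := by unfold regBits; omega
  have hd := hb.d_lt
  have hcount : ∀ m' : ℕ → ℤ, m' 9 = v.d →
      ((Expr.add (.reg 9) (.lit 1)).val m').toNat = v.d + 1 := by
    intro m' h'; simp only [Expr.val, h']; omega
  simp only [weightProgram, Program.wp]
  refine ⟨by simpa [Expr.val, bits_one] using hone, by simpa [Expr.val, bits_one] using hone,
    by simp [Expr.val, bits], ?_⟩
  rw [hcount _ (by simp [Function.update, h.h9])]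
  refine ⟨hd, fun t m' => (∀ r, r < 16 ∨ 18 < r → m' r = m r) ∧ m' 16 = v.weightNum s i t ∧
    m' 17 = v.weightDen s i t ∧ m' 18 = t, ?_, ?_, ?_⟩
  · refine ⟨fun r hr => ?_, ?_, ?_, ?_⟩
    · rw [Function.update_of_ne (by omega), Function.update_of_ne (by omega),
        Function.update_of_ne (by omega)]
    · simp [Function.update, Expr.val, weightNum]
    · simp [Function.update, Expr.val, weightDen]
    · simp [Expr.val]
  · rintro t ht m' ⟨h1, h2, h3, h4⟩
    have hm' : v.Holds m' := h.of_agree fun r hr => h1 r (by omega)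
    have h15 : m' 15 = i := by rw [h1 15 (by norm_num), hm]
    have hW := hb.weightNum_le s hi (t := t + 1) (by omega)
    have hD := hb.weightDen_le s hi (t := t + 1) (by omega)
    have hbt : bits ((t : ℤ) + 1) ≤ regBits s L :=
      (bits_natCast_le (t + 1)).trans (by unfold regBits; omega)
    rw [weightNum_succ] at hW
    rw [weightDen_succ] at hD
    have hcond : 0 < (Expr.mul (.sub (.reg 18) (.reg 15)) (.sub (.reg 18) (.reg 15))).val m' ↔
        ¬ t = i := by
      simp only [Expr.val, h4, h15]
      constructor
      · rintro h' rfl; simp at h'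
      · intro h'
        have : (t : ℤ) - i ≠ 0 := by omega
        exact mul_self_pos.2 this
    by_cases hti : t = i
    swap
    · rw [if_pos (hcond.2 hti)]
      rw [if_neg hti] at hW hD
      have e1 : (Expr.mul (.reg 16) (weightNumE s)).val m' =
          v.weightNum s i t * v.wn s i t := by
        simp only [Expr.val]; rw [hm'.weightNumE, h2, h15, h4]
      rw [e1]
      have hm'' : v.Holds (Function.update m' 16 (v.weightNum s i t * v.wn s i t)) :=
        hm'.of_agree fun r hr => Function.update_of_ne (by omega) _ _
      have e2 : (Expr.mul (.reg 17) (weightDenE s)).val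
          (Function.update m' 16 (v.weightNum s i t * v.wn s i t)) =
          v.weightDen s i t * v.wd s i t := by
        simp only [Expr.val]; rw [hm''.weightDenE]; simp [Function.update, h3, h4, h15]
      rw [e2]
      refine ⟨hW.trans (by unfold regBits; omega), hD.trans (by unfold regBits; omega), ?_, ?_⟩
      · simpa [Expr.val, Function.update, h4] using hbt
      · refine ⟨fun r hr => ?_, ?_, ?_, ?_⟩
        · rw [Function.update_of_ne (by omega), Function.update_of_ne (by omega),
            Function.update_of_ne (by omega), h1 r hr]
        · simp [Function.update, weightNum_succ, hti]
        · simp [Function.update, weightDen_succ, hti]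
        · simp [Function.update, Expr.val, h4]
    · rw [if_neg (fun hc => hcond.1 hc hti)]
      refine ⟨by simpa [Expr.val, h4] using hbt, fun r hr => ?_, ?_, ?_, ?_⟩
      · rw [Function.update_of_ne (by omega), h1 r hr]
      · rw [Function.update_of_ne (by omega), h2, weightNum_succ, if_pos hti]
      · rw [Function.update_of_ne (by omega), h3, weightDen_succ, if_pos hti]
      · simp [Expr.val, h4]
  · rintro m' ⟨h1, h2, h3, -⟩
    exact hQ m' h1 h2 h3

lemma wp_qProgram (h : v.Holds m) (hb : v.Bounded L) {i : ℕ} (hi : i ≤ L) (hm : m 15 = i)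
    {Q : (ℕ → ℤ) → Prop}
    (hQ : ∀ m', (∀ r, r < 19 ∨ 22 < r → m' r = m r) → m' 20 = v.qNum s i (v.N / 2) →
      m' 21 = v.termDen s i (v.N / 2) → Q m') :
    (qProgram s).wp O X (regBits s L) L Q m := by
  have hone : 1 ≤ regBits s L := by unfold regBits; omega
  have hN := hb.N_le
  have hcount : ∀ m' : ℕ → ℤ, m' 0 = v.N →
      ((Expr.div (.reg 0) (.lit 2)).val m').toNat = v.N / 2 := by
    intro m' h'
    simp only [Expr.val, h']
    rw [Int.fdiv_eq_ediv_of_nonneg _ (by norm_num)]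
    omega
  simp only [qProgram, Program.wp]
  refine ⟨by simpa [Expr.val, bits_one] using hone, by simpa [Expr.val, bits_one] using hone,
    by simpa [Expr.val, bits_one] using hone, by simp [Expr.val, bits], ?_⟩
  rw [hcount _ (by simp [Function.update, h.h0])]
  refine ⟨by omega, fun t m' => (∀ r, r < 19 ∨ 22 < r → m' r = m r) ∧ m' 19 = v.termNum s i t ∧
    m' 20 = v.qNum s i t ∧ m' 21 = v.termDen s i t ∧ m' 22 = t, ?_, ?_, ?_⟩
  · refine ⟨fun r hr => ?_, ?_, ?_, ?_, ?_⟩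
    · rw [Function.update_of_ne (by omega), Function.update_of_ne (by omega),
        Function.update_of_ne (by omega), Function.update_of_ne (by omega)]
    · simp [Function.update, Expr.val, termNum]
    · simp [Function.update, Expr.val, qNum]
    · simp [Function.update, Expr.val, termDen]
    · simp [Expr.val]
  · rintro t ht m' ⟨h1, h2, h3, h4, h5⟩
    have hm' : v.Holds m' := h.of_agree fun r hr => h1 r (by omega)
    have h15 : m' 15 = i := by rw [h1 15 (by norm_num), hm]
    have hW := hb.termNum_le s hi (k := t + 1) (by omega)
    have hD := hb.termDen_le s hi (k := t + 1) (by omega)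
    have hS := hb.qNum_le s hi (k := t + 1) (by omega)
    have hbt : bits ((t : ℤ) + 1) ≤ regBits s L :=
      (bits_natCast_le (t + 1)).trans (by unfold regBits; omega)
    have e1 : (Expr.mul (.reg 19) (termNumE s)).val m' = v.termNum s i (t + 1) := by
      simp only [Expr.val]; rw [hm'.termNumE, h2, h15, h5, termNum, termNum, Finset.prod_range_succ]
    rw [e1]
    have hm2 : v.Holds (Function.update m' 19 (v.termNum s i (t + 1))) :=
      hm'.of_agree fun r hr => Function.update_of_ne (by omega) _ _
    have e2 : (Expr.add (.mul (.reg 20) (termDenE s)) (.reg 19)).val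
        (Function.update m' 19 (v.termNum s i (t + 1))) = v.qNum s i (t + 1) := by
      simp only [Expr.val]; rw [hm2.termDenE]; simp [Function.update, h3, h5, h15, qNum]
    rw [e2]
    have hm3 : v.Holds (Function.update (Function.update m' 19 (v.termNum s i (t + 1))) 20
        (v.qNum s i (t + 1))) :=
      hm2.of_agree fun r hr => Function.update_of_ne (by omega) _ _
    have e3 : (Expr.mul (.reg 21) (termDenE s)).val (Function.update (Function.update m' 19
        (v.termNum s i (t + 1))) 20 (v.qNum s i (t + 1))) = v.termDen s i (t + 1) := by
      simp only [Expr.val]; rw [hm3.termDenE]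
      rw [termDen_succ]
      repeat rw [Function.update_of_ne (by norm_num)]
      rw [h4, h5, h15]
    rw [e3]
    refine ⟨hW.trans (by unfold regBits; omega), hS.trans (by unfold regBits; omega),
      hD.trans (by unfold regBits; omega), ?_, ?_⟩
    · simpa [Expr.val, Function.update, h5] using hbt
    · refine ⟨fun r hr => ?_, ?_, ?_, ?_, ?_⟩
      · rw [Function.update_of_ne (by omega), Function.update_of_ne (by omega),
          Function.update_of_ne (by omega), Function.update_of_ne (by omega), h1 r hr]
      · simp [Function.update]
      · simp [Function.update]
      · simp [Function.update]
      · simp [Function.update, Expr.val, h5]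
  · rintro m' ⟨h1, -, h3, h4, -⟩
    exact hQ m' h1 h3 h4

variable (v s) in
/-- The answer of the oracle at a node. -/
def answer (O : Oracle v.N v.M) (X : Matrix (Fin v.N) (Fin v.M) ℂ) (i : ℕ) : ℤ :=
  readReal v.prec (O (((v.den - v.a i : ℤ) : ℝ) / (v.den : ℝ)) X)

lemma wp_nodeProgram (h : v.Holds m) (hb : v.Bounded L) {i : ℕ} (hi : i < v.d + 1)
    (hm : m 15 = i) (h13 : m 13 = v.sumNum s (v.answer O X) i) (h14 : m 14 = v.sumDen s i)
    {Q : (ℕ → ℤ) → Prop}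
    (hQ : ∀ m', (∀ r, r < 13 ∨ 23 < r → m' r = m r) →
      m' 13 = v.sumNum s (v.answer O X) (i + 1) → m' 14 = v.sumDen s (i + 1) →
      m' 15 = ((i + 1 : ℕ) : ℤ) → Q m') :
    (nodeProgram s).wp O X (regBits s L) L Q m := by
  have hd := hb.d_lt
  have hiL : i ≤ L := by omega
  simp only [nodeProgram, Program.wp]
  refine wp_weightProgram h hb hiL hm fun m₁ a1 w1 w2 => ?_
  have hm1 : v.Holds m₁ := h.of_agree fun r hr => a1 r (by omega)
  refine wp_qProgram hm1 hb hiL (by rw [a1 15 (by norm_num), hm]) fun m₂ a2 q1 q2 => ?_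
  have hm2 : v.Holds m₂ := hm1.of_agree fun r hr => a2 r (by omega)
  have b15 : m₂ 15 = i := by rw [a2 15 (by norm_num), a1 15 (by norm_num), hm]
  have b13 : m₂ 13 = v.sumNum s (v.answer O X) i := by
    rw [a2 13 (by norm_num), a1 13 (by norm_num), h13]
  have b14 : m₂ 14 = v.sumDen s i := by rw [a2 14 (by norm_num), a1 14 (by norm_num), h14]
  have b16 : m₂ 16 = v.weightNum s i (v.d + 1) := by rw [a2 16 (by norm_num), w1]
  have b17 : m₂ 17 = v.weightDen s i (v.d + 1) := by rw [a2 17 (by norm_num), w2]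
  have hprec : ((Expr.reg 12).val m₂).toNat = v.prec := by simp [Expr.val, hm2.h12]
  have hans : ∀ j, bits (v.answer O X j) ≤ 2 * L + 1 := fun j =>
    (bits_readReal_le _ _).trans (by have := hb.prec_le; omega)
  have hask : readReal ((Expr.reg 12).val m₂).toNat
      (O (((Expr.sub (.reg 11) (lossNumE (.reg 15))).val m₂ : ℝ) / ((Expr.reg 11).val m₂ : ℝ)) X) =
      v.answer O X i := by
    rw [hprec]
    simp only [Expr.val]
    rw [hm2.lossNumE]
    simp only [Expr.val, hm2.h11, b15]
    rfl
  rw [hask, hprec]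
  have hN := hb.sumNum_le s hans (t := i + 1) (by omega)
  have hD := hb.sumDen_le s (t := i + 1) (by omega)
  have e1 : (Expr.add (.mul (.reg 13) (.mul (.reg 17) (.reg 21)))
      (.mul (.mul (.mul (.reg 16) (.reg 20)) (.reg 23)) (.reg 14))).val
      (Function.update m₂ 23 (v.answer O X i)) = v.sumNum s (v.answer O X) (i + 1) := by
    simp [Expr.val, Function.update, b13, b14, b16, b17, q1, q2, sumNum, nodeDen]
  rw [e1]
  have e2 : (Expr.mul (.reg 14) (.mul (.reg 17) (.reg 21))).val (Function.update (Function.update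
      m₂ 23 (v.answer O X i)) 13 (v.sumNum s (v.answer O X) (i + 1))) = v.sumDen s (i + 1) := by
    rw [sumDen_succ]
    simp only [Expr.val]
    repeat rw [Function.update_of_ne (by norm_num)]
    rw [b14, b17, q2]
  rw [e2]
  refine ⟨hb.prec_le, by unfold regBits; omega, hN.trans (by unfold regBits; omega),
    hD.trans (by unfold regBits; omega), ?_, hQ _ (fun r hr => ?_) ?_ ?_ ?_⟩
  · have : bits ((i : ℤ) + 1) ≤ regBits s L :=
      (bits_natCast_le (i + 1)).trans (by unfold regBits; omega)
    simpa [Expr.val, Function.update, b15] using this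
  · rw [Function.update_of_ne (by omega), Function.update_of_ne (by omega),
      Function.update_of_ne (by omega), Function.update_of_ne (by omega), a2 r (by omega),
      a1 r (by omega)]
  · simp [Function.update]
  · simp [Function.update]
  · simp [Function.update, Expr.val, b15]

end NodeData

end Correctness

/-! ### Choice of degree, nodes and precision -/

section Preparation

open NodeData

/-- An integer above `N / (ε₀ δ₀)`. -/
def sizeCount (N : ℕ) (ε₀ δ₀ : ℚ) : ℕ :=
  N * ε₀.den * δ₀.den / (ε₀.num.toNat * δ₀.num.toNat) + 1

/-- An integer above `(1 - ηstar) N`. -/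
def lossCount (N : ℕ) (ηstar : ℚ) : ℕ := ((ηstar.den - ηstar.num) * N / ηstar.den).toNat + 1

/-- The degree of the extrapolation. -/
def degree (N : ℕ) (ηstar ε₀ δ₀ : ℚ) : ℕ :=
  Nat.clog 3 (sizeCount N ε₀ δ₀) + 32 * lossCount N ηstar

/-- The number of bits to which the answers of the oracle are read. -/
def precision (N M : ℕ) (ηstar ε₀ δ₀ : ℚ) : ℕ :=
  -- The first summand absorbs the exponential amplification, the two quotients absorb `1 / δ₀` and
  -- `1 / ε₀`, and the last bracket absorbs the error unit and numerical constants.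
  4 * degree N ηstar ε₀ δ₀ + ((δ₀.den / δ₀.num.toNat + 1) + (ε₀.den / ε₀.num.toNat + 1)) +
    ((2 * N + M) * N + 4)

/-- The nodes that the program uses. -/
def nodeData (N M : ℕ) (ηstar ε₀ δ₀ : ℚ) : NodeData where
  N := N
  M := M
  rateNum := ηstar.num
  rateDen := ηstar.den
  d := degree N ηstar ε₀ δ₀
  lossNum := 64 * N * (ηstar.den - ηstar.num) + ηstar.den
  den := 64 * N * ηstar.den * degree N ηstar ε₀ δ₀
  prec := precision N M ηstar ε₀ δ₀

variable {N M : ℕ} {ηstar ε₀ δ₀ : ℚ} {s : SqueezingRule} {L : ℕ} {O : Oracle N M}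
  {X : Matrix (Fin N) (Fin M) ℂ} {m : ℕ → ℤ} {Q : (ℕ → ℤ) → Prop}

/-- The registers `0, …, 7` hold the input. -/
def HoldsInput (N M : ℕ) (ηstar ε₀ δ₀ : ℚ) (m : ℕ → ℤ) : Prop :=
  ∀ r < 8, m r = (initial N M ηstar ε₀ δ₀).reg r

lemma bits_natCast_pow_le {a b : ℕ} (hab : a ≤ 2 ^ b) (t : ℕ) : bits ((a : ℤ) ^ t) ≤ b * t + 1 := by
  rw [bits_le_iff, Int.natAbs_pow, Int.natAbs_natCast, pow_succ, pow_mul]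
  have h1 : a ^ t ≤ (2 ^ b) ^ t := Nat.pow_le_pow_left hab t
  have h2 : 0 < (2 ^ b) ^ t := by positivity
  omega

lemma wp_degreeProgram (h : HoldsInput N M ηstar ε₀ δ₀ m) (hη : ηstar ≤ 1) (hε : 0 < ε₀)
    (hδ : 0 < δ₀) (hL : sizeCount N ε₀ δ₀ ≤ L) (hd : degree N ηstar ε₀ δ₀ ≤ L)
    (hQ : ∀ m', (∀ r < 8, m' r = m r) → m' 9 = ((degree N ηstar ε₀ δ₀ : ℕ) : ℤ) → Q m') :
    degreeProgram.wp O X (regBits s L) L Q m := by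
  have hG : 3 * L + 10 ≤ regBits s L := by unfold regBits; omega
  have g0 : m 0 = N := h 0 (by norm_num)
  have g2 : m 2 = ηstar.num := h 2 (by norm_num)
  have g3 : m 3 = ηstar.den := h 3 (by norm_num)
  have g4 : m 4 = ε₀.num.toNat := by
    rw [h 4 (by norm_num), Int.toNat_of_nonneg (Rat.num_nonneg.2 hε.le)]; rfl
  have g5 : m 5 = ε₀.den := h 5 (by norm_num)
  have g6 : m 6 = δ₀.num.toNat := by
    rw [h 6 (by norm_num), Int.toNat_of_nonneg (Rat.num_nonneg.2 hδ.le)]; rfl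
  have g7 : m 7 = δ₀.den := h 7 (by norm_num)
  set cnt := sizeCount N ε₀ δ₀ with hcnt
  have e1 : (Expr.add (.div (.mul (.mul (.reg 0) (.reg 5)) (.reg 7)) (.mul (.reg 4) (.reg 6)))
      (.lit 1)).val m = cnt := by
    simp only [Expr.val, g0, g4, g5, g6, g7]
    rw [Int.fdiv_eq_ediv_of_nonneg _ (by positivity), hcnt, sizeCount]
    push_cast
    rfl
  simp only [degreeProgram, Program.wp]
  rw [e1]
  refine ⟨(bits_natCast_le _).trans (by omega), by simp [Expr.val, bits_one]; omega,
    by simp [Expr.val, bits], ?_⟩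
  have e2 : (Expr.reg 13).val (Function.update (Function.update (Function.update m 13 (cnt : ℤ)) 8
      ((Expr.lit 1).val (Function.update m 13 (cnt : ℤ)))) 9 ((Expr.lit 0).val (Function.update
      (Function.update m 13 (cnt : ℤ)) 8 ((Expr.lit 1).val (Function.update m 13 (cnt : ℤ)))))) =
      cnt := by simp [Expr.val, Function.update]
  rw [e2, Int.toNat_natCast]
  -- The minimum in the invariant describes both phases: tripling up to the logarithm, idling
  -- afterwards.
  refine ⟨hL, fun t m' => (∀ r < 8, m' r = m r) ∧ m' 13 = cnt ∧
    m' 9 = (min t (Nat.clog 3 cnt) : ℕ) ∧ m' 8 = (3 : ℤ) ^ min t (Nat.clog 3 cnt), ?_, ?_, ?_⟩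
  · refine ⟨fun r hr => ?_, ?_, ?_, ?_⟩
    · rw [Function.update_of_ne (by omega), Function.update_of_ne (by omega),
        Function.update_of_ne (by omega)]
    · simp [Function.update]
    · simp [Expr.val]
    · simp [Function.update, Expr.val]
  · rintro t ht m' ⟨h1, h2, h3, h4⟩
    have hcond : 0 < (Expr.sub (.reg 13) (.reg 8)).val m' ↔ t < Nat.clog 3 cnt := by
      simp only [Expr.val, h2, h4]
      rw [sub_pos]
      have := Nat.lt_clog_iff_pow_lt (b := 3) (by norm_num) (x := cnt) (y := min t (Nat.clog 3 cnt))
      rw [show ((3 : ℤ) ^ min t (Nat.clog 3 cnt) < cnt ↔ 3 ^ min t (Nat.clog 3 cnt) < cnt) by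
        exact_mod_cast Iff.rfl, ← this]
      omega
    by_cases hc : t < Nat.clog 3 cnt
    · rw [if_pos (hcond.2 hc)]
      rw [min_eq_left hc.le] at h3 h4
      have f1 : (Expr.mul (.lit 3) (.reg 8)).val m' = 3 ^ (t + 1) := by
        simp only [Expr.val, h4, pow_succ]; ring
      rw [f1]
      have f2 : (Expr.add (.reg 9) (.lit 1)).val (Function.update m' 8 (3 ^ (t + 1))) =
          (t + 1 : ℕ) := by simp [Expr.val, Function.update, h3]
      rw [f2]
      have hb := bits_natCast_pow_le (a := 3) (b := 2) (by norm_num) (t + 1)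
      refine ⟨hb.trans (by omega), (bits_natCast_le _).trans (by omega), fun r hr => ?_, ?_, ?_, ?_⟩
      · rw [Function.update_of_ne (by omega), Function.update_of_ne (by omega), h1 r hr]
      · simp [Function.update, h2]
      · rw [min_eq_left hc]; simp
      · rw [min_eq_left hc]; simp [Function.update]
    · rw [if_neg (fun h' => hc (hcond.1 h'))]
      rw [min_eq_right (by omega)] at h3 h4
      refine ⟨h1, h2, ?_, ?_⟩
      · rw [h3, min_eq_right (by omega)]
      · rw [h4, min_eq_right (by omega)]
  · rintro m' ⟨h1, h2, h3, h4⟩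
    -- The loop is long enough for the search to finish.
    have hle : Nat.clog 3 cnt ≤ cnt :=
      Nat.clog_le_of_le_pow (Nat.lt_pow_self (by norm_num)).le
    rw [min_eq_right hle] at h3
    have f : (Expr.add (.reg 9) (.mul (.lit 32)
        (.add (.div (.mul (.sub (.reg 3) (.reg 2)) (.reg 0)) (.reg 3)) (.lit 1)))).val m' =
        (degree N ηstar ε₀ δ₀ : ℕ) := by
      have hnn : 0 ≤ ((ηstar.den : ℤ) - ηstar.num) * N / ηstar.den := by
        have : ηstar.num ≤ ηstar.den := by
          exact Rat.num_le_denom_iff.2 hη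
        refine Int.ediv_nonneg (mul_nonneg (by omega) (by positivity)) (by positivity)
      simp only [Expr.val, h3, h1 3 (by norm_num), h1 2 (by norm_num), h1 0 (by norm_num), g0, g2, g3]
      rw [Int.fdiv_eq_ediv_of_nonneg _ (by positivity), degree, lossCount]
      push_cast
      rw [Int.toNat_of_nonneg hnn]
    rw [f]
    refine ⟨(bits_natCast_le _).trans (by omega), hQ _ (fun r hr => ?_) (by simp)⟩
    rw [Function.update_of_ne (by omega), h1 r hr]

lemma wp_precisionProgram (h : HoldsInput N M ηstar ε₀ δ₀ m) (hε : 0 < ε₀)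
    (hδ : 0 < δ₀) (h9 : m 9 = (degree N ηstar ε₀ δ₀ : ℕ))
    (hb : (nodeData N M ηstar ε₀ δ₀).Bounded L)
    (hQ : ∀ m', (nodeData N M ηstar ε₀ δ₀).Holds m' →
      m' 24 = 2 ^ precision N M ηstar ε₀ δ₀ → Q m') :
    precisionProgram.wp O X (regBits s L) L Q m := by
  have hG : 3 * L + 10 ≤ regBits s L := by unfold regBits; omega
  have g0 : m 0 = N := h 0 (by norm_num)
  have g1 : m 1 = M := h 1 (by norm_num)
  have g2 : m 2 = ηstar.num := h 2 (by norm_num)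
  have g3 : m 3 = ηstar.den := h 3 (by norm_num)
  have g4 : m 4 = ε₀.num.toNat := by
    rw [h 4 (by norm_num), Int.toNat_of_nonneg (Rat.num_nonneg.2 hε.le)]; rfl
  have g5 : m 5 = ε₀.den := h 5 (by norm_num)
  have g6 : m 6 = δ₀.num.toNat := by
    rw [h 6 (by norm_num), Int.toNat_of_nonneg (Rat.num_nonneg.2 hδ.le)]; rfl
  have g7 : m 7 = δ₀.den := h 7 (by norm_num)
  have b10 := hb.lossNum_le
  have b11 := hb.den_le
  have b12 := hb.prec_le
  set v := nodeData N M ηstar ε₀ δ₀ with hv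
  simp only [precisionProgram, Program.wp]
  have e1 : (Expr.add (.mul (.mul (.lit 64) (.reg 0)) (.sub (.reg 3) (.reg 2))) (.reg 3)).val m =
      v.lossNum := by
    simp only [Expr.val, g0, g2, g3]; rfl
  rw [e1]
  have e2 : (Expr.mul (.mul (.mul (.lit 64) (.reg 0)) (.reg 3)) (.reg 9)).val
      (Function.update m 10 v.lossNum) = v.den := by
    simp [Expr.val, Function.update, g0, g3, h9, hv, nodeData]
  rw [e2]
  have e3 : (Expr.add (.add (.mul (.lit 4) (.reg 9))
      (.add (.add (.div (.reg 7) (.reg 6)) (.lit 1)) (.add (.div (.reg 5) (.reg 4)) (.lit 1))))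
      (.add (.mul (.add (.mul (.lit 2) (.reg 0)) (.reg 1)) (.reg 0)) (.lit 4))).val
      (Function.update (Function.update m 10 v.lossNum) 11 v.den) = (v.prec : ℕ) := by
    simp only [Expr.val, ne_eq, Nat.reduceEqDiff, not_false_eq_true, Function.update_of_ne, g0, g1,
      g4, g5, g6, g7, h9, hv, nodeData, precision]
    rw [Int.fdiv_eq_ediv_of_nonneg _ (by positivity), Int.fdiv_eq_ediv_of_nonneg _ (by positivity)]
    push_cast
    ring
  rw [e3]
  refine ⟨b10.trans (by omega), b11.trans (by omega), (bits_natCast_le _).trans (by omega),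
    by simp [Expr.val, bits_one]; omega, ?_⟩
  have e4 : ∀ y : ℤ, ((Expr.reg 12).val (Function.update (Function.update (Function.update
      (Function.update m 10 v.lossNum) 11 v.den) 12 (v.prec : ℤ)) 24 y)).toNat = v.prec := by
    intro y; simp [Expr.val, Function.update]
  rw [e4]
  refine ⟨b12, fun t m' => v.Holds m' ∧ m' 24 = 2 ^ t, ?_, ?_, ?_⟩
  · refine ⟨⟨?_, ?_, ?_, ?_, ?_, ?_, ?_, ?_⟩, ?_⟩ <;>
      simp [Function.update, Expr.val, g0, g1, g2, g3, h9, hv, nodeData]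
  · rintro t ht m' ⟨h1, h2⟩
    have hbt := bits_natCast_pow_le (a := 2) (b := 1) (by norm_num) (t + 1)
    have f : (Expr.mul (.lit 2) (.reg 24)).val m' = 2 ^ (t + 1) := by
      simp only [Expr.val, h2, pow_succ]; ring
    rw [f]
    refine ⟨hbt.trans (by omega), h1.of_agree fun r hr => Function.update_of_ne (by omega) _ _,
      by simp⟩
  · rintro m' ⟨h1, h2⟩
    exact hQ m' h1 h2

lemma wp_extrapolation (h : HoldsInput N M ηstar ε₀ δ₀ m) (hη : ηstar ≤ 1) (hε : 0 < ε₀)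
    (hδ : 0 < δ₀) (hL : sizeCount N ε₀ δ₀ ≤ L) (hb : (nodeData N M ηstar ε₀ δ₀).Bounded L)
    (hQ : ∀ m',
      m' 0 = (nodeData N M ηstar ε₀ δ₀).sumNum s ((nodeData N M ηstar ε₀ δ₀).answer O X)
        (degree N ηstar ε₀ δ₀ + 1) →
      m' 1 = (nodeData N M ηstar ε₀ δ₀).sumDen s (degree N ηstar ε₀ δ₀ + 1) *
        2 ^ precision N M ηstar ε₀ δ₀ → Q m') :
    (extrapolation s).wp O X (regBits s L) L Q m := by
  have hG : sumNumBits s L + sumDenBits s L + (3 * L + 10) ≤ regBits s L := by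
    unfold regBits; omega
  have hdL := hb.d_lt
  have hpL := hb.prec_le
  simp only [extrapolation, Program.wp]
  refine wp_degreeProgram h hη hε hδ hL (by change (nodeData N M ηstar ε₀ δ₀).d ≤ L; omega)
    fun m₁ a1 h9 => ?_
  refine wp_precisionProgram (fun r hr => by rw [a1 r hr, h r hr]) hε hδ h9 hb fun m₂ h2 h24 => ?_
  refine ⟨by simp [Expr.val, bits], by simp [Expr.val, bits_one]; omega, by simp [Expr.val, bits], ?_⟩
  have e1 : ∀ y : ℕ → ℤ, y 9 = (nodeData N M ηstar ε₀ δ₀).d →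
      ((Expr.add (.reg 9) (.lit 1)).val y).toNat = (nodeData N M ηstar ε₀ δ₀).d + 1 := by
    intro y hy; simp only [Expr.val, hy]; omega
  rw [e1 _ (by simp [Function.update, h2.h9])]
  refine ⟨hdL, fun t m' => (nodeData N M ηstar ε₀ δ₀).Holds m' ∧
    m' 24 = 2 ^ precision N M ηstar ε₀ δ₀ ∧ m' 13 = (nodeData N M ηstar ε₀ δ₀).sumNum s
      ((nodeData N M ηstar ε₀ δ₀).answer O X) t ∧
    m' 14 = (nodeData N M ηstar ε₀ δ₀).sumDen s t ∧ m' 15 = t, ?_, ?_, ?_⟩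
  · refine ⟨h2.of_agree fun r hr => ?_, ?_, ?_, ?_, ?_⟩
    · rw [Function.update_of_ne (by omega), Function.update_of_ne (by omega),
        Function.update_of_ne (by omega)]
    · simp [Function.update, h24]
    · simp [Function.update, Expr.val, NodeData.sumNum]
    · simp [Function.update, Expr.val, NodeData.sumDen]
    · simp [Expr.val]
  · rintro t ht m' ⟨k1, k2, k3, k4, k5⟩
    refine NodeData.wp_nodeProgram (v := nodeData N M ηstar ε₀ δ₀) k1 hb ht k5 k3 k4
      fun m'' l1 l2 l3 l4 => ⟨k1.of_agree fun r hr => l1 r (by omega), ?_, l2, l3, l4⟩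
    rw [l1 24 (by norm_num), k2]
  · rintro m' ⟨k1, k2, k3, k4, -⟩
    have hans : ∀ j, bits ((nodeData N M ηstar ε₀ δ₀).answer O X j) ≤ 2 * L + 1 := fun j =>
      (bits_readReal_le _ _).trans (by omega)
    have hN := hb.sumNum_le s hans hdL
    have hD := hb.sumDen_le s hdL
    have hp := bits_natCast_pow_le (a := 2) (b := 1) (by norm_num) (nodeData N M ηstar ε₀ δ₀).prec
    have hmul := bits_mul_le ((nodeData N M ηstar ε₀ δ₀).sumDen s
      ((nodeData N M ηstar ε₀ δ₀).d + 1)) (2 ^ (nodeData N M ηstar ε₀ δ₀).prec)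
    have f1 : (Expr.reg 13).val m' = (nodeData N M ηstar ε₀ δ₀).sumNum s
      ((nodeData N M ηstar ε₀ δ₀).answer O X) ((nodeData N M ηstar ε₀ δ₀).d + 1) := k3
    rw [f1]
    have f2 : ∀ y : ℤ, (Expr.mul (.reg 14) (.reg 24)).val (Function.update m' 0 y) =
        (nodeData N M ηstar ε₀ δ₀).sumDen s ((nodeData N M ηstar ε₀ δ₀).d + 1) *
        2 ^ (nodeData N M ηstar ε₀ δ₀).prec := by
      intro y
      simp only [Expr.val, ne_eq, OfNat.ofNat_ne_zero, not_false_eq_true, Function.update_of_ne, k2,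
        k4]
      rfl
    rw [f2]
    push_cast at hp
    refine ⟨hN.trans (by omega), hmul.trans (by omega), hQ _ ?_ ?_⟩
    · simp [Function.update]; rfl
    · simp [Function.update]; rfl

end Preparation

/-! ### The output equals the real-valued estimate -/

section ExactValue

namespace NodeData

variable {v : NodeData} {s : SqueezingRule}

lemma weightNum_div_weightDen (hq : ∀ j ≤ v.d, v.q s j ≠ 0) {i : ℕ} (hi : i ≤ v.d) :
    (v.weightNum s i (v.d + 1) : ℝ) / v.weightDen s i (v.d + 1) =
      weight v.d (fun j => (v.p s j : ℝ) / v.q s j) i := by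
  rw [weightNum, weightDen, weight]
  push_cast
  rw [← Finset.prod_div_distrib]
  refine Finset.prod_congr rfl fun j hj => ?_
  have hj' := Finset.mem_range.1 (Finset.mem_of_mem_erase hj)
  have h1 : (v.q s i : ℝ) ≠ 0 := by exact_mod_cast hq i hi
  have h2 : (v.q s j : ℝ) ≠ 0 := by exact_mod_cast hq j (by omega)
  rw [wn, wd, div_sub_div _ _ h2 h1, div_div_div_eq]
  push_cast
  rw [← mul_div_mul_left _ _ h2]
  congr 1 <;> ring

/-- A vanishing factor would be a coincidence of two nodes, cross-multiplied. -/
lemma weightDen_ne_zero (hq : ∀ j ≤ v.d, v.q s j ≠ 0)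
    (hz : Set.InjOn (fun j : ℕ => (v.p s j : ℝ) / v.q s j) (Finset.range (v.d + 1))) {i : ℕ}
    (hi : i ≤ v.d) : v.weightDen s i (v.d + 1) ≠ 0 := by
  rw [weightDen, Finset.prod_ne_zero_iff]
  intro j hj h
  rw [Finset.mem_erase] at hj
  refine hj.1 (hz (Finset.mem_coe.2 hj.2) (by simpa [Nat.lt_succ_iff] using hi) ?_)
  have hj' := Finset.mem_range.1 hj.2
  have h1 : (v.q s i : ℝ) ≠ 0 := by exact_mod_cast hq i hi
  have h2 : (v.q s j : ℝ) ≠ 0 := by exact_mod_cast hq j (by omega)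
  dsimp only
  rw [div_eq_div_iff h2 h1]
  rw [wd, sub_eq_zero] at h
  exact_mod_cast h

lemma rd_ne_zero {i : ℕ} (hq : v.q s i ≠ 0) (k : ℕ) : v.rd s i k ≠ 0 := by
  unfold rd
  positivity

lemma termDen_ne_zero {i : ℕ} (hq : v.q s i ≠ 0) (k : ℕ) : v.termDen s i k ≠ 0 :=
  Finset.prod_ne_zero_iff.2 fun l _ => rd_ne_zero hq l

lemma termNum_div_termDen (i k : ℕ) : (v.termNum s i k : ℝ) / v.termDen s i k =
    qCoeff v.N v.M k * ((v.p s i : ℝ) / v.q s i) ^ k := by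
  induction k with
  | zero => simp [termNum, termDen, qCoeff]
  | succ k ih =>
    rw [qCoeff_succ, pow_succ, mul_mul_mul_comm, ← ih, termDen_succ, termNum,
      Finset.prod_range_succ, ← termNum, rn, rd, div_mul_div_comm]
    push_cast
    rw [div_mul_div_comm]

lemma qNum_div_termDen {i : ℕ} (hq : v.q s i ≠ 0) (k : ℕ) :
    (v.qNum s i k : ℝ) / v.termDen s i k =
      ∑ l ∈ Finset.range (k + 1), qCoeff v.N v.M l * ((v.p s i : ℝ) / v.q s i) ^ l := by
  induction k with
  | zero => simp [qNum, termDen, qCoeff]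
  | succ k ih =>
    have h1 : (v.termDen s i k : ℝ) ≠ 0 := by exact_mod_cast termDen_ne_zero hq k
    have h2 : (v.rd s i k : ℝ) ≠ 0 := by exact_mod_cast rd_ne_zero hq k
    rw [Finset.sum_range_succ, ← ih, ← termNum_div_termDen, qNum, termDen_succ]
    push_cast
    rw [add_div, mul_div_mul_right _ _ h2]

lemma sumNum_div_sumDen (ans : ℕ → ℤ) {t : ℕ} (ht : t ≤ v.d + 1)
    (hq : ∀ j ≤ v.d, v.q s j ≠ 0)
    (hz : Set.InjOn (fun j : ℕ => (v.p s j : ℝ) / v.q s j) (Finset.range (v.d + 1))) :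
    v.sumDen s t ≠ 0 ∧ (v.sumNum s ans t : ℝ) / v.sumDen s t =
      ∑ i ∈ Finset.range t, weight v.d (fun j => (v.p s j : ℝ) / v.q s j) i *
        (qPoly v.N v.M ((v.p s i : ℝ) / v.q s i) * ans i) := by
  induction t with
  | zero => simp [sumNum, sumDen]
  | succ t ih =>
    obtain ⟨ih1, ih2⟩ := ih (by omega)
    have hq' := hq t (by omega)
    have hw := weightDen_ne_zero hq hz (i := t) (by omega)
    have ht' := termDen_ne_zero hq' (v.N / 2)
    refine ⟨by rw [sumDen_succ]; positivity, ?_⟩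
    rw [Finset.sum_range_succ, ← ih2, ← weightNum_div_weightDen hq (by omega), qPoly,
      ← qNum_div_termDen hq', sumDen_succ, sumNum, nodeDen]
    have ih1' : (v.sumDen s t : ℝ) ≠ 0 := by exact_mod_cast ih1
    have hw' : (v.weightDen s t (v.d + 1) : ℝ) ≠ 0 := by exact_mod_cast hw
    have ht'' : (v.termDen s t (v.N / 2) : ℝ) ≠ 0 := by exact_mod_cast ht'
    push_cast
    field_simp

end NodeData

variable {N M : ℕ} {ηstar ε₀ δ₀ : ℚ} {s : SqueezingRule} {O : Oracle N M}
  {X : Matrix (Fin N) (Fin M) ℂ}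

/-- The loss at the middle of the nodes, up to the factor `2`. -/
def baseLoss (N : ℕ) (ηstar : ℚ) : ℝ := 1 - ηstar + 1 / (64 * N)

lemma a_div_den (hN : 0 < N) (i : ℕ) :
    ((nodeData N M ηstar ε₀ δ₀).a i : ℝ) / (nodeData N M ηstar ε₀ δ₀).den =
      nodeLoss (baseLoss N ηstar) (degree N ηstar ε₀ δ₀) i := by
  have hN' : (N : ℝ) ≠ 0 := by exact_mod_cast hN.ne'
  have hd : (ηstar.den : ℝ) ≠ 0 := by exact_mod_cast ηstar.den_ne_zero
  have hη : (ηstar : ℝ) = ηstar.num / ηstar.den := Rat.cast_def _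
  rw [NodeData.a, nodeLoss, baseLoss, hη]
  simp only [nodeData]
  push_cast
  rw [mul_div_mul_comm, mul_div_assoc]
  congr 1
  field_simp

lemma den_pos (hN : 0 < N) (hd : 0 < degree N ηstar ε₀ δ₀) :
    0 < (nodeData N M ηstar ε₀ δ₀).den := by
  have := ηstar.den_pos
  simp only [nodeData]
  positivity

lemma tn_div_td (hN : 0 < N) (hd : 0 < degree N ηstar ε₀ δ₀) (i : ℕ) :
    ((nodeData N M ηstar ε₀ δ₀).tn s i : ℝ) / (nodeData N M ηstar ε₀ δ₀).td s =
      s.rate ηstar (1 - nodeLoss (baseLoss N ηstar) (degree N ηstar ε₀ δ₀) i) := by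
  cases s
  · have h : ((nodeData N M ηstar ε₀ δ₀).den : ℝ) ≠ 0 := by exact_mod_cast (den_pos hN hd).ne'
    simp only [NodeData.tn, NodeData.td, SqueezingRule.rate]
    push_cast
    rw [sub_div, div_self h, a_div_den hN]
  · exact (Rat.cast_def ηstar).symm

lemma td_pos (hN : 0 < N) (hd : 0 < degree N ηstar ε₀ δ₀) :
    0 < (nodeData N M ηstar ε₀ δ₀).td s := by
  cases s
  · exact den_pos hN hd
  · exact Int.natCast_pos.2 ηstar.den_pos

lemma q_eq (hN : 0 < N) (hd : 0 < degree N ηstar ε₀ δ₀) (i : ℕ) :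
    ((nodeData N M ηstar ε₀ δ₀).q s i : ℝ) = (nodeData N M ηstar ε₀ δ₀).den ^ 2 *
      ((nodeData N M ηstar ε₀ δ₀).td s * (s.rate ηstar (1 - nodeLoss (baseLoss N ηstar)
        (degree N ηstar ε₀ δ₀) i) * M + N)) := by
  have h : ((nodeData N M ηstar ε₀ δ₀).td s : ℝ) ≠ 0 := by exact_mod_cast (td_pos hN hd).ne'
  rw [← tn_div_td hN hd, NodeData.q]
  push_cast
  change _ = _ * (_ * (_ * ((nodeData N M ηstar ε₀ δ₀).M : ℝ) + ((nodeData N M ηstar ε₀ δ₀).N : ℝ)))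
  field_simp

lemma p_div_q (hN : 0 < N) (hd : 0 < degree N ηstar ε₀ δ₀) (i : ℕ) :
    ((nodeData N M ηstar ε₀ δ₀).p s i : ℝ) / (nodeData N M ηstar ε₀ δ₀).q s i =
      nodeParam s N M ηstar (baseLoss N ηstar) (degree N ηstar ε₀ δ₀) i := by
  have h : ((nodeData N M ηstar ε₀ δ₀).td s : ℝ) ≠ 0 := by exact_mod_cast (td_pos hN hd).ne'
  have e : ((nodeData N M ηstar ε₀ δ₀).p s i : ℝ) = (nodeData N M ηstar ε₀ δ₀).td s *
      ((nodeData N M ηstar ε₀ δ₀).a i ^ 2 * N) := by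
    rw [NodeData.p]
    push_cast
    change _ = _ * (_ * ((nodeData N M ηstar ε₀ δ₀).N : ℝ))
    ring
  rw [q_eq hN hd, e, mul_left_comm (((nodeData N M ηstar ε₀ δ₀).den : ℝ) ^ 2),
    mul_div_mul_left _ _ h, nodeParam, ← a_div_den (M := M) hN,
    div_pow, div_mul_div_comm]

/-- The integer arithmetic is exact: the only rounding is in the reading of the answers, which
`estimate` already contains. -/
lemma output_eq_estimate (hN : 0 < N) (hu : 0 < baseLoss N ηstar)
    (hu3 : 3 * baseLoss N ηstar ≤ 1 / 4) (hη : 3 / 4 ≤ (ηstar : ℝ)) :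
    ((nodeData N M ηstar ε₀ δ₀).sumNum s ((nodeData N M ηstar ε₀ δ₀).answer O X)
        (degree N ηstar ε₀ δ₀ + 1) : ℝ) /
      ((nodeData N M ηstar ε₀ δ₀).sumDen s (degree N ηstar ε₀ δ₀ + 1) *
        2 ^ precision N M ηstar ε₀ δ₀) =
      estimate s ηstar (baseLoss N ηstar) (degree N ηstar ε₀ δ₀) (precision N M ηstar ε₀ δ₀) O X := by
  have hd : 0 < degree N ηstar ε₀ δ₀ := by unfold degree lossCount; omega
  set v := nodeData N M ηstar ε₀ δ₀ with hv
  have hvd : v.d = degree N ηstar ε₀ δ₀ := rfl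
  have hz : (fun j : ℕ => (v.p s j : ℝ) / v.q s j) =
      nodeParam s N M ηstar (baseLoss N ηstar) (degree N ηstar ε₀ δ₀) := funext (p_div_q hN hd)
  have hq : ∀ j ≤ v.d, v.q s j ≠ 0 := by
    intro j hj h
    have h1 := nodeParam_pos (s := s) (M := M) hN hu hu3 hη hd hj
    rw [← p_div_q (M := M) hN hd, ← hv, h] at h1
    simp at h1
  have hinj : Set.InjOn (fun j : ℕ => (v.p s j : ℝ) / v.q s j) (Finset.range (v.d + 1)) := by
    rw [hz]; exact injOn_nodeParam hN hu hu3 hη hd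
  rw [← div_div, ← hvd, (NodeData.sumNum_div_sumDen _ le_rfl hq hinj).2, estimate, hz,
    Finset.sum_div]
  refine Finset.sum_congr rfl fun i _ => ?_
  have h0 : (v.den : ℝ) ≠ 0 := by exact_mod_cast (den_pos hN hd).ne'
  have hrate : ((v.den - v.a i : ℤ) : ℝ) / (v.den : ℝ) =
      1 - nodeLoss (baseLoss N ηstar) v.d i := by
    push_cast
    rw [sub_div, div_self h0, a_div_den hN, hvd]
  have hans : v.answer O X i = readReal (precision N M ηstar ε₀ δ₀)
      (O (1 - nodeLoss (baseLoss N ηstar) v.d i) X) := by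
    rw [← hrate]; rfl
  rw [hans, p_div_q hN hd, mul_div_assoc, mul_div_assoc]
  rfl

end ExactValue

/-! ### Integer roundings of the real parameters -/

section ParameterBounds

variable {N M : ℕ} {ηstar ε₀ δ₀ : ℚ}

lemma ratCast_eq_div_toNat {x : ℚ} (hx : 0 < x) : (x : ℝ) = (x.num.toNat : ℝ) / x.den := by
  have h : ((x.num.toNat : ℤ) : ℝ) = (x.num : ℝ) := by
    rw [Int.toNat_of_nonneg (Rat.num_nonneg.2 hx.le)]
  rw [Int.cast_natCast] at h
  rw [h]
  exact Rat.cast_def x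

lemma num_toNat_pos {x : ℚ} (hx : 0 < x) : 0 < x.num.toNat := by
  have := Rat.num_pos.2 hx
  omega

lemma den_div_num_le {x : ℚ} (hx : 0 < x) : ((x.den / x.num.toNat : ℕ) : ℝ) ≤ (x : ℝ)⁻¹ := by
  rw [ratCast_eq_div_toNat hx, inv_div]
  exact Nat.cast_div_le

lemma inv_le_den_div_num {x : ℚ} (hx : 0 < x) :
    (x : ℝ)⁻¹ ≤ ((x.den / x.num.toNat + 1 : ℕ) : ℝ) := by
  have h : (0 : ℝ) < x.num.toNat := by exact_mod_cast num_toNat_pos hx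
  rw [ratCast_eq_div_toNat hx, inv_div, div_le_iff₀ h]
  have := Nat.lt_div_mul_add (a := x.den) (num_toNat_pos hx)
  have h2 : x.den ≤ (x.den / x.num.toNat + 1) * x.num.toNat := by rw [add_mul]; omega
  exact_mod_cast h2

lemma size_eq (hε : 0 < ε₀) (hδ : 0 < δ₀) : (N : ℝ) * (ε₀ : ℝ)⁻¹ * (δ₀ : ℝ)⁻¹ =
    ((N * ε₀.den * δ₀.den : ℕ) : ℝ) / ((ε₀.num.toNat * δ₀.num.toNat : ℕ) : ℝ) := by
  rw [ratCast_eq_div_toNat hε, ratCast_eq_div_toNat hδ, inv_div, inv_div, mul_assoc,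
    div_mul_div_comm, ← mul_div_assoc]
  push_cast
  ring

lemma sizeCount_le (hε : 0 < ε₀) (hδ : 0 < δ₀) :
    (sizeCount N ε₀ δ₀ : ℝ) ≤ N * (ε₀ : ℝ)⁻¹ * (δ₀ : ℝ)⁻¹ + 1 := by
  rw [size_eq hε hδ, sizeCount, Nat.cast_add, Nat.cast_one]
  gcongr
  exact Nat.cast_div_le

lemma le_sizeCount (hε : 0 < ε₀) (hδ : 0 < δ₀) :
    N * (ε₀ : ℝ)⁻¹ * (δ₀ : ℝ)⁻¹ ≤ sizeCount N ε₀ δ₀ := by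
  have h0 : 0 < ε₀.num.toNat * δ₀.num.toNat := Nat.mul_pos (num_toNat_pos hε) (num_toNat_pos hδ)
  have h : (0 : ℝ) < (ε₀.num.toNat * δ₀.num.toNat : ℕ) := by exact_mod_cast h0
  rw [size_eq hε hδ, div_le_iff₀ h]
  have := Nat.lt_div_mul_add (a := N * ε₀.den * δ₀.den) h0
  have h2 : N * ε₀.den * δ₀.den ≤ sizeCount N ε₀ δ₀ * (ε₀.num.toNat * δ₀.num.toNat) := by
    rw [sizeCount, add_mul]; omega
  exact_mod_cast h2

lemma lossCount_bounds (hη : ηstar ≤ 1) : (1 - (ηstar : ℝ)) * N ≤ lossCount N ηstar ∧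
    (lossCount N ηstar : ℝ) ≤ (1 - ηstar) * N + 1 := by
  have hden : 0 < (ηstar.den : ℤ) := Int.natCast_pos.2 ηstar.den_pos
  have hdenR : (0 : ℝ) < ηstar.den := by exact_mod_cast ηstar.den_pos
  have hnum : ηstar.num ≤ ηstar.den := Rat.num_le_denom_iff.2 hη
  set a : ℤ := (ηstar.den - ηstar.num) * N with ha
  have hnn : 0 ≤ a / ηstar.den :=
    Int.ediv_nonneg (mul_nonneg (by omega) (by positivity)) hden.le
  have hcast : (lossCount N ηstar : ℝ) = ((a / ηstar.den : ℤ) : ℝ) + 1 := by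
    rw [lossCount, ← ha, Nat.cast_add, Nat.cast_one]
    congr 1
    rw [← Int.cast_natCast, Int.toNat_of_nonneg hnn]
  have hval : (1 - (ηstar : ℝ)) * N = (a : ℝ) / ηstar.den := by
    rw [Rat.cast_def, ha]
    push_cast
    field_simp
  have h1 := Int.lt_ediv_add_one_mul_self a hden
  have h2 := Int.ediv_mul_le a hden.ne'
  have h1' : (a : ℝ) < ((a / ηstar.den : ℤ) + 1) * ηstar.den := by exact_mod_cast h1
  have h2' : ((a / ηstar.den : ℤ) : ℝ) * ηstar.den ≤ a := by exact_mod_cast h2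
  rw [hcast, hval]
  constructor
  · rw [div_le_iff₀ hdenR]; exact h1'.le
  · rw [add_le_add_iff_right, le_div_iff₀ hdenR]; exact h2'

end ParameterBounds

/-! ### Polynomial bounds for the input and the registers -/

section PolynomialTime

/-- Inputs for which the running time is bounded. -/
structure Parameters (γ c : ℝ) where
  N : ℕ
  M : ℕ
  ηstar : ℚ
  ε₀ : ℚ
  δ₀ : ℚ
  N_pos : 0 < N
  M_le : (M : ℝ) ≤ c * (N : ℝ) ^ γ
  η_pos : 0 ≤ ηstar
  η_le : ηstar ≤ 1
  ε_pos : 0 < ε₀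
  δ_pos : 0 < δ₀

namespace Parameters

variable {γ c : ℝ}

/-- The quantity in which the running time is polynomial. -/
def base (x : Parameters γ c) : ℝ :=
  (x.N : ℝ) + (x.ε₀ : ℝ)⁻¹ + (x.δ₀ : ℝ)⁻¹ + paramBits x.ηstar x.ε₀ x.δ₀

lemma bits_pos {a : ℤ} (ha : a ≠ 0) : 0 < bits a := by
  rw [bits, Nat.size_pos]; omega

lemma two_le_base (x : Parameters γ c) : 2 ≤ x.base := by
  have h1 : (1 : ℝ) ≤ x.N := by exact_mod_cast x.N_pos
  have h2 : (0 : ℝ) ≤ (x.ε₀ : ℝ)⁻¹ := by have := x.ε_pos; positivity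
  have h3 : (0 : ℝ) ≤ (x.δ₀ : ℝ)⁻¹ := by have := x.δ_pos; positivity
  have h4 : 1 ≤ paramBits x.ηstar x.ε₀ x.δ₀ := by
    have : 0 < bits x.ηstar.den := bits_pos (by simp)
    unfold paramBits; omega
  have h5 : (1 : ℝ) ≤ paramBits x.ηstar x.ε₀ x.δ₀ := by exact_mod_cast h4
  unfold base
  linarith

/-- A bound for the numbers of bits of the input and for the loop counts. -/
def inputBound (x : Parameters γ c) : ℕ :=
  x.N + x.M + sizeCount x.N x.ε₀ x.δ₀ + degree x.N x.ηstar x.ε₀ x.δ₀ + 1 +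
    precision x.N x.M x.ηstar x.ε₀ x.δ₀ + paramBits x.ηstar x.ε₀ x.δ₀ +
    bits (nodeData x.N x.M x.ηstar x.ε₀ x.δ₀).lossNum + bits (nodeData x.N x.M x.ηstar x.ε₀ x.δ₀).den

lemma polyBounded_of_le {f : Parameters γ c → ℕ} (h : ∀ x, (f x : ℝ) ≤ x.base) :
    PolyBounded base f := ⟨1, fun x => by rw [pow_one]; exact h x⟩

/-- Loop counts must be polynomial in value and not only in length: `M` is so by the dilute regime,
`sizeCount` and `precision` through `1/ε₀` and `1/δ₀`, and `lossCount` because `0 ≤ η*`. Node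
numerators and denominators enter only through their lengths. -/
lemma polyBounded_inputBound : PolyBounded (base (γ := γ) (c := c)) inputBound := by
  have hb := two_le_base (γ := γ) (c := c)
  have hc := PolyBounded.const hb
  have nnε : ∀ x : Parameters γ c, (0 : ℝ) ≤ (x.ε₀ : ℝ)⁻¹ := fun x => by
    have := x.ε_pos; positivity
  have nnδ : ∀ x : Parameters γ c, (0 : ℝ) ≤ (x.δ₀ : ℝ)⁻¹ := fun x => by
    have := x.δ_pos; positivity
  have nnp : ∀ x : Parameters γ c, (0 : ℝ) ≤ paramBits x.ηstar x.ε₀ x.δ₀ := fun x => by positivity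
  have nnN : ∀ x : Parameters γ c, (0 : ℝ) ≤ x.N := fun x => by positivity
  have hN : PolyBounded (base (γ := γ) (c := c)) fun x => x.N := polyBounded_of_le fun x => by
    unfold base; linarith [nnε x, nnδ x, nnp x]
  have hp : PolyBounded (base (γ := γ) (c := c)) fun x => paramBits x.ηstar x.ε₀ x.δ₀ :=
    polyBounded_of_le fun x => by unfold base; linarith [nnε x, nnδ x, nnN x]
  have hε : PolyBounded (base (γ := γ) (c := c)) fun x => x.ε₀.den / x.ε₀.num.toNat :=
    polyBounded_of_le fun x => (den_div_num_le x.ε_pos).trans (by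
      unfold base; linarith [nnp x, nnδ x, nnN x])
  have hδ : PolyBounded (base (γ := γ) (c := c)) fun x => x.δ₀.den / x.δ₀.num.toNat :=
    polyBounded_of_le fun x => (den_div_num_le x.δ_pos).trans (by
      unfold base; linarith [nnp x, nnε x, nnN x])
  have hM : PolyBounded (base (γ := γ) (c := c)) fun x => x.M := by
    obtain ⟨k, hk⟩ := exists_nat_ge |c|
    obtain ⟨l, hl⟩ := exists_nat_ge γ
    refine ((hc k).mul hb (hN.pow hb l)).mono fun x => ?_
    have h1 : (1 : ℝ) ≤ x.N := by exact_mod_cast x.N_pos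
    have h2 : (x.M : ℝ) ≤ k * (x.N : ℝ) ^ l := by
      refine x.M_le.trans ?_
      rw [← Real.rpow_natCast]
      have h3 : (x.N : ℝ) ^ γ ≤ (x.N : ℝ) ^ (l : ℝ) := Real.rpow_le_rpow_of_exponent_le h1 hl
      have h4 : c ≤ k := (le_abs_self c).trans hk
      have h5 : (0 : ℝ) ≤ (x.N : ℝ) ^ γ := by positivity
      gcongr
    exact_mod_cast h2
  have hcnt : PolyBounded (base (γ := γ) (c := c)) fun x => sizeCount x.N x.ε₀ x.δ₀ := by
    have := (((hN.mul hb (hε.add hb (hc 1))).mul hb (hδ.add hb (hc 1))).add hb (hc 1))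
    refine this.mono fun x => ?_
    have h1 := sizeCount_le (N := x.N) x.ε_pos x.δ_pos
    have h2 := inv_le_den_div_num x.ε_pos
    have h3 := inv_le_den_div_num x.δ_pos
    have h4 : (sizeCount x.N x.ε₀ x.δ₀ : ℝ) ≤ x.N * ((x.ε₀.den / x.ε₀.num.toNat + 1 : ℕ) : ℝ) *
        ((x.δ₀.den / x.δ₀.num.toNat + 1 : ℕ) : ℝ) + 1 := by
      refine h1.trans ?_
      have := nnε x
      have := nnδ x
      gcongr
    exact_mod_cast h4
  have hloss : PolyBounded (base (γ := γ) (c := c)) fun x => lossCount x.N x.ηstar := by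
    refine (hN.add hb (hc 1)).mono fun x => ?_
    have h1 := (lossCount_bounds (N := x.N) x.η_le).2
    have h2 : (0 : ℝ) ≤ x.ηstar := by exact_mod_cast x.η_pos
    have h3 := nnN x
    have h4 : (lossCount x.N x.ηstar : ℝ) ≤ x.N + 1 := h1.trans (by nlinarith)
    exact_mod_cast h4
  have hd : PolyBounded (base (γ := γ) (c := c)) fun x => degree x.N x.ηstar x.ε₀ x.δ₀ := by
    refine (hcnt.add hb ((hc 32).mul hb hloss)).mono fun x => ?_
    unfold degree
    have : Nat.clog 3 (sizeCount x.N x.ε₀ x.δ₀) ≤ sizeCount x.N x.ε₀ x.δ₀ :=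
      Nat.clog_le_of_le_pow (Nat.lt_pow_self (by norm_num)).le
    omega
  have hprec : PolyBounded (base (γ := γ) (c := c)) fun x =>
      precision x.N x.M x.ηstar x.ε₀ x.δ₀ :=
    (((hc 4).mul hb hd).add hb ((hδ.add hb (hc 1)).add hb (hε.add hb (hc 1)))).add hb
      (((((hc 2).mul hb hN).add hb hM).mul hb hN).add hb (hc 4))
  have hlossNum : PolyBounded (base (γ := γ) (c := c)) fun x =>
      bits (nodeData x.N x.M x.ηstar x.ε₀ x.δ₀).lossNum := by
    refine ((((hc 7).add hb hN).add hb ((hp.add hb hp).add hb (hc 1))).add hb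
      (hp.add hb (hc 1))).mono fun x => ?_
    have h1 := bits_add_le (64 * x.N * (x.ηstar.den - x.ηstar.num)) x.ηstar.den
    have h2 := bits_mul_le (64 * x.N) (x.ηstar.den - x.ηstar.num)
    have h3 := bits_mul_le 64 x.N
    have h4 := bits_natCast_le x.N
    have h5 := bits_sub_le x.ηstar.den x.ηstar.num
    have h6 : bits 64 = 7 := by decide
    simp only [nodeData, paramBits]
    omega
  have hden : PolyBounded (base (γ := γ) (c := c)) fun x =>
      bits (nodeData x.N x.M x.ηstar x.ε₀ x.δ₀).den := by
    refine ((((hc 7).add hb hN).add hb hp).add hb hd).mono fun x => ?_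
    have h1 := bits_mul_le (64 * x.N * x.ηstar.den) (degree x.N x.ηstar x.ε₀ x.δ₀)
    have h2 := bits_mul_le (64 * x.N) x.ηstar.den
    have h3 := bits_mul_le 64 x.N
    have h4 := bits_natCast_le x.N
    have h5 := bits_natCast_le (degree x.N x.ηstar x.ε₀ x.δ₀)
    have h6 : bits 64 = 7 := by decide
    simp only [nodeData, paramBits]
    omega
  exact (((((((hN.add hb hM).add hb hcnt).add hb hd).add hb (hc 1)).add hb hprec).add hb hp).add hb
    hlossNum).add hb hden

lemma bounded_inputBound (x : Parameters γ c) {L : ℕ} (hL : x.inputBound ≤ L) :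
    (nodeData x.N x.M x.ηstar x.ε₀ x.δ₀).Bounded L := by
  unfold inputBound paramBits at hL
  refine ⟨?_, ?_, ?_, ?_, ?_, ?_, ?_, ?_⟩
  · change degree x.N x.ηstar x.ε₀ x.δ₀ + 1 ≤ L; omega
  · change x.N ≤ L; omega
  · change x.M ≤ L; omega
  · change precision x.N x.M x.ηstar x.ε₀ x.δ₀ ≤ L; omega
  · change bits x.ηstar.num ≤ L; omega
  · change bits x.ηstar.den ≤ L; omega
  · omega
  · omega

lemma polyBounded_regBits (s : SqueezingRule) {L : Parameters γ c → ℕ}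
    (hL : PolyBounded base L) : PolyBounded base fun x => NodeData.regBits s (L x) := by
  have hb := two_le_base (γ := γ) (c := c)
  have hc := PolyBounded.const hb
  have hf : PolyBounded base fun x => NodeData.factorBits s (L x) :=
    (hc _).mul hb (hL.add hb (hc 1))
  have hp : PolyBounded base fun x => NodeData.prodBits s (L x) := (hc 1).add hb (hL.mul hb hf)
  have hq : PolyBounded base fun x => NodeData.qBits s (L x) :=
    (hc 1).add hb (hL.mul hb ((hf.add hb hp).add hb (hc 1)))
  have hd : PolyBounded base fun x => NodeData.sumDenBits s (L x) :=
    (hc 1).add hb (hL.mul hb (hp.add hb hp))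
  have hn : PolyBounded base fun x => NodeData.sumNumBits s (L x) :=
    hL.mul hb (((hp.add hb hp).add hb (((hp.add hb hq).add hb (((hc 2).mul hb hL).add hb
      (hc 1))).add hb hd)).add hb (hc 1))
  exact (((hp.add hb hq).add hb hd).add hb hn).add hb (((hc 3).mul hb hL).add hb (hc 10))

lemma bits_initial_le (x : Parameters γ c) (r : ℕ) :
    bits ((initial x.N x.M x.ηstar x.ε₀ x.δ₀).reg r) ≤
      x.N + x.M + paramBits x.ηstar x.ε₀ x.δ₀ := by
  have h1 := bits_natCast_le x.N
  have h2 := bits_natCast_le x.M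
  simp only [initial, paramBits]
  split <;> first | omega | simp [bits]

end Parameters

end PolynomialTime

/-! ### Matching the error budget to the stated bounds -/

section ErrorBounds

variable {N M : ℕ} {ηstar ε₀ δ₀ : ℚ}

lemma errorUnit_le_two_pow (hNe : Even N) (hM : 0 < M) (hMe : Even M) :
    errorUnit N M ≤ 2 ^ ((2 * N + M) * N) := by
  rw [errorUnit_eq hNe hMe hM]
  have h1 : hafMoment M (N / 2) ≤ ∏ _k ∈ Finset.range (N / 2), 2 ^ (2 * N + M) := by
    refine Finset.prod_le_prod' fun k hk => ?_
    have hk' := Finset.mem_range.1 hk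
    have h2 : 2 * k + 1 < 2 ^ (2 * k + 1) := Nat.lt_two_pow_self
    have h3 : M + 2 * k < 2 ^ (M + 2 * k) := Nat.lt_two_pow_self
    calc (2 * k + 1) * (M + 2 * k) ≤ 2 ^ (2 * k + 1) * 2 ^ (M + 2 * k) :=
          Nat.mul_le_mul h2.le h3.le
      _ = 2 ^ ((2 * k + 1) + (M + 2 * k)) := (pow_add _ _ _).symm
      _ ≤ 2 ^ (2 * N + M) := Nat.pow_le_pow_right (by norm_num) (by omega)
  rw [Finset.prod_const, Finset.card_range, ← pow_mul] at h1
  have h2 : 2 ^ ((2 * N + M) * (N / 2)) ≤ 2 ^ ((2 * N + M) * N) :=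
    Nat.pow_le_pow_right (by norm_num) (Nat.mul_le_mul_left _ (Nat.div_le_self _ _))
  exact_mod_cast h1.trans h2

lemma exp_mul_natCast_le {a b : ℕ} (h : (2.7182818286 : ℝ) ^ a ≤ 2 ^ b) (n : ℕ) :
    Real.exp (a * n) ≤ 2 ^ (b * n) := by
  have h1 : Real.exp (a * n) = (Real.exp 1 ^ a) ^ n := by
    rw [← pow_mul, Real.exp_one_pow]; push_cast; rfl
  have h2 : Real.exp 1 ^ a ≤ 2 ^ b := by
    refine le_trans ?_ h
    have := Real.exp_one_lt_d9
    have := Real.exp_pos 1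
    gcongr
  rw [h1, pow_mul]
  gcongr

lemma one_le_mul_two_pow {x : ℚ} (hx : 0 < x) {n : ℕ} (hn : x.den / x.num.toNat + 1 ≤ n) :
    1 ≤ (x : ℝ) * 2 ^ n := by
  have h1 := inv_le_den_div_num hx
  have h2 : ((x.den / x.num.toNat + 1 : ℕ) : ℝ) ≤ 2 ^ n := by
    exact_mod_cast hn.trans Nat.lt_two_pow_self.le
  have hx' : (0 : ℝ) < x := by exact_mod_cast hx
  rw [mul_comm]
  exact (inv_le_iff_one_le_mul₀ hx').1 (h1.trans h2)

lemma three_pow_clog_bounds {n : ℕ} (hn : 0 < n) :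
    n ≤ 3 ^ Nat.clog 3 n ∧ 3 ^ Nat.clog 3 n ≤ 3 * n := by
  refine ⟨Nat.le_pow_clog (by norm_num) n, ?_⟩
  rcases Nat.lt_or_ge 1 n with h | h
  · have h1 := Nat.pow_pred_clog_lt_self (b := 3) (by norm_num) h
    have h2 := Nat.clog_pos (b := 3) (by norm_num) h
    rw [show Nat.clog 3 n = (Nat.clog 3 n).pred + 1 by
      rw [← Nat.succ_eq_add_one, Nat.succ_pred h2.ne'], pow_succ]
    simp only [Nat.pred_eq_sub_one] at h1 ⊢
    omega
  · have : n = 1 := by omega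
    subst this; simp

lemma kStar_bounds {η : ℝ} (hη : 3 / 4 ≤ η) (hη1 : η ≤ 1) :
    (1 - η) * N ≤ kStar N η ∧ kStar N η ≤ 4 / 3 * ((1 - η) * N) := by
  have h0 : 0 < η := by linarith
  have hN : (0 : ℝ) ≤ N := by positivity
  have h1 : 1 - η ≤ 1 / η - 1 := by
    rw [le_sub_iff_add_le, le_div_iff₀ h0]; nlinarith
  have h2 : 1 / η - 1 ≤ 4 / 3 * (1 - η) := by
    rw [sub_le_iff_le_add, div_le_iff₀ h0]; nlinarith
  unfold kStar
  constructor
  · gcongr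
  · rw [← mul_assoc]; gcongr

lemma le_rate_of_loss_le (hN : 1 ≤ N) {η : ℝ} (h : 1 - η ≤ 1 / (12 * Real.sqrt N)) :
    3 / 4 ≤ η := by
  have h1 : (1 : ℝ) ≤ Real.sqrt N := by
    rw [Real.one_le_sqrt]; exact_mod_cast hN
  have h2 : 1 / (12 * Real.sqrt N) ≤ 1 / 12 := by
    rw [div_le_div_iff₀ (by positivity) (by norm_num)]; linarith
  linarith

lemma three_mul_baseLoss_le (hN : 2 ≤ N) (h : 1 - (ηstar : ℝ) ≤ 1 / (12 * Real.sqrt N)) :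
    3 * baseLoss N ηstar ≤ 1 / 4 := by
  have hN' : (2 : ℝ) ≤ N := by exact_mod_cast hN
  -- The bound needs `N ≥ 2`: for `N = 1` the maximal permitted loss alone would already exhaust
  -- `1/4`. Numerically, `3 (0.06 + 0.02) = 0.24`.
  have h1 : (1.4 : ℝ) ≤ Real.sqrt N := Real.le_sqrt_of_sq_le (by norm_num; linarith)
  have h2 : 1 / (12 * Real.sqrt N) ≤ 0.06 :=
    le_trans (b := 1 / (12 * 1.4)) (by gcongr) (by norm_num)
  have h3 : 1 / (64 * (N : ℝ)) ≤ 0.02 := le_trans (b := 1 / (64 * 2)) (by gcongr) (by norm_num)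
  unfold baseLoss
  norm_num1 at h2 h3 ⊢
  linarith

/-- The summand `1 / (64 N)` keeps the nodes positive even for `η* = 1`, where they would otherwise
all collapse to `0`; it shifts `u₀ N` by only `1/64`. -/
lemma baseLoss_pos (hN : 0 < N) (hη : ηstar ≤ 1) : 0 < baseLoss N ηstar := by
  have h1 : (ηstar : ℝ) ≤ 1 := by exact_mod_cast hη
  have h2 : (0 : ℝ) < N := by exact_mod_cast hN
  unfold baseLoss
  have : 0 < 1 / (64 * (N : ℝ)) := by positivity
  linarith

lemma lossCount_pos : 0 < lossCount N ηstar := Nat.succ_pos _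

lemma exp_four_mul_le (n : ℕ) : Real.exp (4 * n) ≤ 2 ^ (6 * n) :=
  exp_mul_natCast_le (a := 4) (b := 6) (by norm_num) n

lemma errorUnit_mul_exp_le (hNe : Even N) (hM : 0 < M) (hMe : Even M) (hδ₀ : 0 < δ₀) :
    5 * errorUnit N M * Real.exp (4 * lossCount N ηstar) ≤ δ₀ * 2 ^ precision N M ηstar ε₀ δ₀ := by
  have h1 := one_le_mul_two_pow hδ₀ (n := (δ₀.den / δ₀.num.toNat + 1) +
      (ε₀.den / ε₀.num.toNat + 1)) (Nat.le_add_right _ _)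
  have h2 := errorUnit_le_two_pow hNe hM hMe
  have h3 : Real.exp (4 * lossCount N ηstar) ≤ 2 ^ (4 * degree N ηstar ε₀ δ₀) :=
    (exp_four_mul_le _).trans (pow_le_pow_right₀ (by norm_num) (by unfold degree; omega))
  have h4 : 5 * errorUnit N M ≤ 2 ^ 4 * 2 ^ ((2 * N + M) * N) := by
    have : (0 : ℝ) < 2 ^ ((2 * N + M) * N) := by positivity
    linarith
  calc 5 * errorUnit N M * Real.exp (4 * lossCount N ηstar)
      ≤ 2 ^ 4 * 2 ^ ((2 * N + M) * N) * 2 ^ (4 * degree N ηstar ε₀ δ₀) := by gcongr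
    _ ≤ 2 ^ 4 * 2 ^ ((2 * N + M) * N) * 2 ^ (4 * degree N ηstar ε₀ δ₀) *
        (δ₀ * 2 ^ ((δ₀.den / δ₀.num.toNat + 1) + (ε₀.den / ε₀.num.toNat + 1))) :=
        le_mul_of_one_le_right (by positivity) h1
    _ = _ := by simp only [precision, pow_add]; ring

lemma exp_degree_mul_exp_le (hε₀ : 0 < ε₀) :
    4 * (Real.exp (2 * degree N ηstar ε₀ δ₀) * Real.exp (4 * lossCount N ηstar)) ≤
      ε₀ * 2 ^ precision N M ηstar ε₀ δ₀ := by
  have h1 := one_le_mul_two_pow hε₀ (n := (δ₀.den / δ₀.num.toNat + 1) +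
      (ε₀.den / ε₀.num.toNat + 1)) (Nat.le_add_left _ _)
  have h2 : Real.exp (2 * degree N ηstar ε₀ δ₀) ≤ 2 ^ (3 * degree N ηstar ε₀ δ₀) :=
    exp_mul_natCast_le (a := 2) (b := 3) (by norm_num) _
  have h3 : Real.exp (4 * lossCount N ηstar) ≤ 2 ^ degree N ηstar ε₀ δ₀ :=
    (exp_four_mul_le _).trans (pow_le_pow_right₀ (by norm_num) (by unfold degree; omega))
  have h4 : (1 : ℝ) ≤ 2 ^ ((2 * N + M) * N) := one_le_pow₀ (by norm_num)
  have h5 : 4 * (Real.exp (2 * degree N ηstar ε₀ δ₀) * Real.exp (4 * lossCount N ηstar)) ≤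
      2 ^ 4 * (2 ^ (3 * degree N ηstar ε₀ δ₀) * 2 ^ degree N ηstar ε₀ δ₀) :=
    mul_le_mul (by norm_num) (mul_le_mul h2 h3 (by positivity) (by positivity)) (by positivity)
      (by positivity)
  calc _ ≤ 2 ^ 4 * (2 ^ (3 * degree N ηstar ε₀ δ₀) * 2 ^ degree N ηstar ε₀ δ₀) := h5
    _ ≤ 2 ^ 4 * (2 ^ (3 * degree N ηstar ε₀ δ₀) * 2 ^ degree N ηstar ε₀ δ₀) *
        (2 ^ ((2 * N + M) * N) * (ε₀ *
          2 ^ ((δ₀.den / δ₀.num.toNat + 1) + (ε₀.den / ε₀.num.toNat + 1)))) :=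
        le_mul_of_one_le_right (by positivity) (one_le_mul_of_one_le_of_one_le h4 h1)
    _ = _ := by
        rw [precision, show 4 * degree N ηstar ε₀ δ₀ = 3 * degree N ηstar ε₀ δ₀ +
          degree N ηstar ε₀ δ₀ by ring]
        simp only [pow_add]; ring

lemma three_pow_clog_le (hε₀ : 0 < ε₀) (hδ₀ : 0 < δ₀)
    (hU : 3 ≤ N * (ε₀ : ℝ)⁻¹ * (δ₀ : ℝ)⁻¹) :
    (3 : ℝ) ^ Nat.clog 3 (sizeCount N ε₀ δ₀) ≤ 4 * (N * (ε₀ : ℝ)⁻¹ * (δ₀ : ℝ)⁻¹) := by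
  have h1 : ((3 ^ Nat.clog 3 (sizeCount N ε₀ δ₀) : ℕ) : ℝ) ≤ (3 * sizeCount N ε₀ δ₀ : ℕ) := by
    exact_mod_cast (three_pow_clog_bounds (n := sizeCount N ε₀ δ₀) (Nat.succ_pos _)).2
  have h2 := sizeCount_le (N := N) hε₀ hδ₀
  push_cast at h1
  linarith

/-- The exponent `68` is `2 · 32` from the weights plus `4` from `Q`, and `lossCount` exceeds `(1 -
η*) N` by at most one. The logarithmic part of the degree costs `e^(2 d₀) ≤ (3^d₀)²`. -/
lemma exp_degree_le (hη : ηstar ≤ 1) (hε₀ : 0 < ε₀) (hδ₀ : 0 < δ₀)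
    (hU : 3 ≤ N * (ε₀ : ℝ)⁻¹ * (δ₀ : ℝ)⁻¹) :
    Real.exp (2 * degree N ηstar ε₀ δ₀) * Real.exp (4 * lossCount N ηstar) ≤
      (4 * (N * (ε₀ : ℝ)⁻¹ * (δ₀ : ℝ)⁻¹)) ^ 2 *
        (Real.exp 68 * Real.exp (68 * ((1 - ηstar) * N))) := by
  have hp := three_pow_clog_le hε₀ hδ₀ hU
  have hg := (lossCount_bounds (N := N) hη).2
  set d₀ := Nat.clog 3 (sizeCount N ε₀ δ₀) with hd₀
  have h1 : Real.exp (2 * d₀) ≤ (4 * (N * (ε₀ : ℝ)⁻¹ * (δ₀ : ℝ)⁻¹)) ^ 2 := by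
    have e : Real.exp (2 * d₀) = (Real.exp 1 ^ d₀) ^ 2 := by
      rw [← pow_mul, Real.exp_one_pow]; push_cast; rw [mul_comm]
    have h := Real.exp_one_lt_d9
    rw [e]
    have h3 : Real.exp 1 ^ d₀ ≤ 3 ^ d₀ :=
      pow_le_pow_left₀ (Real.exp_pos 1).le (by linarith) _
    exact pow_le_pow_left₀ (by positivity) (h3.trans hp) _
  have e : Real.exp (2 * degree N ηstar ε₀ δ₀) * Real.exp (4 * lossCount N ηstar) =
      Real.exp (2 * d₀) * Real.exp (68 * lossCount N ηstar) := by
    rw [← Real.exp_add, ← Real.exp_add, degree, ← hd₀]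
    push_cast
    ring_nf
  rw [e, ← Real.exp_add 68]
  exact mul_le_mul h1 (Real.exp_le_exp.2 (by linarith)) (Real.exp_pos _).le (by positivity)

/-- The logarithmic part is at most `logSize + 2`, since `e^d₀ ≤ 3^d₀ ≤ 4 N / (ε₀ δ₀)` and `4 ≤ e²`.
The remaining constants, at most `35`, are absorbed by `35 · logSize`. -/
lemma degree_add_one_le (hη : ηstar ≤ 1) (hε₀ : 0 < ε₀) (hδ₀ : 0 < δ₀)
    (hN : 0 < N) (hlog : Real.exp 1 ≤ logSize N ε₀ δ₀) :
    (degree N ηstar ε₀ δ₀ : ℝ) + 1 ≤ 36 * ((1 - ηstar) * N + logSize N ε₀ δ₀) := by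
  have hg := (lossCount_bounds (N := N) hη).2
  have hN' : (0 : ℝ) < N := by exact_mod_cast hN
  have hε₀R : (0 : ℝ) < ε₀ := by exact_mod_cast hε₀
  have hδ₀R : (0 : ℝ) < δ₀ := by exact_mod_cast hδ₀
  have hη1 : (ηstar : ℝ) ≤ 1 := by exact_mod_cast hη
  have hUexp : N * (ε₀ : ℝ)⁻¹ * (δ₀ : ℝ)⁻¹ = Real.exp (logSize N ε₀ δ₀) :=
    (Real.exp_log (by positivity)).symm
  have he : (2.7 : ℝ) < Real.exp 1 := lt_trans (by norm_num) Real.exp_one_gt_d9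
  have he' := Real.exp_one_lt_d9
  have hU3 : 3 ≤ N * (ε₀ : ℝ)⁻¹ * (δ₀ : ℝ)⁻¹ := by
    have := Real.add_one_le_exp (logSize N ε₀ δ₀)
    linarith
  have hp := three_pow_clog_le hε₀ hδ₀ hU3
  have h1 : (Nat.clog 3 (sizeCount N ε₀ δ₀) : ℝ) ≤ logSize N ε₀ δ₀ + 2 := by
    refine Real.exp_le_exp.1 ?_
    have e2 : (4 : ℝ) ≤ Real.exp 2 := by
      have : Real.exp 2 = Real.exp 1 ^ 2 := by rw [Real.exp_one_pow]; norm_num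
      rw [this]; nlinarith
    rw [Real.exp_add, ← hUexp, ← Real.exp_one_pow]
    refine (pow_le_pow_left₀ (Real.exp_pos 1).le (by linarith) _).trans (hp.trans ?_)
    nlinarith
  have h2 : 0 ≤ (1 - (ηstar : ℝ)) * N := mul_nonneg (by linarith) hN'.le
  rw [degree]
  push_cast
  linarith

theorem measure_estimate_error_le_of_bounds (s : SqueezingRule) (hN : 0 < N) (hNe : Even N)
    (hM : 0 < M) (hMe : Even M) (O : Oracle N M) (hη1 : ηstar ≤ 1)
    (hloss : 1 - (ηstar : ℝ) ≤ 1 / (12 * Real.sqrt N)) (hε₀ : 0 < ε₀) (hδ₀ : 0 < δ₀)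
    (hlog : Real.exp 1 ≤ logSize N ε₀ δ₀) {ε δ : ℝ} (hε : 0 < ε) (hδ : 0 < δ)
    (hεle : ε ≤ Real.exp (-68) / 64 * ((ε₀ : ℝ) ^ 3 * (δ₀ : ℝ) ^ 2 * ((N : ℝ) ^ 3)⁻¹ *
      Real.exp (-(68 * kStar N ηstar))))
    (hδle : δ ≤ Real.exp (-68) / 64 * ((δ₀ : ℝ) / (kStar N ηstar + logSize N ε₀ δ₀)))
    (hO : SolvesGHED s ηstar ε δ O) :
    gaussianLaw N M {X | ¬ ‖((estimate s ηstar (baseLoss N ηstar) (degree N ηstar ε₀ δ₀)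
      (precision N M ηstar ε₀ δ₀) O (Matrix.of X) : ℝ) : ℂ) - idealProb (Matrix.of X)‖ ≤
      ε₀ * errorUnit N M} ≤ ENNReal.ofReal δ₀ := by
  have hN2 : 2 ≤ N := by
    obtain ⟨k, hk⟩ := hNe; omega
  have hNR : (2 : ℝ) ≤ N := by exact_mod_cast hN2
  have hη := le_rate_of_loss_le (by omega) hloss
  have hη1R : (ηstar : ℝ) ≤ 1 := by exact_mod_cast hη1
  have hε₀R : (0 : ℝ) < ε₀ := by exact_mod_cast hε₀
  have hδ₀R : (0 : ℝ) < δ₀ := by exact_mod_cast hδ₀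
  have hk1 := (kStar_bounds (N := N) hη hη1R).1
  have hg1 := (lossCount_bounds (N := N) hη1).1
  have hgR : (1 : ℝ) ≤ lossCount N ηstar := by exact_mod_cast lossCount_pos
  have hUexp : N * (ε₀ : ℝ)⁻¹ * (δ₀ : ℝ)⁻¹ = Real.exp (logSize N ε₀ δ₀) :=
    (Real.exp_log (by positivity)).symm
  have he : (2.7 : ℝ) < Real.exp 1 := lt_trans (by norm_num) Real.exp_one_gt_d9
  have hU3 : 3 ≤ N * (ε₀ : ℝ)⁻¹ * (δ₀ : ℝ)⁻¹ := by
    have := Real.add_one_le_exp (logSize N ε₀ δ₀)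
    linarith
  have hk0 : 0 ≤ (1 - (ηstar : ℝ)) * N := mul_nonneg (by linarith) (by linarith)
  have hexp := exp_degree_le (N := N) hη1 hε₀ hδ₀ hU3
  have hdeg := degree_add_one_le hη1 hε₀ hδ₀ hN hlog
  have hUc := le_sizeCount (N := N) hε₀ hδ₀
  have hcp : (sizeCount N ε₀ δ₀ : ℝ) ≤ 3 ^ Nat.clog 3 (sizeCount N ε₀ δ₀) := by
    exact_mod_cast (three_pow_clog_bounds (n := sizeCount N ε₀ δ₀) (Nat.succ_pos _)).1
  have e1 : Real.exp 68 * Real.exp (-68) = 1 := by rw [← Real.exp_add]; simp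
  generalize kStar N ηstar = k at *
  generalize logSize N ε₀ δ₀ = ℓ at *
  have e2 : Real.exp (68 * k) * Real.exp (-(68 * k)) = 1 := by rw [← Real.exp_add]; simp
  have hεδ : ε * δ₀ ≤ 1 := by
    have h1 : Real.exp (-68) ≤ 1 := Real.exp_le_one_iff.2 (by norm_num)
    have h2 : Real.exp (-(68 * k)) ≤ 1 := Real.exp_le_one_iff.2 (by linarith)
    have h3 : (N * (ε₀ : ℝ)⁻¹ * (δ₀ : ℝ)⁻¹)⁻¹ ≤ 1 := inv_le_one_of_one_le₀ (by linarith)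
    calc ε * δ₀ ≤ Real.exp (-68) / 64 * ((ε₀ : ℝ) ^ 3 * (δ₀ : ℝ) ^ 2 * ((N : ℝ) ^ 3)⁻¹ *
          Real.exp (-(68 * k))) * δ₀ := mul_le_mul_of_nonneg_right hεle hδ₀R.le
      _ = Real.exp (-68) / 64 * ((N * (ε₀ : ℝ)⁻¹ * (δ₀ : ℝ)⁻¹)⁻¹ ^ 3 * Real.exp (-(68 * k))) := by
          field_simp
      _ ≤ 1 / 64 * (1 ^ 3 * 1) := by gcongr
      _ ≤ 1 := by norm_num
  have hεle' : Real.exp (2 * degree N ηstar ε₀ δ₀) * Real.exp (4 * lossCount N ηstar) * ε ≤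
      ε₀ / 4 := by
    have h1 : Real.exp (68 * ((1 - ηstar) * N)) ≤ Real.exp (68 * k) :=
      Real.exp_le_exp.2 (by linarith)
    have h2 : Real.exp (2 * degree N ηstar ε₀ δ₀) * Real.exp (4 * lossCount N ηstar) ≤
        (4 * (N * (ε₀ : ℝ)⁻¹ * (δ₀ : ℝ)⁻¹)) ^ 2 * (Real.exp 68 * Real.exp (68 * k)) :=
      hexp.trans (by gcongr)
    -- The product leaves `ε₀ / (4N)`: the constant `64` is `4² · 4`, and the exponentials cancel.
    calc _ ≤ (4 * (N * (ε₀ : ℝ)⁻¹ * (δ₀ : ℝ)⁻¹)) ^ 2 * (Real.exp 68 * Real.exp (68 * k)) *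
          (Real.exp (-68) / 64 * ((ε₀ : ℝ) ^ 3 * (δ₀ : ℝ) ^ 2 * ((N : ℝ) ^ 3)⁻¹ *
            Real.exp (-(68 * k)))) := mul_le_mul h2 hεle hε.le (by positivity)
      _ = (Real.exp 68 * Real.exp (-68)) * (Real.exp (68 * k) * Real.exp (-(68 * k))) *
          ((ε₀ : ℝ) / 4 * (N : ℝ)⁻¹) := by
          generalize Real.exp 68 = a; generalize Real.exp (-68) = b
          generalize Real.exp (68 * k) = a'; generalize Real.exp (-(68 * k)) = b'
          field_simp
          ring
      _ ≤ ε₀ / 4 := by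
        rw [e1, e2, one_mul, one_mul]
        exact mul_le_of_le_one_right (by positivity) (inv_le_one_of_one_le₀ (by linarith))
  have hδle' : ((degree N ηstar ε₀ δ₀ : ℝ) + 1) * δ ≤ δ₀ / 4 := by
    have hkl : 0 < k + ℓ := by linarith
    -- The constant `e^(-68) / 64` is dictated by the bound on `ε`; for the number of nodes it
    -- leaves ample room.
    have h2 : (degree N ηstar ε₀ δ₀ : ℝ) + 1 ≤ 16 * (k + ℓ) * Real.exp 68 := by
      have h3 : (69 : ℝ) ≤ Real.exp 68 := by
        have := Real.add_one_le_exp (68 : ℝ); linarith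
      nlinarith
    calc _ ≤ (16 * (k + ℓ) * Real.exp 68) * (Real.exp (-68) / 64 * ((δ₀ : ℝ) / (k + ℓ))) :=
          mul_le_mul h2 hδle hδ.le (by positivity)
      _ = (Real.exp 68 * Real.exp (-68)) * (δ₀ / 4) := by
          generalize Real.exp 68 = a; generalize Real.exp (-68) = b
          field_simp
          ring
      _ ≤ δ₀ / 4 := by rw [e1, one_mul]
  refine measure_estimate_error_le s (d₀ := Nat.clog 3 (sizeCount N ε₀ δ₀))
    (g := lossCount N ηstar) hN hNe hM hMe O hη1R hη ?_ (baseLoss_pos hN hη1)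
    (three_mul_baseLoss_le hN2 hloss) lossCount_pos ?_ rfl hε₀R hδ₀R ?_
    (errorUnit_mul_exp_le hNe hM hMe hδ₀) (exp_degree_mul_exp_le hε₀) hεle' hεδ hδle' hO
  · unfold baseLoss
    have : 0 < 1 / (64 * (N : ℝ)) := by positivity
    linarith
  · have : baseLoss N ηstar * N = (1 - ηstar) * N + 1 / 64 := by
      unfold baseLoss; field_simp
    rw [this]; linarith
  · calc (N : ℝ) = ε₀ * δ₀ * (N * (ε₀ : ℝ)⁻¹ * (δ₀ : ℝ)⁻¹) := by field_simp
      _ ≤ _ := by gcongr; exact hUc.trans hcp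

end ErrorBounds

/-! ### From the estimate to a solution in polynomial time -/

section Solution

variable {γ c : ℝ} {s : SqueezingRule}

instance : IsProbabilityMeasure coinLaw := by unfold coinLaw; infer_instance

/-- An output that ignores the coins is right with probability `0` or `1`, so the threshold `2/3`
holds wherever the estimate is accurate. -/
lemma solvesGHE_of_output_eq {p : Program} {K N M : ℕ} {ηstar ε₀ δ₀ : ℚ} {O : Oracle N M}
    (f : Matrix (Fin N) (Fin M) ℂ → ℝ)
    (htime : ∀ (X : Matrix (Fin N) (Fin M) ℂ) (ω : ℕ → Bool),
      ((p.run O X ω (initial N M ηstar ε₀ δ₀)).time : ℝ) ≤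
        K * ((N : ℝ) + (ε₀ : ℝ)⁻¹ + (δ₀ : ℝ)⁻¹ + paramBits ηstar ε₀ δ₀) ^ K)
    (hout : ∀ X ω, (p.run O X ω (initial N M ηstar ε₀ δ₀)).output = f X)
    (hf : gaussianLaw N M {X | ¬ ‖((f (Matrix.of X) : ℝ) : ℂ) - idealProb (Matrix.of X)‖ ≤
      ε₀ * errorUnit N M} ≤ ENNReal.ofReal δ₀) : SolvesGHE p K ηstar ε₀ δ₀ O := by
  refine ⟨htime, (measure_mono fun X hX => ?_).trans hf⟩
  intro hgood
  simp only [Set.mem_ofPred_eq, hout, hgood, Set.ofPred_true, measure_univ] at hX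
  exact absurd hX (not_lt.2 (ENNReal.div_le_of_le_mul (by norm_num)))

/-- Replaces `ε₀` and `δ₀` by their minima with `1`. -/
def clampProgram : Program :=
  .seq (.branch (.sub (.reg 4) (.reg 5)) (.seq (.assign 4 (.lit 1)) (.assign 5 (.lit 1))) .skip)
    (.branch (.sub (.reg 6) (.reg 7)) (.seq (.assign 6 (.lit 1)) (.assign 7 (.lit 1))) .skip)

lemma wp_clampProgram {N M : ℕ} {ηstar ε₀ δ₀ : ℚ} {O : Oracle N M}
    {X : Matrix (Fin N) (Fin M) ℂ} {m : ℕ → ℤ} {Q : (ℕ → ℤ) → Prop} {G L : ℕ} (hG : 1 ≤ G)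
    (h : HoldsInput N M ηstar ε₀ δ₀ m)
    (hQ : ∀ m', HoldsInput N M ηstar (min ε₀ 1) (min δ₀ 1) m' → Q m') :
    clampProgram.wp O X G L Q m := by
  have hcond : ∀ (a b : ℕ) (x : ℚ) (m' : ℕ → ℤ), m' a = x.num → m' b = x.den →
      (0 < (Expr.sub (.reg a) (.reg b)).val m' ↔ ¬ x ≤ 1) := by
    intro a b x m' ha hb
    simp only [Expr.val, ha, hb]
    rw [← Rat.num_le_denom_iff, not_le, sub_pos]
  have key : ∀ m', HoldsInput N M ηstar (min ε₀ 1) δ₀ m' →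
      (Program.branch (.sub (.reg 6) (.reg 7)) (.seq (.assign 6 (.lit 1)) (.assign 7 (.lit 1)))
        .skip).wp O X G L Q m' := by
    intro m' h'
    simp only [Program.wp]
    by_cases hδ : δ₀ ≤ 1
    · rw [if_neg (fun h0 => (hcond 6 7 δ₀ m' (h' 6 (by norm_num)) (h' 7 (by norm_num))).1 h0 hδ)]
      refine hQ _ ?_
      rwa [min_eq_left hδ]
    · rw [if_pos ((hcond 6 7 δ₀ m' (h' 6 (by norm_num)) (h' 7 (by norm_num))).2 hδ)]
      refine ⟨by simpa [Expr.val, bits_one] using hG, by simpa [Expr.val, bits_one] using hG,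
        hQ _ ?_⟩
      rw [min_eq_right (not_le.1 hδ).le]
      intro r hr
      have := h' r hr
      interval_cases r <;> simp_all [Function.update, Expr.val, initial]
  simp only [clampProgram, Program.wp.eq_3, Program.wp.eq_4]
  by_cases hε : ε₀ ≤ 1
  · rw [if_neg (fun h0 => (hcond 4 5 ε₀ m (h 4 (by norm_num)) (h 5 (by norm_num))).1 h0 hε)]
    refine key _ ?_
    rwa [min_eq_left hε]
  · rw [if_pos ((hcond 4 5 ε₀ m (h 4 (by norm_num)) (h 5 (by norm_num))).2 hε)]
    refine ⟨by simpa [Expr.val, bits_one] using hG, by simpa [Expr.val, bits_one] using hG,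
      key _ ?_⟩
    rw [min_eq_right (not_le.1 hε).le]
    intro r hr
    have := h r hr
    interval_cases r <;> simp_all [Function.update, Expr.val, initial]

namespace Parameters

lemma wp_extrapolation_estimate (x : Parameters γ c) {L : ℕ} (hL : x.inputBound ≤ L)
    (hη : 3 / 4 ≤ (x.ηstar : ℝ)) (hu3 : 3 * baseLoss x.N x.ηstar ≤ 1 / 4) {O : Oracle x.N x.M}
    {X : Matrix (Fin x.N) (Fin x.M) ℂ} {m : ℕ → ℤ}
    (h : HoldsInput x.N x.M x.ηstar x.ε₀ x.δ₀ m) :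
    (extrapolation s).wp O X (NodeData.regBits s L) L (fun m' => (m' 0 : ℝ) / (m' 1 : ℝ) =
      estimate s x.ηstar (baseLoss x.N x.ηstar) (degree x.N x.ηstar x.ε₀ x.δ₀)
        (precision x.N x.M x.ηstar x.ε₀ x.δ₀) O X) m := by
  refine wp_extrapolation h x.η_le x.ε_pos x.δ_pos ?_ (x.bounded_inputBound hL) fun m' h0 h1 => ?_
  · unfold inputBound at hL; omega
  · rw [h0, h1, ← output_eq_estimate x.N_pos (baseLoss_pos x.N_pos x.η_le) hu3 hη]
    push_cast
    rfl

/-- The parameters with `ε₀` and `δ₀` replaced by their minima with `1`. -/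
def clamp (x : Parameters γ c) : Parameters γ c where
  N := x.N
  M := x.M
  ηstar := x.ηstar
  ε₀ := min x.ε₀ 1
  δ₀ := min x.δ₀ 1
  N_pos := x.N_pos
  M_le := x.M_le
  η_pos := x.η_pos
  η_le := x.η_le
  ε_pos := lt_min x.ε_pos one_pos
  δ_pos := lt_min x.δ_pos one_pos

lemma inv_min_one_le {y : ℚ} (hy : 0 < y) : ((min y 1 : ℚ) : ℝ)⁻¹ ≤ (y : ℝ)⁻¹ + 1 := by
  have hy' : (0 : ℝ) ≤ (y : ℝ)⁻¹ := by positivity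
  rcases le_total y 1 with h | h
  · rw [min_eq_left h]; linarith
  · rw [min_eq_right h]; simp [hy.le]

lemma bits_min_one_le {y : ℚ} (hy : 0 < y) :
    bits (min y 1).num + bits (min y 1).den ≤ bits y.num + bits y.den := by
  rcases le_total y 1 with h | h
  · rw [min_eq_left h]
  · rw [min_eq_right h]
    have h1 := bits_pos (a := y.num) (Rat.num_pos.2 hy).ne'
    have h2 := bits_pos (a := y.den) (by simp)
    simp only [Rat.num_ofNat, Rat.den_ofNat, Nat.cast_one, bits_one]
    omega

lemma base_clamp_le (x : Parameters γ c) : x.clamp.base ≤ x.base ^ 2 := by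
  have h1 := inv_min_one_le x.ε_pos
  have h2 := inv_min_one_le x.δ_pos
  have h3 : paramBits x.ηstar (min x.ε₀ 1) (min x.δ₀ 1) ≤ paramBits x.ηstar x.ε₀ x.δ₀ := by
    have h1 := bits_min_one_le x.ε_pos
    have h2 := bits_min_one_le x.δ_pos
    unfold paramBits
    omega
  have h4 : (paramBits x.ηstar (min x.ε₀ 1) (min x.δ₀ 1) : ℝ) ≤ paramBits x.ηstar x.ε₀ x.δ₀ := by
    exact_mod_cast h3
  have h5 := x.two_le_base
  have h6 : x.clamp.base ≤ x.base + 2 := by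
    simp only [base, clamp] at *
    linarith
  -- `base + 2 ≤ base²` because `base ≥ 2`.
  nlinarith

/-- A bound for the numbers of bits of the input, of the clamped input and for the loop counts. -/
def clampBound (x : Parameters γ c) : ℕ :=
  x.clamp.inputBound + (x.N + x.M + paramBits x.ηstar x.ε₀ x.δ₀)

lemma polyBounded_clampBound : PolyBounded (base (γ := γ) (c := c)) clampBound := by
  have hb := two_le_base (γ := γ) (c := c)
  refine PolyBounded.add hb ?_ (polyBounded_inputBound.mono fun x => ?_)
  · obtain ⟨k, hk⟩ := polyBounded_inputBound (γ := γ) (c := c)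
    refine ⟨2 * k, fun x => (hk x.clamp).trans ?_⟩
    rw [pow_mul]
    exact pow_le_pow_left₀ (by linarith [hb x.clamp]) x.base_clamp_le k
  · unfold inputBound; omega

lemma le_mul_base_pow (x : Parameters γ c) {t k K : ℕ} (hk : (t : ℝ) ≤ x.base ^ k) (hkK : k ≤ K)
    (hK : 0 < K) : (t : ℝ) ≤ K * x.base ^ K := by
  have h1 := x.two_le_base
  have h2 : (1 : ℝ) ≤ K := by exact_mod_cast hK
  calc (t : ℝ) ≤ x.base ^ K := hk.trans (pow_le_pow_right₀ (by linarith) hkK)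
    _ ≤ K * x.base ^ K := le_mul_of_one_le_left (by positivity) h2

end Parameters

/-- Running times that are polynomial in the size of the input and the error bounds. -/
lemma exists_solvesGHE (γ c : ℝ) (s : SqueezingRule) : ∃ K₀ : ℕ, ∀ K : ℕ, K₀ ≤ K → 0 < K →
    ∀ (x : Parameters γ c) (O : Oracle x.N x.M), 3 / 4 ≤ (x.ηstar : ℝ) →
      3 * baseLoss x.N x.ηstar ≤ 1 / 4 →
      gaussianLaw x.N x.M {X | ¬ ‖((estimate s x.ηstar (baseLoss x.N x.ηstar)
        (degree x.N x.ηstar x.ε₀ x.δ₀) (precision x.N x.M x.ηstar x.ε₀ x.δ₀) O (Matrix.of X) : ℝ) :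
          ℂ) - idealProb (Matrix.of X)‖ ≤ x.ε₀ * errorUnit x.N x.M} ≤ ENNReal.ofReal x.δ₀ →
      SolvesGHE (extrapolation s) K x.ηstar x.ε₀ x.δ₀ O := by
  have hL := Parameters.polyBounded_inputBound (γ := γ) (c := c)
  obtain ⟨k, hk⟩ := PolyBounded.timeBound Parameters.two_le_base
    (Parameters.polyBounded_regBits s hL) hL (extrapolation s)
  refine ⟨k, fun K hkK hK x O hη hu3 hmeas => ?_⟩
  have hbits : BitBounded (NodeData.regBits s x.inputBound)
      (initial x.N x.M x.ηstar x.ε₀ x.δ₀).reg := fun r => (x.bits_initial_le r).trans (by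
    have : x.N + x.M + paramBits x.ηstar x.ε₀ x.δ₀ ≤ x.inputBound := by
      unfold Parameters.inputBound; omega
    unfold NodeData.regBits; omega)
  have hrun := fun X ω => Program.wp_sound O X ω (NodeData.regBits s x.inputBound) x.inputBound
    (extrapolation s) _ (initial x.N x.M x.ηstar x.ε₀ x.δ₀) hbits
    (x.wp_extrapolation_estimate le_rfl hη hu3 fun _ _ => rfl)
  refine solvesGHE_of_output_eq _ (fun X ω => ?_) (fun X ω => (hrun X ω).2.1) hmeas
  refine x.le_mul_base_pow (le_trans ?_ (hk x)) hkK hK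
  have := (hrun X ω).2.2
  simp only [initial, zero_add] at this
  exact_mod_cast this

/-- Error bounds above `1` could make `logSize` small or negative. Solving with the minima is a
stronger task, and it changes the size of the input only polynomially. -/
lemma exists_solvesGHE_clamp (γ c : ℝ) (s : SqueezingRule) : ∃ K₀ : ℕ, ∀ K : ℕ, K₀ ≤ K → 0 < K →
    ∀ (x : Parameters γ c) (O : Oracle x.N x.M), 3 / 4 ≤ (x.ηstar : ℝ) →
      3 * baseLoss x.N x.ηstar ≤ 1 / 4 →
      gaussianLaw x.N x.M {X | ¬ ‖((estimate s x.ηstar (baseLoss x.N x.ηstar)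
        (degree x.N x.ηstar (min x.ε₀ 1) (min x.δ₀ 1))
        (precision x.N x.M x.ηstar (min x.ε₀ 1) (min x.δ₀ 1)) O (Matrix.of X) : ℝ) : ℂ) -
          idealProb (Matrix.of X)‖ ≤ (min x.ε₀ 1 : ℚ) * errorUnit x.N x.M} ≤
        ENNReal.ofReal (min x.δ₀ 1 : ℚ) →
      SolvesGHE (.seq clampProgram (extrapolation s)) K x.ηstar x.ε₀ x.δ₀ O := by
  have hL := Parameters.polyBounded_clampBound (γ := γ) (c := c)
  obtain ⟨k, hk⟩ := PolyBounded.timeBound Parameters.two_le_base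
    (Parameters.polyBounded_regBits s hL) hL (.seq clampProgram (extrapolation s))
  refine ⟨k, fun K hkK hK x O hη hu3 hmeas => ?_⟩
  have hbits : BitBounded (NodeData.regBits s x.clampBound)
      (initial x.N x.M x.ηstar x.ε₀ x.δ₀).reg := fun r => (x.bits_initial_le r).trans (by
    have : x.N + x.M + paramBits x.ηstar x.ε₀ x.δ₀ ≤ x.clampBound := by
      unfold Parameters.clampBound; omega
    unfold NodeData.regBits; omega)
  have hrun := fun X ω => Program.wp_sound O X ω (NodeData.regBits s x.clampBound) x.clampBound
    (.seq clampProgram (extrapolation s)) _ (initial x.N x.M x.ηstar x.ε₀ x.δ₀) hbits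
    (wp_clampProgram (by unfold NodeData.regBits; omega) (fun _ _ => rfl) fun m' hm' =>
      x.clamp.wp_extrapolation_estimate (L := x.clampBound) (Nat.le_add_right _ _) hη hu3 hm')
  have hε : ((min x.ε₀ 1 : ℚ) : ℝ) ≤ x.ε₀ := by exact_mod_cast min_le_left _ _
  have hδ : ((min x.δ₀ 1 : ℚ) : ℝ) ≤ x.δ₀ := by exact_mod_cast min_le_left _ _
  have hB : 0 ≤ errorUnit x.N x.M := by unfold errorUnit; positivity
  refine solvesGHE_of_output_eq _ (fun X ω => ?_) (fun X ω => (hrun X ω).2.1) ?_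
  · refine x.le_mul_base_pow (le_trans ?_ (hk x)) hkK hK
    have := (hrun X ω).2.2
    simp only [initial, zero_add] at this
    exact_mod_cast this
  · refine le_trans (measure_mono ?_) (hmeas.trans (ENNReal.ofReal_le_ofReal hδ))
    intro X hX h
    exact hX (h.trans (by gcongr))

end Solution

/-! ### The exponent `α` and the regime of logarithmic loss -/

section Thresholds

/-- Already `χ ≥ 1` and `log 2.1 ≥ log 2` give `6 · 1.69 · 7.38 + 3 > 77`. -/
lemma sixty_eight_le_alpha {N : ℕ} {ε₀ δ₀ : ℝ} (hlog : Real.exp 1 ≤ logSize N ε₀ δ₀) :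
    68 ≤ alpha N ε₀ δ₀ := by
  have he : (2.7182818283 : ℝ) < Real.exp 1 := Real.exp_one_gt_d9
  have h1 : 1 ≤ chi N ε₀ δ₀ := by
    refine Real.one_le_exp (div_nonneg (Real.log_nonneg ?_) ?_) <;> linarith
  have h2 : (0.6931471803 : ℝ) ≤ Real.log 2.1 :=
    Real.log_two_gt_d9.le.trans (Real.log_le_log (by norm_num) (by norm_num))
  have h3 : (7.38 : ℝ) ≤ Real.exp 1 ^ 2 := by nlinarith
  have h4 : 6 * (1 + 0.6931471803 : ℝ) * 7.38 * 1 ≤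
      6 * (1 + Real.log 2.1) * Real.exp 1 ^ 2 * chi N ε₀ δ₀ := by gcongr
  unfold alpha
  norm_num at h4 ⊢
  linarith

/-- Inverse polynomial errors are small enough when the loss is logarithmic. -/
lemma exists_inv_poly_le {A C : ℝ} (hA : 0 ≤ A) (hC : 0 < C) : ∃ K₀ : ℕ, ∀ K : ℕ, K₀ ≤ K →
    ∀ (N : ℕ) (η : ℝ) (ε₀ δ₀ : ℚ), 0 < N → 3 / 4 ≤ η → η ≤ 1 → (1 - η) * N ≤ A * Real.log N →
      0 < ε₀ → 0 < δ₀ → 0 < logSize N (min ε₀ 1 : ℚ) (min δ₀ 1 : ℚ) →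
      (K * ((N : ℝ) + (ε₀ : ℝ)⁻¹ + (δ₀ : ℝ)⁻¹) ^ K)⁻¹ ≤
        C * (((min ε₀ 1 : ℚ) : ℝ) ^ 3 * ((min δ₀ 1 : ℚ) : ℝ) ^ 2 * ((N : ℝ) ^ 3)⁻¹ *
          Real.exp (-(68 * kStar N η))) ∧
      (K * ((N : ℝ) + (ε₀ : ℝ)⁻¹ + (δ₀ : ℝ)⁻¹) ^ K)⁻¹ ≤
        C * (((min δ₀ 1 : ℚ) : ℝ) / (kStar N η + logSize N (min ε₀ 1 : ℚ) (min δ₀ 1 : ℚ))) := by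
  -- `k* ≤ (4/3)(1 - η) N` and `68 · 4/3 < 91`, so `e^(68 k*) ≤ N^m`. The `8` chosen below is `3 + 2
  -- + 3`, the exponents of `ε₀`, `δ₀` and `N`.
  obtain ⟨m, hm⟩ := exists_nat_ge (91 * A)
  obtain ⟨l, hl⟩ := exists_nat_ge (C⁻¹ * (2 * A + 3))
  refine ⟨m + 8 + l, fun K hK N η ε₀ δ₀ hN hη hη1 hloss hε₀ hδ₀ hsize => ?_⟩
  have hN' : (1 : ℝ) ≤ N := by exact_mod_cast hN
  have hε₀R : (0 : ℝ) < ε₀ := by exact_mod_cast hε₀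
  have hδ₀R : (0 : ℝ) < δ₀ := by exact_mod_cast hδ₀
  set S : ℝ := (N : ℝ) + (ε₀ : ℝ)⁻¹ + (δ₀ : ℝ)⁻¹ with hS
  have hεi : 0 < (ε₀ : ℝ)⁻¹ := by positivity
  have hδi : 0 < (δ₀ : ℝ)⁻¹ := by positivity
  have hNS : (N : ℝ) ≤ S := by linarith
  have hS1 : 1 ≤ S := by linarith
  -- After clamping, one factor of `S` compensates each factor `ε₀` or `δ₀`: `S` is at least the
  -- inverse, and at least `1` when the minimum is `1`.
  have hSmin : ∀ y : ℚ, 0 < y → (y : ℝ)⁻¹ ≤ S → 0 < ((min y 1 : ℚ) : ℝ) ∧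
      1 ≤ S * ((min y 1 : ℚ) : ℝ) := by
    intro y hy hyS
    have hyR : (0 : ℝ) < y := by exact_mod_cast hy
    rcases le_total y 1 with h | h
    · rw [min_eq_left h]
      exact ⟨hyR, (inv_le_iff_one_le_mul₀ hyR).1 hyS⟩
    · rw [min_eq_right h]
      simpa using hS1
  obtain ⟨hε1, hε2⟩ := hSmin ε₀ hε₀ (by linarith)
  obtain ⟨hδ1, hδ2⟩ := hSmin δ₀ hδ₀ (by linarith)
  have hKC : 2 * A + 3 ≤ K * C := by
    have h1 : C⁻¹ * (2 * A + 3) ≤ K := hl.trans (by exact_mod_cast (by omega : l ≤ K))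
    rwa [inv_mul_le_iff₀ hC, mul_comm C] at h1
  have hk := (kStar_bounds (N := N) hη hη1).2
  have hlogN : 0 ≤ Real.log N := Real.log_nonneg hN'
  have hlogS : ∀ y : ℝ, 0 < y → y ≤ S → Real.log y ≤ S := fun y hy hyS =>
    (Real.log_le_self hy.le).trans hyS
  have hK0 : (0 : ℝ) < K := by
    have : 0 < K * C := by linarith
    exact pos_of_mul_pos_left this hC.le
  have hkn : 0 ≤ kStar N η :=
    le_trans (mul_nonneg (by linarith) (by linarith)) (kStar_bounds (N := N) hη hη1).1
  generalize hkk : kStar N η = k at *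
  generalize ((min ε₀ 1 : ℚ) : ℝ) = e at *
  generalize ((min δ₀ 1 : ℚ) : ℝ) = f at *
  constructor
  · have h1 : 1 ≤ S ^ m * Real.exp (-(68 * k)) := by
      rw [Real.exp_neg, ← div_eq_mul_inv, le_div_iff₀ (Real.exp_pos _), one_mul]
      calc Real.exp (68 * k) ≤ Real.exp (Real.log N * m) := by
            refine Real.exp_le_exp.2 ?_
            nlinarith
        _ = (N : ℝ) ^ m := by rw [mul_comm, Real.exp_nat_mul, Real.exp_log (by linarith)]
        _ ≤ S ^ m := by gcongr
    have h2 : 1 ≤ S ^ 3 * ((N : ℝ) ^ 3)⁻¹ := by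
      rw [← div_eq_mul_inv, le_div_iff₀ (by positivity), one_mul]
      gcongr
    have h3 : S ^ (m + 8) ≤ S ^ K := pow_le_pow_right₀ hS1 (by omega)
    rw [inv_le_iff_one_le_mul₀ (by positivity)]
    calc (1 : ℝ) ≤ (K * C) * ((S * e) ^ 3 * (S * f) ^ 2 * (S ^ 3 * ((N : ℝ) ^ 3)⁻¹) *
          (S ^ m * Real.exp (-(68 * k)))) := by
          refine one_le_mul_of_one_le_of_one_le (by linarith) ?_
          refine one_le_mul_of_one_le_of_one_le ?_ h1
          refine one_le_mul_of_one_le_of_one_le ?_ h2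
          exact one_le_mul_of_one_le_of_one_le (one_le_pow₀ hε2) (one_le_pow₀ hδ2)
      _ = C * (e ^ 3 * f ^ 2 * ((N : ℝ) ^ 3)⁻¹ * Real.exp (-(68 * k))) * (K * S ^ (m + 8)) := by
          ring
      _ ≤ _ := by gcongr
  · have hsz : logSize N e f ≤ 3 * S := by
      have h1 : Real.log e⁻¹ ≤ S := hlogS _ (by positivity) ((inv_le_iff_one_le_mul₀ hε1).2 hε2)
      have h2 : Real.log f⁻¹ ≤ S := hlogS _ (by positivity) ((inv_le_iff_one_le_mul₀ hδ1).2 hδ2)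
      have h3 := hlogS N (by linarith) hNS
      unfold logSize
      rw [Real.log_mul (by positivity) (by positivity), Real.log_mul (by positivity) (by positivity)]
      linarith
    have hk2 : k ≤ 2 * A * S := by
      have := hlogS N (by linarith) hNS
      have : A * Real.log N ≤ A * S := by gcongr
      have : 0 ≤ A * S := by positivity
      linarith
    have h3 : S ^ 2 ≤ S ^ K := pow_le_pow_right₀ hS1 (by omega)
    have hpos : 0 < k + logSize N e f := by linarith
    rw [inv_le_iff_one_le_mul₀ (by positivity), mul_comm, ← mul_assoc, ← mul_div_assoc,
      le_div_iff₀ hpos, one_mul]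
    calc k + logSize N e f ≤ (2 * A + 3) * S := by linarith
      _ ≤ (K * C) * S := by gcongr
      _ ≤ (K * C) * S * (S * f) := le_mul_of_one_le_right (by positivity) hδ2
      _ = K * S ^ 2 * C * f := by ring
      _ ≤ _ := by gcongr

/-- Divided by `N`, this places a logarithmic loss inside the range `1 - η* ≤ 1 / (12 √N)` for large
`N`. -/
lemma eventually_mul_log_le (A : ℝ) : ∀ᶠ N : ℕ in Filter.atTop,
    A * Real.log N ≤ Real.sqrt N / 12 := by
  have h := (isLittleO_log_rpow_atTop (r := 1 / 2) (by norm_num)).comp_tendsto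
    tendsto_natCast_atTop_atTop
  have h2 := h.bound (c := 1 / (12 * (|A| + 1))) (by positivity)
  filter_upwards [h2, Filter.eventually_ge_atTop 1] with N hN hN1
  have hN1' : (1 : ℝ) ≤ N := by exact_mod_cast hN1
  simp only [Function.comp, Real.norm_eq_abs] at hN
  rw [← Real.sqrt_eq_rpow, abs_of_nonneg (Real.log_nonneg hN1'),
    abs_of_nonneg (Real.sqrt_nonneg _)] at hN
  have h3 : A ≤ |A| + 1 := (le_abs_self A).trans (by linarith)
  have h4 := Real.log_nonneg hN1'
  calc A * Real.log N ≤ (|A| + 1) * Real.log N := by gcongr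
    _ ≤ (|A| + 1) * (1 / (12 * (|A| + 1)) * Real.sqrt N) := by gcongr
    _ = Real.sqrt N / 12 := by field_simp

end Thresholds

end LossyGBS

end

/-! ### The two regimes of loss -/

theorem theorem1 (s : LossyGBS.SqueezingRule) (γ c₁ c₂ : ℝ)
    (hγ : 2 < γ) (hc₁ : 0 < c₁) (hc₂ : 0 < c₂) :
    -- Logarithmic loss: errors inverse polynomial in N, 1/ε₀, 1/δ₀ suffice.
    (∀ ηth : ℕ → ℝ,
      (fun N : ℕ => (1 - ηth N) * (N : ℝ)) =O[Filter.atTop] (fun N : ℕ => Real.log N) →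
      ∃ (p : LossyGBS.Program) (K N₀ : ℕ), 0 < K ∧
        ∀ N M : ℕ, N₀ ≤ N → LossyGBS.Dilute γ c₁ c₂ N M →
        ∀ ηstar ε₀ δ₀ : ℚ, ηth N ≤ ηstar → ηstar ≤ 1 → 0 < ε₀ → 0 < δ₀ →
        ∀ ε δ : ℝ, 0 < ε → 0 < δ →
          ε ≤ (K * ((N : ℝ) + (ε₀ : ℝ)⁻¹ + (δ₀ : ℝ)⁻¹) ^ K)⁻¹ →
          δ ≤ (K * ((N : ℝ) + (ε₀ : ℝ)⁻¹ + (δ₀ : ℝ)⁻¹) ^ K)⁻¹ →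
        ∀ O : LossyGBS.Oracle N M, LossyGBS.SolvesGHED s ηstar ε δ O →
          LossyGBS.SolvesGHE p K ηstar ε₀ δ₀ O) ∧
    -- General loss: explicit error bounds.
    (∃ (C : ℝ) (p : LossyGBS.Program) (K : ℕ), 0 < C ∧
        ∀ N M : ℕ, LossyGBS.Dilute γ c₁ c₂ N M →
        ∀ ηstar ε₀ δ₀ : ℚ, 1 - (ηstar : ℝ) ≤ 1 / (12 * Real.sqrt N) → ηstar ≤ 1 →
          0 < ε₀ → 0 < δ₀ → Real.exp 1 ≤ LossyGBS.logSize N ε₀ δ₀ →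
        ∀ ε δ : ℝ, 0 < ε → 0 < δ →
          ε ≤ C * ((ε₀ : ℝ) ^ 3 * (δ₀ : ℝ) ^ 2 * ((N : ℝ) ^ 3)⁻¹ *
            Real.exp (-(LossyGBS.alpha N ε₀ δ₀ * LossyGBS.kStar N ηstar))) →
          δ ≤ C * ((δ₀ : ℝ) / (LossyGBS.kStar N ηstar + LossyGBS.logSize N ε₀ δ₀)) →
        ∀ O : LossyGBS.Oracle N M, LossyGBS.SolvesGHED s ηstar ε δ O →
          LossyGBS.SolvesGHE p K ηstar ε₀ δ₀ O) := by
  have hMpos : ∀ N M : ℕ, LossyGBS.Dilute γ c₁ c₂ N M → 0 < M := fun N M h => by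
    have h1 : (0 : ℝ) < N := by exact_mod_cast h.pos
    have h2 : (0 : ℝ) < M := lt_of_lt_of_le (by positivity) h.lower
    exact_mod_cast h2
  have htwo : ∀ N M : ℕ, LossyGBS.Dilute γ c₁ c₂ N M → 2 ≤ N := fun N M h => by
    obtain ⟨k, hk⟩ := h.even_photons
    have := h.pos
    omega
  have hnonneg : ∀ ηstar : ℚ, 3 / 4 ≤ (ηstar : ℝ) → 0 ≤ ηstar := fun ηstar h => by
    have h1 : (0 : ℝ) ≤ ηstar := by linarith
    exact_mod_cast h1
  constructor
  · intro ηth hηth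
    obtain ⟨A, hA, hbound⟩ := hηth.exists_pos
    obtain ⟨N₀, hN₀⟩ := Filter.eventually_atTop.1 ((hbound.bound.and
      (LossyGBS.eventually_mul_log_le A)).and
      -- The clamped inverses are at least `1`, so `N ≥ e^e` alone forces the clamped `logSize` to
      -- be at least `e`.
      (tendsto_natCast_atTop_atTop.eventually_ge_atTop (Real.exp (Real.exp 1))))
    obtain ⟨K₁, hK₁⟩ := LossyGBS.exists_solvesGHE_clamp γ c₂ s
    obtain ⟨K₂, hK₂⟩ := LossyGBS.exists_inv_poly_le (A := A) (C := Real.exp (-68) / 64) hA.le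
      (by positivity)
    refine ⟨.seq LossyGBS.clampProgram (LossyGBS.extrapolation s), K₁ + K₂ + 1, N₀, by omega, ?_⟩
    intro N M hN hD ηstar ε₀ δ₀ hη hη1 hε₀ hδ₀ ε δ hε hδ hεle hδle O hO
    obtain ⟨⟨h1, h2⟩, h3⟩ := hN₀ N hN
    have hNpos : (0 : ℝ) < N := by exact_mod_cast hD.pos
    have hη1R : (ηstar : ℝ) ≤ 1 := by exact_mod_cast hη1
    have hlogN : 0 ≤ Real.log N := Real.log_nonneg (by exact_mod_cast hD.pos)
    have hlossN : (1 - (ηstar : ℝ)) * N ≤ A * Real.log N := by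
      rw [Real.norm_eq_abs, Real.norm_eq_abs, abs_of_nonneg hlogN] at h1
      refine le_trans ?_ ((le_abs_self _).trans h1)
      gcongr
    have hloss : 1 - (ηstar : ℝ) ≤ 1 / (12 * Real.sqrt N) := by
      have h4 : 0 < Real.sqrt N := Real.sqrt_pos.2 hNpos
      have h5 : Real.sqrt N * Real.sqrt N = N := Real.mul_self_sqrt hNpos.le
      have h6 := hlossN.trans h2
      rw [le_div_iff₀ (by positivity)]
      refine le_of_mul_le_mul_right ?_ h4
      calc (1 - (ηstar : ℝ)) * (12 * Real.sqrt N) * Real.sqrt N =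
            12 * ((1 - ηstar) * (Real.sqrt N * Real.sqrt N)) := by ring
        _ = 12 * ((1 - ηstar) * N) := by rw [h5]
        _ ≤ 1 * Real.sqrt N := by linarith
    have hη34 := LossyGBS.le_rate_of_loss_le hD.pos hloss
    have hε' : 0 < min ε₀ 1 := lt_min hε₀ one_pos
    have hδ' : 0 < min δ₀ 1 := lt_min hδ₀ one_pos
    have hlog : Real.exp 1 ≤ LossyGBS.logSize N (min ε₀ 1 : ℚ) (min δ₀ 1 : ℚ) := by
      have h4 : ∀ y : ℚ, 0 < y → 1 ≤ ((min y 1 : ℚ) : ℝ)⁻¹ := fun y hy => by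
        refine (one_le_inv₀ ?_).2 ?_
        · exact_mod_cast lt_min hy one_pos
        · exact_mod_cast min_le_right _ _
      rw [LossyGBS.logSize, Real.le_log_iff_exp_le]
      · calc Real.exp (Real.exp 1) ≤ N * 1 * 1 := by simpa using h3
          _ ≤ _ := by
            have := h4 ε₀ hε₀
            have := h4 δ₀ hδ₀
            gcongr
      · have := h4 ε₀ hε₀
        have := h4 δ₀ hδ₀
        positivity
    obtain ⟨g1, g2⟩ := hK₂ (K₁ + K₂ + 1) (by omega) N ηstar ε₀ δ₀ hD.pos hη34 hη1R hlossN hε₀ hδ₀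
      ((Real.exp_pos 1).trans_le hlog)
    exact hK₁ _ (by omega) (by omega)
      ⟨N, M, ηstar, ε₀, δ₀, hD.pos, hD.upper, hnonneg _ hη34, hη1, hε₀, hδ₀⟩ O hη34
      (LossyGBS.three_mul_baseLoss_le (htwo N M hD) hloss)
      (LossyGBS.measure_estimate_error_le_of_bounds s hD.pos hD.even_photons (hMpos N M hD)
        hD.even_modes O hη1 hloss hε' hδ' hlog hε hδ (hεle.trans g1) (hδle.trans g2) hO)
  · obtain ⟨K, hK⟩ := LossyGBS.exists_solvesGHE γ c₂ s
    refine ⟨Real.exp (-68) / 64, LossyGBS.extrapolation s, K + 1, by positivity, ?_⟩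
    intro N M hD ηstar ε₀ δ₀ hloss hη1 hε₀ hδ₀ hlog ε δ hε hδ hεle hδle O hO
    have hη1R : (ηstar : ℝ) ≤ 1 := by exact_mod_cast hη1
    have hη34 := LossyGBS.le_rate_of_loss_le hD.pos hloss
    have hk : 0 ≤ LossyGBS.kStar N ηstar :=
      le_trans (mul_nonneg (by linarith) (by positivity))
        (LossyGBS.kStar_bounds (N := N) hη34 hη1R).1
    -- The extrapolation tolerates errors of order `e^(-68 k*)`; as `k* ≥ 0`, the bound with `α` in
    -- place of `68` is more restrictive.
    have hα := LossyGBS.sixty_eight_le_alpha hlog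
    refine hK _ (by omega) (by omega)
      ⟨N, M, ηstar, ε₀, δ₀, hD.pos, hD.upper, hnonneg _ hη34, hη1, hε₀, hδ₀⟩ O hη34
      (LossyGBS.three_mul_baseLoss_le (htwo N M hD) hloss)
      (LossyGBS.measure_estimate_error_le_of_bounds s hD.pos hD.even_photons (hMpos N M hD)
        hD.even_modes O hη1 hloss hε₀ hδ₀ hlog hε hδ (hεle.trans ?_) hδle hO)
    have hε₀R : (0 : ℝ) < ε₀ := by exact_mod_cast hε₀
    gcongr
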